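/- **Theorem.** A $3$-graph is a hypergraph all of whose edges have exactly three vertices, and $K_n^3$ denotes the complete $3$-graph on $n$ vertices. For $k\ge 1$, the $k$-star $\mathcal F_k$ is the $3$-graph consisting of $k$ edges that all contain a common vertex (the core) and pairwise have no other vertex in common. Let $f(n,k)$ be the maximum number of edges of a $3$-graph on $n$ vertices that contains no copy of $\mathcal F_k$ as a (not necessarily induced) subhypergraph. Let $ar_3(n,\mathcal F_k)$ be the minimum positive integer $t$ such that every colouring of the edges of $K_n^3$ that uses exactly $t$ colours contains a rainbow copy of $\mathcal F_k$, that is, a copy of $\mathcal F_k$ whose edges have pairwise distinct colours. Then for all integers $k\ge 3$ and $n>\frac52k^3+\frac{15}{2}k^2+26k-3$, $$ar_3(n,\mathcal F_{k+1})=f(n,k)+2 .$$ -/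

import Mathlib

/-! Hypergraphs on a vertex type `V` are given by their edge sets, `H : Finset (Finset V)`; such an
`H` is an `r`-graph (an `r`-uniform hypergraph) when `(H : Set (Finset V)).Sized r`.  Hypergraphs of
order `n` have vertex type `Fin n`. -/

namespace AntiRamsey

/-- `H` contains a copy of `F` as a (not necessarily induced) subhypergraph. -/
def ContainsCopy {W V : Type*} (F : Finset (Finset W)) (H : Finset (Finset V)) : Prop :=
  ∃ φ : W ↪ V, ∀ e ∈ F, e.map φ ∈ H

/-- The Turán number `ex_r(n, F)`: the largest number of edges of an `r`-graph on `n` vertices which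
contains no copy of `F`.  (The set below is bounded, and it is nonempty as soon as `F` has an
edge, so that the supremum is a maximum.) -/
noncomputable def turanNumber {W : Type*} (r n : ℕ) (F : Finset (Finset W)) : ℕ :=
  sSup {m : ℕ | ∃ H : Finset (Finset (Fin n)),
    (H : Set (Finset (Fin n))).Sized r ∧ ¬ ContainsCopy F H ∧ H.card = m}

/-- The edge set of the complete `r`-graph of order `n`. -/
def completeEdges (r n : ℕ) : Finset (Finset (Fin n)) :=
  Finset.powersetCard r Finset.univ

/-- `c` colors the edges of the complete `r`-graph of order `n` with exactly `t` colors.  Only the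
values of `c` at edges matter. -/
def IsExactColoring (r n t : ℕ) (c : Finset (Fin n) → ℕ) : Prop :=
  ((completeEdges r n).image c).card = t

/-- The complete `r`-graph of order `n`, colored by `c`, contains a rainbow copy of `F`: a copy of
`F` whose edges have pairwise distinct colors. -/
def HasRainbowCopy {W : Type*} (r n : ℕ) (F : Finset (Finset W)) (c : Finset (Fin n) → ℕ) : Prop :=
  ∃ φ : W ↪ Fin n, (∀ e ∈ F, e.map φ ∈ completeEdges r n) ∧
    ∀ e ∈ F, ∀ e' ∈ F, c (e.map φ) = c (e'.map φ) → e = e'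

/-- The anti-Ramsey number `ar_r(n, F)`: the least positive number `t` of colors such that every
coloring of the edges of the complete `r`-graph of order `n` with exactly `t` colors contains a
rainbow copy of `F`.  (The set below is nonempty, since no coloring uses more colors than there are
edges; so the infimum is a minimum.) -/
noncomputable def antiRamseyNumber {W : Type*} (r n : ℕ) (F : Finset (Finset W)) : ℕ :=
  sInf {t : ℕ | 1 ≤ t ∧ ∀ c : Finset (Fin n) → ℕ, IsExactColoring r n t c → HasRainbowCopy r n F c}

/-- The `k`-star: the 3-graph consisting of `k` edges through the core `none`, any two of
which have only the core in common.  Its `2 * k + 1` vertices are the core and, for each `i : Fin k`,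
the two other vertices of the `i`-th edge. -/
def kStar (k : ℕ) : Finset (Finset (Option (Fin k × Bool))) :=
  Finset.univ.image fun i : Fin k => {none, some (i, false), some (i, true)}

/-- `f(n, k)`: the maximum number of edges of a 3-graph on `n` vertices without `k`-stars. -/
noncomputable def starTuranNumber (n k : ℕ) : ℕ :=
  turanNumber 3 n (kStar k)

end AntiRamsey

/-!
A star with core `v` is a matching in the link of `v`, which is a graph; all of the argument is
about matchings in links.

For the lower bound on the anti-Ramsey number, the edges of an extremal 3-graph without `k`-stars
get different colors and all other edges one more color (`exists_coloring_without_rainbow`).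

For the upper bound, let a coloring with `f(n, k) + 2` colors have no rainbow star with `k + 1`
edges, put `d = k - 1`, and choose a 3-graph `G` with one edge of each color.  A color is popular
at `v` if it appears at `v` on edges avoiding any prescribed `2 * k` vertices.  Popular colors
extend every rainbow star which does not use them (`RainbowBounded.card_add_card_le`), so that a
rainbow star with core `v` and no popular color has at most `k - p v` edges, where `p v` is the
number of popular colors at `v`; this number is positive when `n` is large, and the set of colors
which are the only popular color of some vertex is small (`RainbowBounded.card_soleColors_le`).
Let `H` consist of the edges of `G` whose color is neither of the latter kind nor popular at a
vertex of the edge.  Then all stars of `H` have at most `d` edges.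

The number of edges of `H` is estimated locally.  A pair of vertices is heavy if more than `2 * d`
edges of `H` contain it.  Every edge is divided among the vertices opposite to its heavy pairs, or
equally among its vertices if it contains no heavy pair, and some of the shares are passed on
(`load`).  What `z` then holds is bounded by a weighted version of the Chvátal–Hanson theorem on
graphs of maximum degree `d` without matchings of size `d + 1`, proved by means of a Gallai–Edmonds
type partition (`IsCapped.netWeight_le_matchingBound`).  So each load is at most the Chvátal–Hanson
number `matchingBound d d`, and it is smaller by one, even after the popular colors at `z` are
added, if `z` has a heavy neighbour or more than one popular color (`load_le_of_deficient`).  On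
the other hand `f(n, k)` is at least `matchingBound d d * (n - 2 * k)`, hence many vertices `z` are
typical: they have one popular color, no heavy neighbours, and a load near the maximum
(`RainbowBounded.card_le_card_typicalVertices_add`).

In the link of a typical vertex, each vertex without heavy neighbours is missed by some matching of
size `d`.  If `u` and `v` have one popular color each, and each of them is missed by such a matching at the other
one, then these two colors agree (`RainbowBounded.sole_color_eq`).  Therefore all typical vertices
have the same popular color `α`, and comparing a rainbow star with `k` edges with a suitable
typical vertex shows that every such star uses `α` (`RainbowBounded.exists_unavoidable_color`).
Without its edge of color `α`, `G` is free of `k`-stars but has `f(n, k) + 1` edges, a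
contradiction. -/

namespace AntiRamsey

open Finset

set_option linter.unusedSectionVars false

/-! ### Matchings in graphs -/

section Matching

variable {V : Type*} [DecidableEq V]

/-- `Q` is a matching of the graph with edge set `E`. -/
def IsMatchingIn (E Q : Finset (Finset V)) : Prop :=
  Q ⊆ E ∧ (Q : Set (Finset V)).PairwiseDisjoint id

lemma IsMatchingIn.mono {E E' Q Q' : Finset (Finset V)} (h : IsMatchingIn E Q) (hQ : Q' ⊆ Q)
    (hE : Q' ⊆ E') : IsMatchingIn E' Q' :=
  ⟨hE, h.2.subset (by exact_mod_cast hQ)⟩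

lemma isMatchingIn_empty (E : Finset (Finset V)) : IsMatchingIn E ∅ := by
  simp [IsMatchingIn]

lemma IsMatchingIn.insert {E Q : Finset (Finset V)} (h : IsMatchingIn E Q) {e : Finset V}
    (he : e ∈ E) (hd : Disjoint e (Q.biUnion id)) : IsMatchingIn E (insert e Q) := by
  refine ⟨insert_subset he h.1, ?_⟩
  rw [coe_insert]
  refine h.2.insert fun f hf _ => ?_
  exact (disjoint_biUnion_right _ _ _).1 hd f hf

lemma card_cover {E Q : Finset (Finset V)} (hE : ∀ e ∈ E, e.card = 2) (h : IsMatchingIn E Q) :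
    (Q.biUnion id).card = 2 * Q.card := by
  rw [card_biUnion h.2, sum_congr rfl (fun e he => (hE e (h.1 he) : (id e).card = 2))]
  simp [mul_comm]

lemma exists_edge_disjoint {E : Finset (Finset V)} (hE : ∀ e ∈ E, e.card = 2) {y : V}
    {F : Finset V} (hy : y ∉ F) (hF : F.card < (E.filter (y ∈ ·)).card) :
    ∃ e ∈ E, y ∈ e ∧ Disjoint e F := by
  by_contra! h
  have : E.filter (y ∈ ·) ⊆ F.image (fun x => {y, x}) := by
    intro e he
    rw [mem_filter] at he
    obtain ⟨x, hxe, hxF⟩ := not_disjoint_iff.1 (h e he.1 he.2)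
    refine mem_image.2 ⟨x, hxF, ?_⟩
    have hxy : y ≠ x := fun h => hy (h ▸ hxF)
    refine eq_of_subset_of_card_le ?_ ?_
    · intro a; simp only [mem_insert, mem_singleton]
      rintro (rfl | rfl); exacts [he.2, hxe]
    · rw [hE e he.1, card_pair hxy]
  have := (card_le_card this).trans card_image_le
  omega

/-- Greedy extension of a matching: vertices of large degree can be covered one after the other,
keeping away from a prescribed set `X`. -/
lemma exists_matching_extend {E : Finset (Finset V)} (hE : ∀ e ∈ E, e.card = 2) (X J : Finset V)
    {D : ℕ} (hJX : Disjoint J X) (hdeg : ∀ y ∈ J, D ≤ (E.filter (y ∈ ·)).card)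
    {Q : Finset (Finset V)} (hQ : IsMatchingIn E Q) (hJQ : Disjoint J (Q.biUnion id))
    (hXQ : Disjoint X (Q.biUnion id)) (hD : 2 * Q.card + 2 * J.card + X.card ≤ D + 1) :
    ∃ Q', IsMatchingIn E Q' ∧ Q ⊆ Q' ∧ Q'.card = Q.card + J.card ∧
      Disjoint X (Q'.biUnion id) := by
  induction J using Finset.induction_on generalizing Q with
  | empty => exact ⟨Q, hQ, subset_rfl, by simp, hXQ⟩
  | insert y J hyJ ih =>
    rw [disjoint_insert_left] at hJX hJQ
    rw [card_insert_of_notMem hyJ] at hD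
    have hcov := card_cover hE hQ
    obtain ⟨e, heE, hye, hde⟩ := exists_edge_disjoint hE (y := y) (F := Q.biUnion id ∪ J ∪ X)
      (by simp only [mem_union, not_or]; exact ⟨⟨hJQ.1, hyJ⟩, hJX.1⟩) (by
        have h1 := hdeg y (mem_insert_self _ _)
        have h2 := card_union_le (Q.biUnion id ∪ J) X
        have h3 := card_union_le (Q.biUnion id) J
        omega)
    rw [disjoint_union_right, disjoint_union_right] at hde
    have heQ : e ∉ Q := fun h => hJQ.1 (mem_biUnion.2 ⟨e, h, hye⟩)
    obtain ⟨Q', h1, h2, h3, h4⟩ := ih hJX.2 (fun z hz => hdeg z (mem_insert_of_mem hz))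
      (hQ.insert heE hde.1.1)
      (by rw [biUnion_insert, disjoint_union_right]; exact ⟨hde.1.2.symm, hJQ.2⟩)
      (by rw [biUnion_insert, disjoint_union_right]; exact ⟨hde.2.symm, hXQ⟩)
      (by rw [card_insert_of_notMem heQ]; omega)
    refine ⟨Q', h1, (subset_insert _ _).trans h2, ?_, h4⟩
    rw [h3, card_insert_of_notMem heQ, card_insert_of_notMem hyJ]; omega

lemma exists_max_matching (E : Finset (Finset V)) :
    ∃ Q, IsMatchingIn E Q ∧ ∀ Q', IsMatchingIn E Q' → Q'.card ≤ Q.card := by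
  classical
  obtain ⟨Q, hQ, hmax⟩ := exists_max_image (E.powerset.filter (IsMatchingIn E)) card
    ⟨∅, by simp [isMatchingIn_empty]⟩
  refine ⟨Q, (mem_filter.1 hQ).2, fun Q' h => hmax Q' ?_⟩
  exact mem_filter.2 ⟨mem_powerset.2 h.1, h⟩

/-- Gallai's exchange argument: the relation "no maximum matching misses both `u` and `v`" is
transitive through a vertex `t` which some maximum matching misses. -/
lemma maximum_matching_covers_trans {E : Finset (Finset V)} (hE : ∀ e ∈ E, e.card = 2) {ν : ℕ}
    (hν : ∀ Q, IsMatchingIn E Q → Q.card ≤ ν) {u t v : V} (huv : u ≠ v)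
    (hut : ∀ Q, IsMatchingIn E Q → Q.card = ν → u ∈ Q.biUnion id ∨ t ∈ Q.biUnion id)
    (htv : ∀ Q, IsMatchingIn E Q → Q.card = ν → t ∈ Q.biUnion id ∨ v ∈ Q.biUnion id)
    (ht : ∃ Q, IsMatchingIn E Q ∧ Q.card = ν ∧ t ∉ Q.biUnion id)
    {M : Finset (Finset V)} (hM : IsMatchingIn E M) (hMν : M.card = ν) :
    u ∈ M.biUnion id ∨ v ∈ M.biUnion id := by
  classical
  by_contra! hcon
  obtain ⟨huM, hvM⟩ := hcon
  have htM : t ∈ M.biUnion id := (hut M hM hMν).resolve_left huM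
  -- among the maximum matchings which miss `t`, take one with the most edges in common with `M`
  obtain ⟨N, hN, hmax⟩ := exists_max_image
    (E.powerset.filter fun Q => IsMatchingIn E Q ∧ Q.card = ν ∧ t ∉ Q.biUnion id)
    (fun Q => (M ∩ Q).card) (by
      obtain ⟨Q, hQ⟩ := ht
      exact ⟨Q, mem_filter.2 ⟨mem_powerset.2 hQ.1.1, hQ⟩⟩)
  obtain ⟨-, hNE, hNν, htN⟩ := mem_filter.1 hN
  have huN : u ∈ N.biUnion id := (hut N hNE hNν).resolve_right htN
  have hvN : v ∈ N.biUnion id := (htv N hNE hNν).resolve_left htN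
  have hcard : (M.biUnion id \ N.biUnion id).card = (N.biUnion id \ M.biUnion id).card :=
    card_sdiff_comm (by rw [card_cover hE hM, card_cover hE hNE, hMν, hNν])
  have h2 : 2 ≤ (N.biUnion id \ M.biUnion id).card := by
    rw [← card_pair huv]
    refine card_le_card fun a => ?_
    simp only [mem_insert, mem_singleton, mem_sdiff]
    rintro (rfl | rfl); exacts [⟨huN, huM⟩, ⟨hvN, hvM⟩]
  obtain ⟨x, hx, hxt⟩ := exists_mem_ne (by omega : 1 < (M.biUnion id \ N.biUnion id).card) t
  obtain ⟨hxM, hxN⟩ := mem_sdiff.1 hx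
  obtain ⟨e, heM, hxe⟩ := mem_biUnion.1 hxM
  simp only [id] at hxe
  have he2 := hE e (hM.1 heM)
  have heN : e ∉ N := fun h => hxN (mem_biUnion.2 ⟨e, h, hxe⟩)
  obtain ⟨y, hy⟩ := card_eq_one.1 (by rw [card_erase_of_mem hxe, he2] : (e.erase x).card = 1)
  have hye : y ∈ e := mem_of_mem_erase (by rw [hy]; exact mem_singleton_self y : y ∈ e.erase x)
  have hexy : e = {x, y} := by rw [← insert_erase hxe, hy]
  by_cases hyN : y ∈ N.biUnion id
  · obtain ⟨f, hfN, hyf⟩ := mem_biUnion.1 hyN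
    simp only [id] at hyf
    have hef : e ≠ f := fun h => heN (h ▸ hfN)
    have hfM : f ∉ M := fun h => disjoint_left.1 (hM.2 heM h hef) hye hyf
    have hdis : Disjoint e ((N.erase f).biUnion id) := by
      rw [hexy, disjoint_insert_left, disjoint_singleton_left]
      refine ⟨fun h => hxN (biUnion_subset_biUnion_of_subset_left _ (erase_subset _ _) h), ?_⟩
      intro h
      obtain ⟨g, hg, hyg⟩ := mem_biUnion.1 h
      exact disjoint_left.1 (hNE.2 (mem_of_mem_erase hg) hfN (ne_of_mem_erase hg)) hyg hyf
    have hNe : e ∉ N.erase f := fun h => heN (mem_of_mem_erase h)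
    have hmem : insert e (N.erase f) ∈ E.powerset.filter
        fun Q => IsMatchingIn E Q ∧ Q.card = ν ∧ t ∉ Q.biUnion id := by
      have hm : IsMatchingIn E (insert e (N.erase f)) :=
        (hNE.mono (erase_subset _ _) ((erase_subset _ _).trans hNE.1)).insert (hM.1 heM) hdis
      refine mem_filter.2 ⟨mem_powerset.2 hm.1, hm, ?_, ?_⟩
      · rw [card_insert_of_notMem hNe, card_erase_add_one hfN, hNν]
      · rw [biUnion_insert, mem_union, not_or]
        refine ⟨?_, fun h => htN (biUnion_subset_biUnion_of_subset_left _ (erase_subset _ _) h)⟩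
        simp only [id, hexy, mem_insert, mem_singleton, not_or]
        exact ⟨hxt.symm, fun h => htN (h ▸ hyN)⟩
    -- exchanging `f` for `e` in `N` yields more edges in common with `M`
    have hlt := hmax _ hmem
    have hsub : insert e (M ∩ N) ⊆ M ∩ insert e (N.erase f) := by
      intro g hg
      rcases mem_insert.1 hg with rfl | hg
      · exact mem_inter.2 ⟨heM, mem_insert_self _ _⟩
      · obtain ⟨h1, h2⟩ := mem_inter.1 hg
        exact mem_inter.2 ⟨h1, mem_insert_of_mem (mem_erase.2 ⟨fun h => hfM (h ▸ h1), h2⟩)⟩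
    have := card_le_card hsub
    rw [card_insert_of_notMem (fun h => heN (mem_inter.1 h).2)] at this
    omega
  · have hdis : Disjoint e (N.biUnion id) := by
      rw [hexy, disjoint_insert_left, disjoint_singleton_left]; exact ⟨hxN, hyN⟩
    have := hν _ (hNE.insert (hM.1 heM) hdis)
    rw [card_insert_of_notMem heN] at this
    omega

end Matching

/-! ### The Gallai partition -/

section Gallai

variable {V : Type*} [DecidableEq V]

/-- Gallai's lemma.  If every vertex of `X` is missed by some maximum matching, then `X` splits into
factor-critical classes with no edges between them, and a maximum matching is near-perfect on
each class. -/
lemma exists_factor_critical_partition {E : Finset (Finset V)} (hE : ∀ e ∈ E, e.card = 2)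
    {X : Finset V} (hEX : ∀ e ∈ E, e ⊆ X) {ν : ℕ} (hν : ∀ Q, IsMatchingIn E Q → Q.card ≤ ν)
    (hav : ∀ v ∈ X, ∃ Q, IsMatchingIn E Q ∧ Q.card = ν ∧ v ∉ Q.biUnion id)
    (hex : ∃ Q, IsMatchingIn E Q ∧ Q.card = ν) :
    ∃ 𝒦 : Finset (Finset V), (∀ K ∈ 𝒦, K ⊆ X) ∧ (∀ x ∈ X, ∃ K ∈ 𝒦, x ∈ K) ∧
      (𝒦 : Set (Finset V)).PairwiseDisjoint id ∧ (∀ e ∈ E, ∃ K ∈ 𝒦, e ⊆ K) ∧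
      (∀ K ∈ 𝒦, K.Nonempty) ∧
      (∀ K ∈ 𝒦, ∀ v ∈ K, ∃ Q, IsMatchingIn E Q ∧ (∀ e ∈ Q, e ⊆ K.erase v) ∧
        2 * Q.card + 1 = K.card) ∧
      ∑ K ∈ 𝒦, K.card / 2 ≤ ν := by
  classical
  set r : V → V → Prop := fun u v => u = v ∨
    ∀ Q, IsMatchingIn E Q → Q.card = ν → u ∈ Q.biUnion id ∨ v ∈ Q.biUnion id with hr
  have hsymm : ∀ u v, r u v → r v u := by
    rintro u v (h | h)
    · exact Or.inl h.symm
    · exact Or.inr fun Q h1 h2 => (h Q h1 h2).symm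
  have htrans : ∀ u t v, t ∈ X → r u t → r t v → r u v := by
    intro u t v htX hut htv
    rcases hut with rfl | hut
    · exact htv
    rcases htv with rfl | htv
    · exact Or.inr hut
    by_cases huv : u = v
    · exact Or.inl huv
    · exact Or.inr fun M h1 h2 =>
        maximum_matching_covers_trans hE hν huv hut htv (hav t htX) h1 h2
  have hadj : ∀ e ∈ E, ∀ u ∈ e, ∀ v ∈ e, r u v := by
    intro e he u hu v hv
    by_cases huv : u = v
    · exact Or.inl huv
    refine Or.inr fun Q h1 h2 => ?_
    by_contra! hcon
    have heuv : e = {u, v} := by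
      refine (eq_of_subset_of_card_le ?_ ?_).symm
      · intro a; simp only [mem_insert, mem_singleton]
        rintro (rfl | rfl) <;> assumption
      · rw [hE e he, card_pair huv]
    have := hν _ (h1.insert he (by
      rw [heuv, disjoint_insert_left, disjoint_singleton_left]; exact hcon))
    rw [card_insert_of_notMem (fun h => hcon.1 (mem_biUnion.2 ⟨e, h, hu⟩))] at this
    omega
  -- the classes of Gallai's relation `r`
  set cls : V → Finset V := fun a => X.filter (r a) with hcls
  have hmem : ∀ a x, x ∈ cls a ↔ x ∈ X ∧ r a x := fun a x => by simp [hcls]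
  have hclos : ∀ a ∈ X, ∀ e ∈ E, ∀ x ∈ e, x ∈ cls a → e ⊆ cls a := by
    intro a ha e he x hx hxa y hy
    rw [hmem] at hxa ⊢
    exact ⟨hEX e he hy, htrans _ _ _ hxa.1 hxa.2 (hadj e he x hx y hy)⟩
  have hrel : ∀ a ∈ X, ∀ x ∈ cls a, ∀ y ∈ cls a, r x y := by
    intro a ha x hx y hy
    rw [hmem] at hx hy
    exact htrans _ _ _ ha (hsymm _ _ hx.2) hy.2
  have hcov : ∀ a ∈ X, ∀ Q, IsMatchingIn E Q →
      2 * (Q.filter (· ⊆ cls a)).card = (Q.biUnion id ∩ cls a).card := by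
    intro a ha Q hQ
    have h1 : IsMatchingIn E (Q.filter (· ⊆ cls a)) :=
      hQ.mono (filter_subset _ _) ((filter_subset _ _).trans hQ.1)
    rw [← card_cover hE h1]
    congr 1
    ext x
    simp only [mem_biUnion, mem_inter, mem_filter, id]
    constructor
    · rintro ⟨e, ⟨h1, h2⟩, h3⟩; exact ⟨⟨e, h1, h3⟩, h2 h3⟩
    · rintro ⟨⟨e, h1, h3⟩, h2⟩; exact ⟨e, ⟨h1, hclos a ha e (hQ.1 h1) x h3 h2⟩, h3⟩
  -- a maximum matching missing `v` is perfect on the rest of the class of `v`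
  have hnear : ∀ a ∈ X, ∀ v ∈ cls a, ∃ Q, IsMatchingIn E Q ∧ (∀ e ∈ Q, e ⊆ (cls a).erase v) ∧
        2 * Q.card + 1 = (cls a).card := by
    intro a ha v hv
    obtain ⟨Q, hQ, hQν, hvQ⟩ := hav v ((hmem a v).1 hv).1
    refine ⟨Q.filter (· ⊆ cls a), hQ.mono (filter_subset _ _) ((filter_subset _ _).trans hQ.1),
      ?_, ?_⟩
    · intro e he x hx
      rw [mem_filter] at he
      exact mem_erase.2 ⟨fun h => hvQ (mem_biUnion.2 ⟨e, he.1, h ▸ hx⟩), he.2 hx⟩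
    · rw [hcov a ha Q hQ, ← card_erase_add_one hv]
      congr 2
      ext x
      simp only [mem_inter, mem_erase]
      constructor
      · rintro ⟨h1, h2⟩; exact ⟨fun h => hvQ (h ▸ h1), h2⟩
      · rintro ⟨h1, h2⟩
        refine ⟨?_, h2⟩
        rcases hrel a ha x h2 v hv with h | h
        · exact absurd h h1
        · exact (h Q hQ hQν).resolve_right hvQ
  have hne : ∀ a ∈ X, a ∈ cls a := fun a ha => (hmem a a).2 ⟨ha, Or.inl rfl⟩
  have hdisj : ((X.image cls : Finset (Finset V)) : Set (Finset V)).PairwiseDisjoint id := by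
    intro K hK K' hK' hKK'
    obtain ⟨a, ha, rfl⟩ := mem_image.1 (mem_coe.1 hK)
    obtain ⟨b, hb, rfl⟩ := mem_image.1 (mem_coe.1 hK')
    refine disjoint_left.2 fun x hx hx' => hKK' ?_
    simp only [id] at hx hx'
    rw [hmem] at hx hx'
    have hab : r a b := htrans _ _ _ hx.1 hx.2 (hsymm _ _ hx'.2)
    ext y
    rw [hmem, hmem]
    exact and_congr_right fun _ =>
      ⟨fun h => htrans _ _ _ ha (hsymm _ _ hab) h, fun h => htrans _ _ _ hb hab h⟩
  refine ⟨X.image cls, ?_, fun x hx => ⟨cls x, mem_image_of_mem _ hx, hne x hx⟩, hdisj, ?_, ?_,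
    ?_, ?_⟩
  · intro K hK
    obtain ⟨a, ha, rfl⟩ := mem_image.1 hK
    exact filter_subset _ _
  · intro e he
    obtain ⟨x, hx⟩ : e.Nonempty := card_pos.1 (by rw [hE e he]; norm_num)
    have hxX := hEX e he hx
    exact ⟨cls x, mem_image_of_mem _ hxX, hclos x hxX e he x hx (hne x hxX)⟩
  · intro K hK
    obtain ⟨a, ha, rfl⟩ := mem_image.1 hK
    exact ⟨a, hne a ha⟩
  · intro K hK
    obtain ⟨a, ha, rfl⟩ := mem_image.1 hK
    exact hnear a ha
  · obtain ⟨Q, hQ, hQν⟩ := hex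
    have h1 : ∀ K ∈ X.image cls, K.card / 2 ≤ (Q.filter (· ⊆ K)).card := by
      intro K hK
      obtain ⟨a, ha, rfl⟩ := mem_image.1 hK
      obtain ⟨-, -, -, hodd⟩ := hnear a ha a (hne a ha)
      have h2 := hcov a ha Q hQ
      have h3 : (cls a \ Q.biUnion id).card ≤ 1 := by
        rw [card_le_one]
        intro x hx y hy
        rw [mem_sdiff] at hx hy
        rcases hrel a ha x hx.1 y hy.1 with h | h
        · exact h
        · rcases h Q hQ hQν with h | h
          exacts [absurd h hx.2, absurd h hy.2]
      have h4 := card_sdiff_add_card_inter (cls a) (Q.biUnion id)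
      rw [inter_comm] at h4
      omega
    calc ∑ K ∈ X.image cls, K.card / 2 ≤ ∑ K ∈ X.image cls, (Q.filter (· ⊆ K)).card :=
          sum_le_sum h1
      _ = ((X.image cls).biUnion fun K => Q.filter (· ⊆ K)).card := by
          rw [card_biUnion]
          intro K hK K' hK' hne
          refine disjoint_left.2 fun e he he' => ?_
          rw [mem_filter] at he he'
          obtain ⟨x, hx⟩ : e.Nonempty := card_pos.1 (by rw [hE e (hQ.1 he.1)]; norm_num)
          exact disjoint_left.1 (hdisj hK hK' hne) (he.2 hx) (he'.2 hx)
      _ ≤ Q.card := card_le_card (biUnion_subset.2 fun K _ => filter_subset _ _)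
      _ = ν := hQν

/-- A Gallai–Edmonds type decomposition: after the removal of a set `U`, the remaining vertices
split into factor-critical classes without edges between them, and the upper bound
`U.card + ∑ K ∈ 𝒦, K.card / 2` on the size of a matching is attained. -/
structure IsGallaiPartition (E : Finset (Finset V)) (X U : Finset V) (𝒦 : Finset (Finset V)) :
    Prop where
  subset : U ⊆ X
  class_subset : ∀ K ∈ 𝒦, K ⊆ X \ U
  exists_class : ∀ x ∈ X \ U, ∃ K ∈ 𝒦, x ∈ K
  disjoint : (𝒦 : Set (Finset V)).PairwiseDisjoint id
  edge : ∀ e ∈ E, e ⊆ X → (∃ u ∈ U, u ∈ e) ∨ ∃ K ∈ 𝒦, e ⊆ K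
  nonempty : ∀ K ∈ 𝒦, K.Nonempty
  critical : ∀ K ∈ 𝒦, ∀ v ∈ K, ∃ Q, IsMatchingIn E Q ∧ (∀ e ∈ Q, e ⊆ K.erase v) ∧
        2 * Q.card + 1 = K.card
  card_le : ∀ s, (∀ Q, IsMatchingIn (E.filter (· ⊆ X)) Q → Q.card ≤ s) →
      U.card + ∑ K ∈ 𝒦, K.card / 2 ≤ s

/-- A vertex `u` which lies in all maximum matchings is put into `U`, and the rest is decomposed
by induction: without `u` the matching number drops by one. -/
lemma exists_gallaiPartition {E : Finset (Finset V)} (hE : ∀ e ∈ E, e.card = 2) (X : Finset V) :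
    ∃ U 𝒦, IsGallaiPartition E X U 𝒦 := by
  classical
  induction X using Finset.strongInduction with
  | H X ih =>
  have hE' : ∀ e ∈ E.filter (· ⊆ X), e.card = 2 := fun e he => hE e (mem_filter.1 he).1
  obtain ⟨Q₀, hQ₀, hmax⟩ := exists_max_matching (E.filter (· ⊆ X))
  by_cases hav : ∀ v ∈ X, ∃ Q, IsMatchingIn (E.filter (· ⊆ X)) Q ∧ Q.card = Q₀.card ∧
      v ∉ Q.biUnion id
  · obtain ⟨𝒦, h1, h2, h3, h4, h5, h6, h7⟩ := exists_factor_critical_partition hE'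
      (fun e he => (mem_filter.1 he).2) hmax hav ⟨Q₀, hQ₀, rfl⟩
    refine ⟨∅, 𝒦, ⟨empty_subset _, by simpa using h1, by simpa using h2, h3, ?_, h5, ?_, ?_⟩⟩
    · exact fun e he heX => Or.inr (h4 e (mem_filter.2 ⟨he, heX⟩))
    · intro K hK v hv
      obtain ⟨Q, hQ, hQ2, hQ3⟩ := h6 K hK v hv
      exact ⟨Q, hQ.mono subset_rfl (hQ.1.trans (filter_subset _ _)), hQ2, hQ3⟩
    · intro s hs
      simpa using h7.trans (hs Q₀ hQ₀)
  · push Not at hav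
    obtain ⟨u, huX, hu⟩ := hav
    obtain ⟨U, 𝒦, h⟩ := ih (X.erase u) (erase_ssubset huX)
    have hsd : X \ insert u U = X.erase u \ U := by
      ext x; simp only [mem_sdiff, mem_insert, mem_erase]; tauto
    have huU : u ∉ U := fun hU => notMem_erase u X (h.subset hU)
    refine ⟨insert u U, 𝒦, ⟨?_, ?_, ?_, h.disjoint, ?_, h.nonempty, h.critical, ?_⟩⟩
    · exact insert_subset huX (h.subset.trans (erase_subset _ _))
    · rw [hsd]; exact h.class_subset
    · rw [hsd]; exact h.exists_class
    · intro e he heX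
      by_cases hue : u ∈ e
      · exact Or.inl ⟨u, mem_insert_self _ _, hue⟩
      · rcases h.edge e he (fun x hx => mem_erase.2 ⟨fun h => hue (h ▸ hx), heX hx⟩) with h | h
        · obtain ⟨w, hw, hwe⟩ := h
          exact Or.inl ⟨w, mem_insert_of_mem hw, hwe⟩
        · exact Or.inr h
    · intro s hs
      have hpos : 1 ≤ Q₀.card := by
        by_contra h0
        have : Q₀ = ∅ := card_eq_zero.1 (by omega)
        have := hu Q₀ hQ₀ rfl
        simp_all
      have := h.card_le (Q₀.card - 1) (by
        intro Q hQ
        have hQ' : IsMatchingIn (E.filter (· ⊆ X)) Q := hQ.mono subset_rfl fun e he => by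
          have := mem_filter.1 (hQ.1 he)
          exact mem_filter.2 ⟨this.1, this.2.trans (erase_subset _ _)⟩
        have h1 := hmax Q hQ'
        have h2 : Q.card ≠ Q₀.card := fun h2 => by
          obtain ⟨e, he, hue⟩ := mem_biUnion.1 (hu Q hQ' h2)
          exact notMem_erase u X ((mem_filter.1 (hQ.1 he)).2 hue)
        omega)
      rw [card_insert_of_notMem huU]
      have := hs Q₀ hQ₀
      omega

end Gallai

/-! ### A weighted Chvátal–Hanson bound -/

section Weighted

variable {V : Type*} [DecidableEq V]

/-- The Chvátal–Hanson bound on the number of edges of a graph of maximum degree `d` without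
matchings of size `s + 1`. -/
def matchingBound (d s : ℕ) : ℕ := d * s + d / 2 * (s / ((d + 1) / 2))

/-- The weight of a pair: the pairs in `B` (the heavy ones) count `1`, the others (the light ones)
count `1 / 3`. -/
def pairWeight (B : Finset (Finset V)) (e : Finset V) : ℚ := if e ∈ B then 1 else 1 / 3

/-- The weighted degree of `x` in the graph with edge set `E`. -/
def weightedDegree (E B : Finset (Finset V)) (x : V) : ℚ := ∑ e ∈ E with x ∈ e, pairWeight B e

/-- The total weight of the edges inside `X`, minus the corrections `ex` at the vertices of `X`. -/
def netWeight (E B : Finset (Finset V)) (ex : V → ℚ) (X : Finset V) : ℚ :=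
  ∑ e ∈ E with e ⊆ X, pairWeight B e - ∑ x ∈ X, ex x

/-- `E` is a graph with at most `d` heavy edges at each vertex, and the corrections `ex` bring every
weighted degree down to `d`, and to `d - 2 / 3` at the end vertices of light edges. -/
structure IsCapped (d : ℕ) (E B : Finset (Finset V)) (ex : V → ℚ) : Prop where
  uniform : ∀ e ∈ E, e.card = 2
  heavy_le : ∀ x, (E.filter fun e => x ∈ e ∧ e ∈ B).card ≤ d
  ex_nonneg : ∀ x, 0 ≤ ex x
  cap : ∀ x, weightedDegree E B x - ex x ≤ d
  cap_light : ∀ e ∈ E, e ∉ B → ∀ x ∈ e, weightedDegree E B x - ex x ≤ d - 2 / 3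

lemma pairWeight_nonneg (B : Finset (Finset V)) (e : Finset V) : 0 ≤ pairWeight B e := by
  unfold pairWeight; split_ifs <;> norm_num

lemma pairWeight_le_one (B : Finset (Finset V)) (e : Finset V) : pairWeight B e ≤ 1 := by
  unfold pairWeight; split_ifs <;> norm_num

lemma weightedDegree_mono {E E' : Finset (Finset V)} (B : Finset (Finset V)) (h : E' ⊆ E) (x : V) :
    weightedDegree E' B x ≤ weightedDegree E B x :=
  sum_le_sum_of_subset_of_nonneg (filter_subset_filter _ h) fun e _ _ => pairWeight_nonneg B e

lemma sum_weightedDegree_inside {E : Finset (Finset V)} (hE : ∀ e ∈ E, e.card = 2)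
    (B : Finset (Finset V)) (X : Finset V) :
    ∑ x ∈ X, weightedDegree (E.filter (· ⊆ X)) B x =
      2 * ∑ e ∈ E with e ⊆ X, pairWeight B e := by
  have hF : ∀ e ∈ E.filter (· ⊆ X), e ∈ E ∧ e ⊆ X := fun e he => mem_filter.1 he
  generalize E.filter (· ⊆ X) = F at hF ⊢
  simp only [weightedDegree, sum_filter]
  rw [sum_comm, mul_sum]
  refine sum_congr rfl fun e he => ?_
  replace he := hF e he
  rw [← sum_filter, sum_const, nsmul_eq_mul]
  have : (X.filter (· ∈ e)) = e := by
    ext x; simp only [mem_filter]; exact ⟨fun h => h.2, fun h => ⟨he.2 h, h⟩⟩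
  rw [this, hE e he.1]; norm_num

variable {d : ℕ} {E B : Finset (Finset V)} {ex : V → ℚ}

lemma IsCapped.two_mul_netWeight_le (h : IsCapped d E B ex) (X : Finset V) :
    2 * netWeight E B ex X ≤ ∑ x ∈ X, (weightedDegree (E.filter (· ⊆ X)) B x - ex x) := by
  rw [sum_sub_distrib, sum_weightedDegree_inside h.uniform, netWeight]
  have := sum_nonneg fun x (_ : x ∈ X) => h.ex_nonneg x
  linarith

lemma IsCapped.inside_cap (h : IsCapped d E B ex) (X : Finset V) (x : V) :
    weightedDegree (E.filter (· ⊆ X)) B x - ex x ≤ d :=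
  (sub_le_sub_right (weightedDegree_mono B (filter_subset _ _) x) _).trans (h.cap x)

lemma IsCapped.netWeight_le_half (h : IsCapped d E B ex) (X : Finset V) :
    netWeight E B ex X ≤ d * X.card / 2 := by
  have h1 := h.two_mul_netWeight_le X
  have h2 := sum_le_card_nsmul X _ _ fun x _ => h.inside_cap X x
  rw [nsmul_eq_mul] at h2
  linarith

/-- The bound for a factor-critical class with `2 * m + 1` vertices.  For odd `d` the bound
`d * (2 * m + 1) / 2` on the weight is not attained: without light edges the weight is an integer,
and the ends of a light edge have a smaller cap. -/
lemma IsCapped.netWeight_class_le (h : IsCapped d E B ex) {X : Finset V} {m : ℕ}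
    (hX : X.card = 2 * m + 1) :
    netWeight E B ex X ≤ d * m + (if (d + 1) / 2 ≤ m then ((d / 2 : ℕ) : ℚ) else 0) := by
  have hex := sum_nonneg fun x (_ : x ∈ X) => h.ex_nonneg x
  split_ifs with hm
  · by_cases hl : ∃ e ∈ E, e ⊆ X ∧ e ∉ B
    · obtain ⟨e, heE, heX, heB⟩ := hl
      have h1 := h.two_mul_netWeight_le X
      have h2 : ∑ x ∈ X, (weightedDegree (E.filter (· ⊆ X)) B x - ex x) ≤
          ∑ x ∈ X, ((d : ℚ) - if x ∈ e then 2 / 3 else 0) := by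
        refine sum_le_sum fun x _ => ?_
        split_ifs with hxe
        · exact (sub_le_sub_right (weightedDegree_mono B (filter_subset _ _) x) _).trans
            (h.cap_light e heE heB x hxe)
        · rw [sub_zero]; exact h.inside_cap X x
      rw [sum_sub_distrib (fun _ => (d : ℚ)), ← sum_filter, filter_mem_eq_inter,
        inter_eq_right.2 heX, sum_const, sum_const, h.uniform e heE, hX] at h2
      have h3 : (d : ℚ) ≤ 2 * (d / 2 : ℕ) + 1 := by exact_mod_cast (by omega)
      simp only [nsmul_eq_mul] at h2
      push_cast at h2
      linarith
    · push Not at hl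
      have h1 : ∑ e ∈ E with e ⊆ X, pairWeight B e = ((E.filter (· ⊆ X)).card : ℚ) := by
        rw [card_eq_sum_ones, Nat.cast_sum]
        refine sum_congr rfl fun e he => ?_
        rw [mem_filter] at he
        simp [pairWeight, hl e he.1 he.2]
      have h2 : 2 * (E.filter (· ⊆ X)).card ≤ d * X.card := by
        have h3 := sum_weightedDegree_inside h.uniform B X
        have h4 : ∀ x ∈ X, weightedDegree (E.filter (· ⊆ X)) B x ≤ d := by
          intro x _
          refine le_trans ?_ (Nat.cast_le.2 (h.heavy_le x))
          rw [weightedDegree, card_eq_sum_ones, Nat.cast_sum, Nat.cast_one]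
          refine (sum_le_sum fun e _ => pairWeight_le_one B e).trans ?_
          refine sum_le_sum_of_subset_of_nonneg ?_ fun _ _ _ => zero_le_one
          intro e he
          simp only [mem_filter] at he ⊢
          exact ⟨he.1.1, he.2, hl e he.1.1 he.1.2⟩
        have h5 := sum_le_card_nsmul X _ _ h4
        rw [h3, h1, nsmul_eq_mul, mul_comm (X.card : ℚ)] at h5
        exact_mod_cast h5
      rw [hX] at h2
      have h6 : (E.filter (· ⊆ X)).card ≤ d * m + d / 2 := by
        have : d * (2 * m + 1) = 2 * (d * m) + d := by ring
        omega
      rw [netWeight, h1]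
      have h7 : ((E.filter (· ⊆ X)).card : ℚ) ≤ d * m + (d / 2 : ℕ) := by exact_mod_cast h6
      linarith
  · have h1 : (E.filter (· ⊆ X)).card ≤ m * (2 * m + 1) := by
      have h2 : E.filter (· ⊆ X) ⊆ X.powersetCard 2 := fun e he => by
        rw [mem_filter] at he
        exact mem_powersetCard.2 ⟨he.2, h.uniform e he.1⟩
      have h3 := card_le_card h2
      rw [card_powersetCard, hX, Nat.choose_two_right] at h3
      have : (2 * m + 1) * (2 * m + 1 - 1) / 2 = m * (2 * m + 1) := by
        rw [Nat.add_sub_cancel, show (2 * m + 1) * (2 * m) = m * (2 * m + 1) * 2 by ring]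
        simp
      omega
    have h2 : m * (2 * m + 1) ≤ d * m := by
      rw [mul_comm d]; exact Nat.mul_le_mul_left _ (by omega)
    have h3 : ∑ e ∈ E with e ⊆ X, pairWeight B e ≤ ((E.filter (· ⊆ X)).card : ℚ) := by
      have := sum_le_card_nsmul (E.filter (· ⊆ X)) _ _ fun e _ => pairWeight_le_one B e
      simpa using this
    have h4 : ((E.filter (· ⊆ X)).card : ℚ) ≤ d * m := by exact_mod_cast h1.trans h2
    rw [netWeight]; linarith

/-- Each vertex of `U` contributes at most its cap `d`; the other edges lie inside the classes. -/
lemma IsCapped.netWeight_univ_le_sum [Fintype V] (h : IsCapped d E B ex) {U : Finset V}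
    {P : Finset (Finset V)} (hP : (P : Set (Finset V)).PairwiseDisjoint id)
    (hPU : ∀ K ∈ P, Disjoint U K) (hedge : ∀ e ∈ E, (∃ u ∈ U, u ∈ e) ∨ ∃ K ∈ P, e ⊆ K) :
    netWeight E B ex univ ≤ d * U.card + ∑ K ∈ P, netWeight E B ex K := by
  have h1 : ∑ e ∈ E, pairWeight B e ≤
      ∑ u ∈ U, weightedDegree E B u + ∑ K ∈ P, ∑ e ∈ E with e ⊆ K, pairWeight B e := by
    simp only [weightedDegree, sum_filter]
    rw [sum_comm, sum_comm (s := P), ← sum_add_distrib]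
    refine sum_le_sum fun e he => ?_
    have hn := pairWeight_nonneg B e
    have hU : 0 ≤ ∑ u ∈ U, if u ∈ e then pairWeight B e else 0 :=
      sum_nonneg fun u _ => by split_ifs <;> simp [hn]
    have hK : 0 ≤ ∑ K ∈ P, if e ⊆ K then pairWeight B e else 0 :=
      sum_nonneg fun u _ => by split_ifs <;> simp [hn]
    rcases hedge e he with ⟨u, hu, hue⟩ | ⟨K, hKP, heK⟩
    · have := single_le_sum (f := fun u => if u ∈ e then pairWeight B e else 0)
        (fun u _ => by split_ifs <;> simp [hn]) hu
      simp only [hue, if_true] at this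
      linarith
    · have := single_le_sum (f := fun K => if e ⊆ K then pairWeight B e else 0)
        (fun u _ => by split_ifs <;> simp [hn]) hKP
      simp only [heK, if_true] at this
      linarith
  have h2 : ∑ u ∈ U, ex u + ∑ K ∈ P, ∑ x ∈ K, ex x ≤ ∑ x, ex x := by
    have h3 : ∑ K ∈ P, ∑ x ∈ K, ex x = ∑ x ∈ P.biUnion id, ex x := (sum_biUnion hP).symm
    rw [h3, ← sum_union (show Disjoint U (P.biUnion id) from (disjoint_biUnion_right _ _ _).2 hPU)]
    exact sum_le_sum_of_subset_of_nonneg (subset_univ _) fun x _ _ => h.ex_nonneg x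
  have h4 : ∑ u ∈ U, (weightedDegree E B u - ex u) ≤ d * U.card := by
    have := sum_le_card_nsmul U _ _ fun u _ => h.cap u
    rwa [nsmul_eq_mul, mul_comm] at this
  rw [sum_sub_distrib] at h4
  simp only [netWeight, sum_sub_distrib, subset_univ, filter_true]
  linarith

/-- The weighted form of the Chvátal–Hanson bound. -/
lemma IsCapped.netWeight_le_matchingBound [Fintype V] (h : IsCapped d E B ex) (hd : 1 ≤ d) {s : ℕ}
    (hs : ∀ Q, IsMatchingIn E Q → Q.card ≤ s) : netWeight E B ex univ ≤ matchingBound d s := by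
  obtain ⟨U, P, hG⟩ := exists_gallaiPartition h.uniform univ
  have h1 := h.netWeight_univ_le_sum hG.disjoint
    (fun K hK => (disjoint_left.2 fun x hx hxU =>
      (mem_sdiff.1 (hG.class_subset K hK hx)).2 hxU).symm)
    (fun e he => hG.edge e he (subset_univ _))
  have h2 := hG.card_le s fun Q hQ => hs Q (hQ.mono subset_rfl (hQ.1.trans (filter_subset _ _)))
  have h3 : ∑ K ∈ P, netWeight E B ex K ≤
      ∑ K ∈ P, ((d : ℚ) * (K.card / 2 : ℕ) +
        if (d + 1) / 2 ≤ K.card / 2 then ((d / 2 : ℕ) : ℚ) else 0) := by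
    refine sum_le_sum fun K hK => ?_
    obtain ⟨x, hx⟩ := hG.nonempty K hK
    obtain ⟨Q, -, -, hQ⟩ := hG.critical K hK x hx
    exact h.netWeight_class_le (by omega)
  rw [sum_add_distrib, ← mul_sum, ← sum_filter, sum_const, nsmul_eq_mul] at h3
  have h4 : (P.filter fun K => (d + 1) / 2 ≤ K.card / 2).card ≤ s / ((d + 1) / 2) := by
    rw [Nat.le_div_iff_mul_le (by omega)]
    have h5 := card_nsmul_le_sum (P.filter fun K => (d + 1) / 2 ≤ K.card / 2)
      (fun K => K.card / 2) ((d + 1) / 2) fun K hK => (mem_filter.1 hK).2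
    have h6 := sum_le_sum_of_subset (f := fun K => K.card / 2)
      (filter_subset (fun K => (d + 1) / 2 ≤ K.card / 2) P)
    rw [smul_eq_mul] at h5
    omega
  have h7 : d * U.card + d * ∑ K ∈ P, K.card / 2 +
      (P.filter fun K => (d + 1) / 2 ≤ K.card / 2).card * (d / 2) ≤ matchingBound d s := by
    rw [matchingBound, ← mul_add, mul_comm (d / 2)]
    exact add_le_add (Nat.mul_le_mul_left _ h2) (Nat.mul_le_mul_right _ h4)
  have h8 : ((d * U.card + d * ∑ K ∈ P, K.card / 2 +
      (P.filter fun K => (d + 1) / 2 ≤ K.card / 2).card * (d / 2) : ℕ) : ℚ) ≤ matchingBound d s :=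
    Nat.cast_le.2 h7
  push_cast at h8 h3
  linarith

/-- If `a` lies in all matchings of size `d`, then the graph without the edges at `a` has no such
matching and obeys the bound for `d - 1`. -/
lemma IsCapped.netWeight_le_of_unavoidable [Fintype V] (h : IsCapped d E B ex) (hd : 1 ≤ d)
    (hs : ∀ Q, IsMatchingIn E Q → Q.card ≤ d) {a : V}
    (ha : ∀ Q, IsMatchingIn E Q → Q.card = d → a ∈ Q.biUnion id) :
    netWeight E B ex univ ≤ matchingBound d (d - 1) + (weightedDegree E B a - ex a) := by
  set E' := E.filter (a ∉ ·) with hE'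
  have hsub : E' ⊆ E := filter_subset _ _
  have h' : IsCapped d E' B (Function.update ex a 0) := by
    have key : ∀ x, x ≠ a → weightedDegree E' B x - Function.update ex a 0 x ≤
        weightedDegree E B x - ex x := by
      intro x hx
      rw [Function.update_of_ne hx]
      exact sub_le_sub_right (weightedDegree_mono B hsub x) _
    refine ⟨fun e he => h.uniform e (hsub he), fun x => ?_, fun x => ?_, fun x => ?_, ?_⟩
    · exact (card_le_card (filter_subset_filter _ hsub)).trans (h.heavy_le x)
    · by_cases hx : x = a
      · subst hx; simp
      · rw [Function.update_of_ne hx]; exact h.ex_nonneg x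
    · by_cases hx : x = a
      · subst hx
        have : weightedDegree E' B x = 0 := by
          rw [weightedDegree, filter_filter, filter_false_of_mem, sum_empty]
          rintro e - ⟨h1, h2⟩; exact h1 h2
        rw [this]; simp
      · exact (key x hx).trans (h.cap x)
    · intro e he heB x hx
      exact (key x (fun hxa => (mem_filter.1 he).2 (hxa ▸ hx))).trans
        (h.cap_light e (hsub he) heB x hx)
  have h1 := h'.netWeight_le_matchingBound hd (s := d - 1) (by
    intro Q hQ
    have hQE := hQ.mono subset_rfl (hQ.1.trans hsub)
    have h2 := hs Q hQE
    have h3 : Q.card ≠ d := fun h3 => by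
      obtain ⟨e, he, hae⟩ := mem_biUnion.1 (ha Q hQE h3)
      exact (mem_filter.1 (hQ.1 he)).2 hae
    omega)
  have h2 : netWeight E B ex univ = netWeight E' B (Function.update ex a 0) univ +
      (weightedDegree E B a - ex a) := by
    simp only [netWeight, weightedDegree, subset_univ, filter_true]
    have e1 := sum_filter_add_sum_filter_not E (a ∈ ·) (pairWeight B)
    have e2 : ∑ x, Function.update ex a 0 x = ∑ x, ex x - ex a := by
      rw [sum_update_of_mem (mem_univ a), ← sum_erase_eq_sub (mem_univ a), sdiff_singleton_eq_erase,
        zero_add]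
    rw [e2, ← e1]; ring
  linarith

end Weighted

/-! ### Nearly extremal graphs of odd maximum degree -/

section Factor

variable {V : Type*} [DecidableEq V]

/-- In a Gallai partition, a system of distinct classes adjacent to the vertices of `U` and
different from `C` gives a large matching which misses a given vertex of `C`. -/
lemma IsGallaiPartition.exists_matching_missing {E : Finset (Finset V)}
    (hE : ∀ e ∈ E, e.card = 2) {X U : Finset V} {P : Finset (Finset V)}
    (hG : IsGallaiPartition E X U P) {C : Finset V} (hC : C ∈ P) {f : U → Finset V}
    (hf : Function.Injective f) (hfP : ∀ u, f u ∈ P) (hfC : ∀ u, f u ≠ C)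
    (hfE : ∀ u : U, ∃ v ∈ f u, {(u : V), v} ∈ E) {y : V} (hy : y ∈ C) :
    ∃ Q, IsMatchingIn E Q ∧ Q.card = U.card + ∑ K ∈ P, K.card / 2 ∧ y ∉ Q.biUnion id := by
  classical
  have : Nonempty V := ⟨y⟩
  have hpt : ∀ K ∈ P, ∃ p, p ∈ K ∧ (K = C → p = y) ∧ ∀ u : U, f u = K → {(u : V), p} ∈ E := by
    intro K hK
    by_cases hKC : K = C
    · exact ⟨y, hKC ▸ hy, fun _ => rfl, fun u hu => absurd (hu.trans hKC) (hfC u)⟩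
    by_cases hu : ∃ u, f u = K
    · obtain ⟨u, rfl⟩ := hu
      obtain ⟨v, hv, hvE⟩ := hfE u
      exact ⟨v, hv, fun h => absurd h hKC, fun u' hu' => hf hu' ▸ hvE⟩
    · obtain ⟨p, hp⟩ := hG.nonempty K hK
      exact ⟨p, hp, fun h => absurd h hKC, fun u hu' => absurd ⟨u, hu'⟩ hu⟩
  choose! pt hpK hpC hpE using hpt
  have hQ : ∀ K ∈ P, ∃ Q, IsMatchingIn E Q ∧ (∀ e ∈ Q, e ⊆ K.erase (pt K)) ∧
      2 * Q.card + 1 = K.card := fun K hK => hG.critical K hK _ (hpK K hK)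
  choose! Q hQM hQK hQc using hQ
  have hUK : ∀ K ∈ P, ∀ x ∈ K, x ∉ U := fun K hK x hx =>
    (mem_sdiff.1 (hG.class_subset K hK hx)).2
  have hsame : ∀ K ∈ P, ∀ K' ∈ P, ∀ x, x ∈ K → x ∈ K' → K = K' := by
    intro K hK K' hK' x hx hx'
    by_contra hne
    exact disjoint_left.1 (hG.disjoint hK hK' hne) hx hx'
  have hcross : ∀ K ∈ P, ∀ e ∈ Q K, ∀ u : U, Disjoint e {(u : V), pt (f u)} := by
    intro K hK e he u
    rw [disjoint_comm, disjoint_insert_left, disjoint_singleton_left]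
    refine ⟨fun h => hUK K hK _ (mem_of_mem_erase (hQK K hK e he h)) u.2, fun h => ?_⟩
    have h1 := hQK K hK e he h
    have h2 := hsame K hK (f u) (hfP u) _ (mem_of_mem_erase h1) (hpK _ (hfP u))
    exact notMem_erase (pt (f u)) K (h2 ▸ h1)
  have hout : ∀ u : U, pt (f u) ∉ U := fun u => hUK _ (hfP u) _ (hpK _ (hfP u))
  have hinj : ∀ u u' : U, (u : V) ∈ ({(u' : V), pt (f u')} : Finset V) → u = u' := by
    intro u u' h
    rcases mem_insert.1 h with h | h
    · exact Subtype.ext h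
    · exact absurd (mem_singleton.1 h ▸ u.2) (hout u')
  refine ⟨P.biUnion Q ∪ U.attach.image fun u : U => ({(u : V), pt (f u)} : Finset V),
    ⟨?_, ?_⟩, ?_, ?_⟩
  · refine union_subset (biUnion_subset.2 fun K hK => (hQM K hK).1) ?_
    intro e he
    obtain ⟨u, -, rfl⟩ := mem_image.1 he
    exact hpE _ (hfP u) u rfl
  · intro e he e' he' hne
    rw [mem_coe, mem_union, mem_biUnion, mem_image] at he he'
    simp only [Function.onFun, id]
    rcases he with ⟨K, hK, he⟩ | ⟨u, -, rfl⟩ <;> rcases he' with ⟨K', hK', he'⟩ | ⟨u', -, rfl⟩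
    · refine disjoint_left.2 fun x hx hx' => ?_
      have := hsame K hK K' hK' x (mem_of_mem_erase (hQK K hK e he hx))
        (mem_of_mem_erase (hQK K' hK' e' he' hx'))
      subst this
      exact disjoint_left.1 ((hQM K hK).2 he he' hne) hx hx'
    · exact hcross K hK e he u'
    · exact (hcross K' hK' e' he' u).symm
    · have huu : u ≠ u' := fun h => hne (by rw [h])
      rw [disjoint_insert_left, disjoint_singleton_left]
      refine ⟨fun h => huu (hinj _ _ h), fun h => ?_⟩
      rcases mem_insert.1 h with h | h
      · exact hout u (h ▸ u'.2)
      · have h1 := hpK _ (hfP u)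
        rw [mem_singleton.1 h] at h1
        exact huu (hf (hsame _ (hfP u) _ (hfP u') _ h1 (hpK _ (hfP u'))))
  · rw [card_union_of_disjoint, card_biUnion, card_image_of_injOn, card_attach, add_comm]
    · congr 1
      exact sum_congr rfl fun K hK => by have := hQc K hK; omega
    · intro u _ u' _ h
      exact hinj u u' (by simp only at h; rw [← h]; exact mem_insert_self _ _)
    · intro K hK K' hK' hne
      refine disjoint_left.2 fun e he he' => hne ?_
      obtain ⟨x, hx⟩ : e.Nonempty := card_pos.1 (by rw [hE e ((hQM K hK).1 he)]; norm_num)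
      exact hsame K hK K' hK' x (mem_of_mem_erase (hQK K hK e he hx))
        (mem_of_mem_erase (hQK K' hK' e he' hx))
    · refine disjoint_left.2 fun e he he' => ?_
      obtain ⟨K, hK, he⟩ := mem_biUnion.1 he
      obtain ⟨u, -, rfl⟩ := mem_image.1 he'
      exact disjoint_left.1 (hcross K hK _ he u) (mem_insert_self _ _) (mem_insert_self _ _)
  · intro hyc
    obtain ⟨e, he, hye⟩ := mem_biUnion.1 hyc
    simp only [id] at hye
    rcases mem_union.1 he with he | he
    · obtain ⟨K, hK, he⟩ := mem_biUnion.1 he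
      have h1 := hQK K hK e he hye
      have h2 := hsame K hK C hC y (mem_of_mem_erase h1) hy
      rw [hpC K hK h2] at h1
      exact notMem_erase _ _ h1
    · obtain ⟨u, -, rfl⟩ := mem_image.1 he
      rcases mem_insert.1 hye with h | h
      · exact hUK C hC y hy (h ▸ u.2)
      · have h1 := hpK _ (hfP u)
        rw [← mem_singleton.1 h] at h1
        exact hfC u (hsame _ (hfP u) C hC y h1 hy)

variable {d : ℕ} {E B : Finset (Finset V)} {ex : V → ℚ}

lemma matchingBound_self_of_odd (hd : 3 ≤ d) (hodd : d % 2 = 1) :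
    matchingBound d d = d * d + d / 2 := by
  have h : d / ((d + 1) / 2) = 1 := Nat.div_eq_of_lt_le (by omega) (by omega)
  rw [matchingBound, h, mul_one]

/-- For odd `d`, a graph whose net weight is nearly extremal has a large factor-critical class `C`
all of whose vertices are missed by matchings of size `d`, and some vertex of `C` has `d` heavy
edges inside `C`.  The matchings are obtained from Hall's theorem, applied to the vertices of `U`
and the classes other than `C` in a Gallai partition. -/
lemma IsCapped.exists_avoidable_class [Fintype V] (h : IsCapped d E B ex) (hd : 3 ≤ d)
    (hodd : d % 2 = 1) (hs : ∀ Q, IsMatchingIn E Q → Q.card ≤ d)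
    (hval : (matchingBound d d : ℚ) - 1 < netWeight E B ex univ) :
    ∃ C : Finset V, (∀ v ∈ C, ∃ Q, IsMatchingIn E Q ∧ Q.card = d ∧ v ∉ Q.biUnion id) ∧
      ∃ y ∈ C, d ≤ (E.filter fun e => y ∈ e ∧ e ∈ B ∧ e ⊆ C).card := by
  classical
  rw [matchingBound_self_of_odd hd hodd] at hval
  obtain ⟨U, P, hG⟩ := exists_gallaiPartition h.uniform univ
  have hcl := hG.card_le d fun Q hQ => hs Q (hQ.mono subset_rfl (hQ.1.trans (filter_subset _ _)))
  have hPU : ∀ K ∈ P, Disjoint U K := fun K hK =>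
    (disjoint_left.2 fun x hx hxU => (mem_sdiff.1 (hG.class_subset K hK hx)).2 hxU).symm
  have hnet := h.netWeight_univ_le_sum hG.disjoint hPU (fun e he => hG.edge e he (subset_univ _))
  have hoddK : ∀ K ∈ P, K.card = 2 * (K.card / 2) + 1 := by
    intro K hK
    obtain ⟨x, hx⟩ := hG.nonempty K hK
    obtain ⟨Q, -, -, hQ⟩ := hG.critical K hK x hx
    omega
  have hsmall : ∀ K ∈ P, K.card / 2 < (d + 1) / 2 →
      netWeight E B ex K ≤ d * (K.card / 2 : ℕ) := by
    intro K hK hlt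
    have := h.netWeight_class_le (hoddK K hK)
    rwa [if_neg (by omega), add_zero] at this
  have hd2 : (1 : ℚ) ≤ (d / 2 : ℕ) := by exact_mod_cast (by omega : 1 ≤ d / 2)
  -- a total weight of `d * d` is too small
  have htot : ∀ N : ℕ, N ≤ d → ¬ netWeight E B ex univ ≤ d * N := by
    intro N hN hle
    have h1 : ((d : ℚ) * N) ≤ d * d := by gcongr
    push_cast at hval
    linarith
  obtain ⟨C, hC, hCm⟩ : ∃ C ∈ P, (d + 1) / 2 ≤ C.card / 2 := by
    by_contra! hcon
    refine htot _ hcl (hnet.trans ?_)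
    have := sum_le_sum fun K hK => hsmall K hK (hcon K hK)
    push_cast
    rw [← mul_sum] at this
    linarith
  have hsumC : C.card / 2 + ∑ K ∈ P.erase C, K.card / 2 = ∑ K ∈ P, K.card / 2 :=
    add_sum_erase P (fun K => K.card / 2) hC
  have hsmall' : ∀ K ∈ P.erase C, netWeight E B ex K ≤ d * (K.card / 2 : ℕ) := by
    intro K hK
    refine hsmall K (mem_of_mem_erase hK) ?_
    have := single_le_sum (f := fun K => K.card / 2) (fun K _ => Nat.zero_le _) hK
    omega
  have hCnet : netWeight E B ex C ≤ d * (C.card / 2 : ℕ) + (d / 2 : ℕ) := by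
    have := h.netWeight_class_le (hoddK C hC)
    rwa [if_pos hCm] at this
  have hnetC : netWeight E B ex univ ≤
      d * (U.card + ∑ K ∈ P.erase C, K.card / 2 : ℕ) + netWeight E B ex C := by
    have h1 := sum_le_sum hsmall'
    rw [← mul_sum] at h1
    have h2 : netWeight E B ex C + ∑ K ∈ P.erase C, netWeight E B ex K =
        ∑ K ∈ P, netWeight E B ex K := add_sum_erase P _ hC
    push_cast at h1 ⊢
    linarith
  have hsize : U.card + ∑ K ∈ P, K.card / 2 = d := by
    refine le_antisymm hcl ?_
    by_contra! hlt
    have h1 : ((d : ℚ) * (U.card + ∑ K ∈ P.erase C, K.card / 2 : ℕ) + d * (C.card / 2 : ℕ)) =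
        d * (U.card + ∑ K ∈ P, K.card / 2 : ℕ) := by
      rw [← hsumC]; push_cast; ring
    have h2 : ((d : ℚ) * (U.card + ∑ K ∈ P, K.card / 2 : ℕ)) ≤ d * (d - 1) := by
      have : ((U.card + ∑ K ∈ P, K.card / 2 : ℕ) : ℚ) + 1 ≤ d := by exact_mod_cast hlt
      gcongr; linarith
    have h3 : (3 : ℚ) ≤ d := by exact_mod_cast hd
    push_cast at hval
    nlinarith
  -- the vertices of `U` can be matched to different classes other than `C`
  have hHall : ∃ f : U → Finset V, Function.Injective f ∧
      ∀ u : U, f u ∈ (P.erase C).filter fun K => ∃ v ∈ K, {(u : V), v} ∈ E := by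
    rw [← all_card_le_biUnion_card_iff_exists_injective]
    intro s
    by_contra! hlt
    set N := s.biUnion fun u => (P.erase C).filter fun K => ∃ v ∈ K, {(u : V), v} ∈ E with hN
    set U' := s.map (Function.Embedding.subtype _) with hU'
    have hU'U : U' ⊆ U := fun x hx => by
      obtain ⟨u, -, rfl⟩ := mem_map.1 hx
      exact u.2
    have hNP : N ⊆ P.erase C := biUnion_subset.2 fun u _ => filter_subset _ _
    -- where Hall's condition fails, `U'`, its neighbouring classes `N` and `C` are merged into one
    -- set `Z`, which is so small that half the sum of the caps is a sufficient bound on it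
    set Z := U' ∪ (insert C N).biUnion id with hZ
    have hNC : C ∉ N := fun hh => notMem_erase C P (hNP hh)
    have hINP : insert C N ⊆ P := insert_subset hC (hNP.trans (erase_subset _ _))
    have hZdisj : ∀ K ∈ P.erase C \ N, Disjoint Z K := by
      intro K hK
      obtain ⟨hK1, hK2⟩ := mem_sdiff.1 hK
      rw [hZ, disjoint_union_left]
      refine ⟨(hPU K (mem_of_mem_erase hK1)).mono_left hU'U, ?_⟩
      refine (disjoint_biUnion_left _ _ _).2 fun K' hK' =>
        hG.disjoint (hINP hK') (mem_of_mem_erase hK1) ?_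
      rintro rfl
      rcases mem_insert.1 hK' with rfl | hK'
      · exact notMem_erase _ _ hK1
      · exact hK2 hK'
    have hZcard : Z.card + (insert C N).card ≤
        2 * (U'.card + ∑ K ∈ insert C N, K.card / 2) + (insert C N).card + 0 := by
      have h1 : ((insert C N).biUnion id).card = ∑ K ∈ insert C N, K.card :=
        card_biUnion (hG.disjoint.subset (by exact_mod_cast hINP))
      have h2 : ∑ K ∈ insert C N, K.card =
          2 * ∑ K ∈ insert C N, K.card / 2 + (insert C N).card := by
        rw [mul_sum, card_eq_sum_ones (insert C N), ← sum_add_distrib]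
        exact sum_congr rfl fun K hK => hoddK K (hINP hK)
      have h3 := card_union_le U' ((insert C N).biUnion id)
      rw [card_insert_of_notMem hNC] at h2 ⊢
      have h4 : U'.card = s.card := card_map _
      rw [← hZ] at h3
      omega
    have hbound := h.netWeight_univ_le_sum (U := U \ U') (P := insert Z (P.erase C \ N)) (by
        rw [coe_insert]
        refine (hG.disjoint.subset ?_).insert fun K hK _ => hZdisj K hK
        exact_mod_cast sdiff_subset.trans (erase_subset _ _)) (by
        intro K hK
        rcases mem_insert.1 hK with rfl | hK
        · rw [hZ, disjoint_union_right]
          refine ⟨sdiff_disjoint, (disjoint_biUnion_right _ _ _).2 fun K' hK' => ?_⟩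
          exact (hPU K' (hINP hK')).mono_left sdiff_subset
        · exact (hPU K (mem_of_mem_erase (mem_sdiff.1 hK).1)).mono_left sdiff_subset) (by
        intro e he
        by_cases hmeet : ∃ u ∈ U \ U', u ∈ e
        · exact Or.inl hmeet
        refine Or.inr ?_
        have hKZ : ∀ K ∈ insert C N, K ⊆ Z := fun K hK =>
          (subset_biUnion_of_mem id hK).trans subset_union_right
        rcases hG.edge e he (subset_univ _) with ⟨u, hu, hue⟩ | ⟨K, hK, heK⟩
        · have hu' : u ∈ U' := by
            by_contra hu'
            exact hmeet ⟨u, mem_sdiff.2 ⟨hu, hu'⟩, hue⟩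
          refine ⟨Z, mem_insert_self _ _, fun v hv => ?_⟩
          by_cases hvU : v ∈ U
          · by_cases hv' : v ∈ U'
            · exact mem_union_left _ hv'
            · exact absurd ⟨v, mem_sdiff.2 ⟨hvU, hv'⟩, hv⟩ hmeet
          · obtain ⟨K, hK, hvK⟩ := hG.exists_class v (mem_sdiff.2 ⟨mem_univ _, hvU⟩)
            refine hKZ K ?_ hvK
            by_cases hKC : K = C
            · exact hKC ▸ mem_insert_self _ _
            · obtain ⟨w, hw, rfl⟩ := mem_map.1 hu'
              have huv : (w : V) ≠ v := fun hh => hvU (hh ▸ w.2)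
              have heq : ({(w : V), v} : Finset V) = e := by
                refine eq_of_subset_of_card_le ?_ ?_
                · intro a; simp only [mem_insert, mem_singleton]
                  rintro (rfl | rfl) <;> assumption
                · rw [h.uniform e he, card_pair huv]
              refine mem_insert_of_mem (mem_biUnion.2 ⟨w, hw, mem_filter.2
                ⟨mem_erase.2 ⟨hKC, hK⟩, v, hvK, heq ▸ he⟩⟩)
        · by_cases hKN : K ∈ insert C N
          · exact ⟨Z, mem_insert_self _ _, heK.trans (hKZ K hKN)⟩
          · rw [mem_insert, not_or] at hKN
            exact ⟨K, mem_insert_of_mem (mem_sdiff.2 ⟨mem_erase.2 ⟨hKN.1, hK⟩, hKN.2⟩), heK⟩)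
    refine htot d le_rfl (hbound.trans ?_)
    have hZnew : Z ∉ P.erase C \ N := fun hZm => by
      obtain ⟨x, hx⟩ := hG.nonempty C hC
      have hxZ : x ∈ Z := mem_union_right _ (mem_biUnion.2 ⟨C, mem_insert_self _ _, hx⟩)
      exact disjoint_left.1 (hZdisj Z hZm) hxZ hxZ
    rw [sum_insert hZnew]
    have h1 : ∑ K ∈ P.erase C \ N, netWeight E B ex K ≤
        d * (∑ K ∈ P.erase C \ N, K.card / 2 : ℕ) := by
      rw [Nat.cast_sum, mul_sum]
      exact sum_le_sum fun K hK => hsmall' K (mem_sdiff.1 hK).1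
    have h2 := h.netWeight_le_half Z
    have h3 : (Z.card : ℚ) ≤ 2 * (U'.card + ∑ K ∈ insert C N, K.card / 2 : ℕ) := by
      exact_mod_cast (by omega : Z.card ≤ 2 * (U'.card + ∑ K ∈ insert C N, K.card / 2))
    have h4 : (U \ U').card + (∑ K ∈ P.erase C \ N, K.card / 2) +
        (U'.card + ∑ K ∈ insert C N, K.card / 2) = d := by
      rw [← hsize, ← hsumC, sum_insert hNC, ← card_sdiff_add_card_eq_card hU'U,
        ← sum_sdiff hNP]
      ring
    have h5 : (((U \ U').card + (∑ K ∈ P.erase C \ N, K.card / 2) +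
        (U'.card + ∑ K ∈ insert C N, K.card / 2) : ℕ) : ℚ) = d := by rw [h4]
    have h6 : (d : ℚ) * Z.card / 2 ≤ d * (U'.card + ∑ K ∈ insert C N, K.card / 2 : ℕ) := by
      have := mul_le_mul_of_nonneg_left h3 (Nat.cast_nonneg (α := ℚ) d)
      linarith
    have h7 : (d : ℚ) * d = d * (U \ U').card + d * (∑ K ∈ P.erase C \ N, K.card / 2 : ℕ) +
        d * (U'.card + ∑ K ∈ insert C N, K.card / 2 : ℕ) := by
      conv_lhs => rw [← h5]
      rw [Nat.cast_add _ (U'.card + _), Nat.cast_add (U \ U').card]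
      rw [h5.symm]; push_cast; ring
    linarith
  obtain ⟨f, hf, hft⟩ := hHall
  refine ⟨C, fun v hv => ?_, ?_⟩
  · rw [← hsize]
    exact hG.exists_matching_missing h.uniform hC hf
      (fun u => mem_of_mem_erase (mem_filter.1 (hft u)).1)
      (fun u => ne_of_mem_erase (mem_filter.1 (hft u)).1) (fun u => (mem_filter.1 (hft u)).2) hv
  · -- otherwise no vertex of `C` reaches the cap `d`, and the class `C` loses too much weight
    by_contra! hcon
    have h1 := h.two_mul_netWeight_le C
    have h2 : ∀ x ∈ C, weightedDegree (E.filter (· ⊆ C)) B x - ex x ≤ d - 2 / 3 := by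
      intro x hx
      by_cases hl : ∃ e ∈ E, e ∉ B ∧ x ∈ e
      · obtain ⟨e, he, heB, hxe⟩ := hl
        exact (sub_le_sub_right (weightedDegree_mono B (filter_subset _ _) x) _).trans
          (h.cap_light e he heB x hxe)
      · push Not at hl
        have h3 : weightedDegree (E.filter (· ⊆ C)) B x ≤
            ((E.filter fun e => x ∈ e ∧ e ∈ B ∧ e ⊆ C).card : ℚ) := by
          rw [weightedDegree, card_eq_sum_ones, Nat.cast_sum, Nat.cast_one]
          refine (sum_le_sum fun e _ => pairWeight_le_one B e).trans ?_
          refine sum_le_sum_of_subset_of_nonneg ?_ fun _ _ _ => zero_le_one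
          intro e he
          simp only [mem_filter] at he ⊢
          refine ⟨he.1.1, he.2, ?_, he.1.2⟩
          by_contra heB
          exact hl e he.1.1 heB he.2
        have h4 : (((E.filter fun e => x ∈ e ∧ e ∈ B ∧ e ⊆ C).card : ℚ)) + 1 ≤ d := by
          exact_mod_cast hcon x hx
        have := h.ex_nonneg x
        linarith
    have h3 := sum_le_card_nsmul C _ _ h2
    rw [nsmul_eq_mul] at h3
    have hCc : (C.card : ℚ) = 2 * (C.card / 2 : ℕ) + 1 := by exact_mod_cast hoddK C hC
    have h5 : (d : ℚ) * (U.card + ∑ K ∈ P.erase C, K.card / 2 : ℕ) =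
        d * d - d * (C.card / 2 : ℕ) := by
      have : U.card + ∑ K ∈ P.erase C, K.card / 2 + C.card / 2 = d := by omega
      have h6 : ((U.card + ∑ K ∈ P.erase C, K.card / 2 : ℕ) : ℚ) = d - (C.card / 2 : ℕ) := by
        rw [eq_sub_iff_add_eq]; exact_mod_cast this
      rw [h6]; ring
    have h6 : (5 : ℚ) ≤ C.card := by
      have : 5 ≤ C.card := by have := hoddK C hC; omega
      exact_mod_cast this
    have h7 : (d : ℚ) = 2 * (d / 2 : ℕ) + 1 := by exact_mod_cast (by omega : d = 2 * (d / 2) + 1)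
    push_cast at hval
    rw [hCc] at h3 h6
    generalize ((d / 2 : ℕ) : ℚ) = q at *
    generalize ((C.card / 2 : ℕ) : ℚ) = m at *
    rw [h5] at hnetC
    nlinarith

end Factor

/-! ### Links -/

section Link

variable {V : Type*} [DecidableEq V]

/-- The link of the vertex `v` in the hypergraph with edge set `H`. -/
def link (H : Finset (Finset V)) (v : V) : Finset (Finset V) :=
  (H.filter (v ∈ ·)).image (·.erase v)

lemma mem_link {H : Finset (Finset V)} {v : V} {P : Finset V} :
    P ∈ link H v ↔ v ∉ P ∧ insert v P ∈ H := by
  simp only [link, mem_image, mem_filter]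
  constructor
  · rintro ⟨e, ⟨he, hv⟩, rfl⟩
    exact ⟨notMem_erase _ _, by rwa [insert_erase hv]⟩
  · rintro ⟨hv, h⟩
    exact ⟨insert v P, ⟨h, mem_insert_self _ _⟩, erase_insert hv⟩

lemma card_of_mem_link {H : Finset (Finset V)} (hH : ∀ e ∈ H, e.card = 3) {v : V} {P : Finset V}
    (hP : P ∈ link H v) : P.card = 2 := by
  obtain ⟨h1, h2⟩ := mem_link.1 hP
  have := hH _ h2
  rw [card_insert_of_notMem h1] at this
  omega

lemma sum_link {M : Type*} [AddCommMonoid M] (H : Finset (Finset V)) (v : V)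
    (f : Finset V → M) : ∑ e ∈ H with v ∈ e, f e = ∑ P ∈ link H v, f (insert v P) := by
  rw [link, sum_image]
  · refine sum_congr rfl fun e he => ?_
    rw [insert_erase (mem_filter.1 he).2]
  · intro e he e' he' h
    rw [mem_coe, mem_filter] at he he'
    simp only at h
    rw [← insert_erase he.2, h, insert_erase he'.2]

lemma card_link_filter (H : Finset (Finset V)) {x y : V} (hxy : x ≠ y) :
    ((link H x).filter (y ∈ ·)).card = (H.filter ({x, y} ⊆ ·)).card := by
  have h : (H.filter ({x, y} ⊆ ·)).card =
      ∑ e ∈ H with x ∈ e, if y ∈ e then 1 else 0 := by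
    rw [← card_filter, filter_filter]
    congr 1
    ext e
    simp [insert_subset_iff]
  rw [h, sum_link, card_filter]
  refine sum_congr rfl fun P _ => ?_
  simp [hxy.symm]

lemma eq_pair_of_mem {e : Finset V} (he : e.card = 2) {x y : V} (hx : x ∈ e) (hy : y ∈ e)
    (hxy : x ≠ y) : e = {x, y} := by
  refine (eq_of_subset_of_card_le ?_ ?_).symm
  · intro a; simp only [mem_insert, mem_singleton]
    rintro (rfl | rfl) <;> assumption
  · rw [he, card_pair hxy]

lemma exists_eq_pair_of_mem {e : Finset V} (he : e.card = 2) {x : V} (hx : x ∈ e) :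
    ∃ y, y ≠ x ∧ e = {x, y} := by
  obtain ⟨y, hy⟩ := card_eq_one.1 (by rw [card_erase_of_mem hx, he] : (e.erase x).card = 1)
  have hye : y ∈ e.erase x := by rw [hy]; exact mem_singleton_self y
  exact ⟨y, ne_of_mem_erase hye,
    eq_pair_of_mem he hx (mem_of_mem_erase hye) (ne_of_mem_erase hye).symm⟩

end Link

/-! ### Distributing the edges over the vertices -/

section Shares

variable {V : Type*} [Fintype V] [DecidableEq V]

/-- The heavy pairs: those which lie in at least `2 * d + 1` edges of `H`.  With so many edges, an
edge through the pair can always be added to a star with fewer than `d` edges, and still avoid one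
more vertex. -/
def heavyPairs (d : ℕ) (H : Finset (Finset V)) : Finset (Finset V) :=
  (powersetCard 2 univ).filter fun P => 2 * d + 1 ≤ (H.filter (P ⊆ ·)).card

/-- The vertices which form a heavy pair with `x`. -/
def heavyNbrs (d : ℕ) (H : Finset (Finset V)) (x : V) : Finset V :=
  univ.filter fun y => {x, y} ∈ heavyPairs d H

/-- The part of the link of `z` which avoids the heavy neighbours of `z`. -/
def lightLink (d : ℕ) (H : Finset (Finset V)) (z : V) : Finset (Finset V) :=
  (link H z).filter fun P => Disjoint P (heavyNbrs d H z)

/-- The share of the edge `e` which its vertex `z` gets.  An edge without heavy pairs is divided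
equally among its three vertices; otherwise it is divided equally among the vertices opposite to
its heavy pairs. -/
def edgeShare (d : ℕ) (H : Finset (Finset V)) (e : Finset V) (z : V) : ℚ :=
  if (e.filter fun x => e.erase x ∈ heavyPairs d H).card = 0 then 1 / 3
  else if e.erase z ∈ heavyPairs d H then
    1 / ((e.filter fun x => e.erase x ∈ heavyPairs d H).card : ℚ) else 0

/-- The amount by which the weighted degree of `x` in the light link of `z` exceeds the cap
`d - 2 / 3`, when `x` lies in a light pair there.  The vertex `x`, which then has heavy neighbours,
takes over this amount from `z`. -/
def excess (d : ℕ) (H : Finset (Finset V)) (z x : V) : ℚ :=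
  if ∃ P ∈ lightLink d H z, P ∉ heavyPairs d H ∧ x ∈ P then
    max 0 (weightedDegree (lightLink d H z) (heavyPairs d H) x - (d - 2 / 3)) else 0

/-- The load of the vertex `z`: its shares of the edges, corrected by the excesses. -/
def load (d : ℕ) (H : Finset (Finset V)) (z : V) : ℚ :=
  ∑ e ∈ H with z ∈ e, edgeShare d H e z - ∑ x, excess d H z x + ∑ x, excess d H x z

variable {d : ℕ} {H : Finset (Finset V)}

lemma card_of_mem_heavyPairs {P : Finset V} (h : P ∈ heavyPairs d H) : P.card = 2 :=
  (mem_powersetCard.1 (mem_filter.1 h).1).2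

lemma mem_heavyNbrs {x y : V} : y ∈ heavyNbrs d H x ↔ {x, y} ∈ heavyPairs d H := by
  simp [heavyNbrs]

lemma mem_heavyNbrs_comm {x y : V} : y ∈ heavyNbrs d H x ↔ x ∈ heavyNbrs d H y := by
  rw [mem_heavyNbrs, mem_heavyNbrs, pair_comm]

lemma notMem_heavyNbrs_self (x : V) : x ∉ heavyNbrs d H x := fun h => by
  have := card_of_mem_heavyPairs (mem_heavyNbrs.1 h)
  simp at this

lemma mem_heavyNbrs_iff {x y : V} (hxy : x ≠ y) :
    y ∈ heavyNbrs d H x ↔ 2 * d + 1 ≤ ((link H x).filter (y ∈ ·)).card := by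
  rw [mem_heavyNbrs, heavyPairs, mem_filter, mem_powersetCard, card_link_filter H hxy]
  simp [card_pair hxy]

lemma excess_nonneg (z x : V) : 0 ≤ excess d H z x := by
  unfold excess; split_ifs; exacts [le_max_left _ _, le_rfl]

lemma sum_edgeShare {e : Finset V} (he : e.card = 3) : ∑ z ∈ e, edgeShare d H e z = 1 := by
  unfold edgeShare
  split_ifs with h
  · rw [sum_const, he]; norm_num
  · rw [← sum_filter, sum_const, nsmul_eq_mul, mul_one_div, div_self]
    exact_mod_cast h

lemma sum_load (hH : ∀ e ∈ H, e.card = 3) : ∑ z, load d H z = H.card := by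
  simp only [load, sum_add_distrib, sum_sub_distrib]
  rw [sum_comm (f := fun z x => excess d H x z), sub_add_cancel]
  simp only [sum_filter]
  rw [sum_comm, card_eq_sum_ones, Nat.cast_sum]
  refine sum_congr rfl fun e he => ?_
  rw [← sum_filter, filter_mem_eq_inter, univ_inter, sum_edgeShare (hH e he), Nat.cast_one]

section Bounded

variable {σ : V → ℕ}

lemma lightLink_subset (z : V) : lightLink d H z ⊆ link H z := filter_subset _ _

/-- The heavy neighbours of `v` extend every matching in the light link of `v`. -/
lemma card_matching_add_card_heavyNbrs_le (hH : ∀ e ∈ H, e.card = 3)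
    (hσ : ∀ v Q, IsMatchingIn (link H v) Q → Q.card ≤ σ v) (hσd : ∀ v, σ v ≤ d) (v : V)
    {Q : Finset (Finset V)} (hQ : IsMatchingIn (lightLink d H v) Q) :
    Q.card + (heavyNbrs d H v).card ≤ σ v := by
  by_contra! hlt
  have hQ' := hQ.mono subset_rfl (hQ.1.trans (lightLink_subset v))
  have h1 := hσ v Q hQ'
  have h2 := hσd v
  obtain ⟨J, hJ, hJc⟩ := exists_subset_card_eq
    (by omega : σ v + 1 - Q.card ≤ (heavyNbrs d H v).card)
  obtain ⟨Q', hQ'1, -, hQ'3, -⟩ := exists_matching_extend (fun P hP => card_of_mem_link hH hP) ∅ J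
    (D := 2 * d + 1) (disjoint_empty_right _) (fun y hy => by
      have hy' := hJ hy
      exact (mem_heavyNbrs_iff (fun h => notMem_heavyNbrs_self v (by rwa [← h] at hy'))).1 hy') hQ'
    ((disjoint_biUnion_right _ _ _).2 fun P hP =>
      ((mem_filter.1 (hQ.1 hP)).2.mono_right hJ).symm) (disjoint_empty_left _)
    (by simp only [card_empty]; omega)
  have := hσ v Q' hQ'1
  omega

lemma card_heavyNbrs_le (hH : ∀ e ∈ H, e.card = 3)
    (hσ : ∀ v Q, IsMatchingIn (link H v) Q → Q.card ≤ σ v) (hσd : ∀ v, σ v ≤ d) (v : V) :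
    (heavyNbrs d H v).card ≤ σ v := by
  simpa using card_matching_add_card_heavyNbrs_le hH hσ hσd v (isMatchingIn_empty _)

lemma card_heavy_le_card_heavyNbrs {E : Finset (Finset V)} (x : V) :
    (E.filter fun e => x ∈ e ∧ e ∈ heavyPairs d H).card ≤ (heavyNbrs d H x).card := by
  refine (card_le_card (t := (heavyNbrs d H x).image fun y => {x, y}) ?_).trans card_image_le
  intro e he
  obtain ⟨-, hxe, heB⟩ := mem_filter.1 he
  obtain ⟨y, -, rfl⟩ := exists_eq_pair_of_mem (card_of_mem_heavyPairs heB) hxe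
  exact mem_image_of_mem _ (mem_heavyNbrs.2 heB)

lemma isCapped_lightLink (hH : ∀ e ∈ H, e.card = 3)
    (hσ : ∀ v Q, IsMatchingIn (link H v) Q → Q.card ≤ σ v) (hσd : ∀ v, σ v ≤ d) (z : V) :
    IsCapped d (lightLink d H z) (heavyPairs d H) (excess d H z) := by
  have hlight : ∀ e ∈ lightLink d H z, e ∉ heavyPairs d H → ∀ x ∈ e,
      weightedDegree (lightLink d H z) (heavyPairs d H) x - excess d H z x ≤ d - 2 / 3 := by
    intro e he heB x hx
    rw [excess, if_pos ⟨e, he, heB, hx⟩]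
    have := le_max_right (0 : ℚ)
      (weightedDegree (lightLink d H z) (heavyPairs d H) x - (d - 2 / 3))
    linarith
  have hheavy : ∀ x, ((lightLink d H z).filter fun e => x ∈ e ∧ e ∈ heavyPairs d H).card ≤ d :=
    fun x => (card_heavy_le_card_heavyNbrs x).trans
      ((card_heavyNbrs_le hH hσ hσd x).trans (hσd x))
  refine ⟨fun e he => card_of_mem_link hH (lightLink_subset z he), hheavy,
    fun x => excess_nonneg z x, fun x => ?_, hlight⟩
  by_cases h : ∃ P ∈ lightLink d H z, P ∉ heavyPairs d H ∧ x ∈ P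
  · obtain ⟨P, hP, hPB, hx⟩ := h
    have := hlight P hP hPB x hx
    linarith
  · rw [excess, if_neg h, sub_zero]
    push Not at h
    refine le_trans ?_ (Nat.cast_le.2 (hheavy x))
    rw [weightedDegree, card_eq_sum_ones, Nat.cast_sum, Nat.cast_one]
    refine (sum_le_sum fun e _ => pairWeight_le_one _ e).trans ?_
    refine sum_le_sum_of_subset_of_nonneg ?_ fun _ _ _ => zero_le_one
    intro e he
    simp only [mem_filter] at he ⊢
    refine ⟨he.1, he.2, ?_⟩
    by_contra heB
    exact h e he.1 heB he.2

/-- The shares of `z` outside its light link come from edges with two heavy pairs, one of them at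
`z`, so they are at most `1 / 2` each. -/
lemma sum_edgeShare_le (hH : ∀ e ∈ H, e.card = 3)
    (hσ : ∀ v Q, IsMatchingIn (link H v) Q → Q.card ≤ σ v) (hσd : ∀ v, σ v ≤ d) (z : V) :
    ∑ e ∈ H with z ∈ e, edgeShare d H e z ≤
      ∑ P ∈ lightLink d H z, pairWeight (heavyPairs d H) P +
        (heavyNbrs d H z).card * ((d : ℚ) - 1) / 2 := by
  rw [sum_link, ← sum_filter_add_sum_filter_not (link H z) fun P => Disjoint P (heavyNbrs d H z)]
  refine add_le_add (sum_le_sum fun P hP => ?_) ?_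
  · obtain ⟨hPl, hPd⟩ := mem_filter.1 hP
    obtain ⟨hzP, hPH⟩ := mem_link.1 hPl
    have h2 := card_of_mem_link hH hPl
    have hsub : ((insert z P).filter fun x => (insert z P).erase x ∈ heavyPairs d H) ⊆ {z} := by
      intro x hx
      obtain ⟨hx1, hx2⟩ := mem_filter.1 hx
      rw [mem_singleton]
      by_contra hxz
      have hxP := mem_of_mem_insert_of_ne hx1 hxz
      obtain ⟨y, hyx, hPe⟩ := exists_eq_pair_of_mem h2 hxP
      have hyP : y ∈ P := by rw [hPe]; simp
      have : (insert z P).erase x = {z, y} := by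
        rw [erase_insert_of_ne (Ne.symm hxz)]
        rw [hPe, erase_insert (by simpa using hyx.symm)]
      rw [this] at hx2
      exact disjoint_left.1 hPd hyP (mem_heavyNbrs.2 hx2)
    have hcard := card_le_card hsub
    rw [card_singleton] at hcard
    unfold edgeShare pairWeight
    rw [erase_insert hzP]
    by_cases hPB : P ∈ heavyPairs d H
    · have h1 : 0 < ((insert z P).filter fun x => (insert z P).erase x ∈ heavyPairs d H).card :=
        card_pos.2 ⟨z, mem_filter.2 ⟨mem_insert_self _ _, by rwa [erase_insert hzP]⟩⟩
      rw [if_neg (by omega), if_pos hPB, if_pos hPB, show (filter _ _).card = 1 by omega]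
      norm_num
    · simp only [hPB, if_false]; split_ifs <;> norm_num
  · have h1 : ∀ P ∈ (link H z).filter fun P => ¬ Disjoint P (heavyNbrs d H z),
        edgeShare d H (insert z P) z ≤ if P ∈ heavyPairs d H then 1 / 2 else 0 := by
      intro P hP
      obtain ⟨hPl, hPd⟩ := mem_filter.1 hP
      obtain ⟨hzP, hPH⟩ := mem_link.1 hPl
      obtain ⟨x, hxP, hxN⟩ := not_disjoint_iff.1 hPd
      obtain ⟨y, hyx, hPe⟩ := exists_eq_pair_of_mem (card_of_mem_link hH hPl) hxP
      have hyP : y ∈ P := by rw [hPe]; simp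
      have hyz : y ≠ z := fun h => hzP (h ▸ hyP)
      have hey : (insert z P).erase y = {z, x} := by
        rw [erase_insert_of_ne hyz.symm, hPe, pair_comm, erase_insert (by simpa using hyx)]
      have hyf : y ∈ (insert z P).filter fun x => (insert z P).erase x ∈ heavyPairs d H :=
        mem_filter.2 ⟨mem_insert_of_mem hyP, by rw [hey]; exact mem_heavyNbrs.1 hxN⟩
      unfold edgeShare
      rw [erase_insert hzP, if_neg (card_pos.2 ⟨y, hyf⟩).ne']
      split_ifs with hPB
      · have h2 : 2 ≤ ((insert z P).filter
            fun x => (insert z P).erase x ∈ heavyPairs d H).card := by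
          rw [← card_pair hyz]
          refine card_le_card (insert_subset hyf (singleton_subset_iff.2 ?_))
          exact mem_filter.2 ⟨mem_insert_self _ _, by rwa [erase_insert hzP]⟩
        have h3 : (2 : ℚ) ≤ (((insert z P).filter
            fun x => (insert z P).erase x ∈ heavyPairs d H).card : ℕ) := by exact_mod_cast h2
        exact one_div_le_one_div_of_le (by norm_num) h3
      · exact le_rfl
    refine (sum_le_sum h1).trans ?_
    rw [← sum_filter, sum_const, nsmul_eq_mul]
    have h2 : (((link H z).filter fun P => ¬ Disjoint P (heavyNbrs d H z)).filter
        fun P => P ∈ heavyPairs d H).card ≤ (heavyNbrs d H z).card * (d - 1) := by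
      refine (card_le_card (t := (heavyNbrs d H z).biUnion fun x =>
        ((heavyNbrs d H x).erase z).image fun y => {x, y}) ?_).trans ?_
      · intro P hP
        obtain ⟨hP, hPB⟩ := mem_filter.1 hP
        obtain ⟨hPl, hPd⟩ := mem_filter.1 hP
        obtain ⟨x, hxP, hxN⟩ := not_disjoint_iff.1 hPd
        obtain ⟨y, hyx, hPe⟩ := exists_eq_pair_of_mem (card_of_mem_link hH hPl) hxP
        refine mem_biUnion.2 ⟨x, hxN, mem_image.2 ⟨y, mem_erase.2 ⟨?_, ?_⟩, hPe.symm⟩⟩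
        · rintro rfl
          exact (mem_link.1 hPl).1 (by rw [hPe]; simp)
        · rw [mem_heavyNbrs, ← hPe]; exact hPB
      · refine card_biUnion_le_card_mul _ _ _ fun x hx => card_image_le.trans ?_
        rw [card_erase_of_mem (mem_heavyNbrs_comm.1 hx)]
        exact Nat.sub_le_sub_right ((card_heavyNbrs_le hH hσ hσd x).trans (hσd x)) 1
    rcases Nat.eq_zero_or_pos d with hd0 | hd0
    · have h3 : (heavyNbrs d H z).card = 0 := by
        have := (card_heavyNbrs_le hH hσ hσd z).trans (hσd z)
        omega
      rw [h3, zero_mul] at h2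
      rw [h3, Nat.le_zero.1 h2]; simp
    · have h3 : (((((link H z).filter fun P => ¬ Disjoint P (heavyNbrs d H z)).filter
        fun P => P ∈ heavyPairs d H).card : ℕ) : ℚ) ≤ (heavyNbrs d H z).card * ((d : ℚ) - 1) := by
        have := Nat.cast_le (α := ℚ).2 h2
        rwa [Nat.cast_mul, Nat.cast_sub hd0, Nat.cast_one] at this
      linarith

/-- If `z` is relieved at `x`, then `z` has large degree in the light link of `x`, and the amount
taken over is small. -/
lemma excess_pos_imp (hH : ∀ e ∈ H, e.card = 3) {z x : V} (h : 0 < excess d H z x) :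
    ∃ t : ℕ, 1 ≤ t ∧ t ≤ ((lightLink d H x).filter (z ∈ ·)).card ∧
      excess d H z x ≤ (heavyNbrs d H x).card + (t : ℚ) / 3 - d + 2 / 3 ∧
      excess d H z x ≤ (2 * ((heavyNbrs d H x).card : ℚ) - d + 2) / 3 := by
  have hex : ∃ P ∈ lightLink d H z, P ∉ heavyPairs d H ∧ x ∈ P := by
    by_contra hcon
    rw [excess, if_neg hcon] at h
    exact lt_irrefl _ h
  rw [excess, if_pos hex] at h ⊢
  obtain ⟨P₀, hP₀, hP₀B, hxP₀⟩ := hex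
  have hxz : x ≠ z := fun hxz => (mem_link.1 (lightLink_subset z hP₀)).1 (hxz ▸ hxP₀)
  have hxN : x ∉ heavyNbrs d H z := disjoint_left.1 (mem_filter.1 hP₀).2 hxP₀
  set L := (lightLink d H z).filter (x ∈ ·) with hL
  have hsplit := card_filter_add_card_filter_not (s := L) (fun P => P ∈ heavyPairs d H)
  set b := (L.filter fun P => P ∈ heavyPairs d H).card with hb
  set t := (L.filter fun P => ¬ P ∈ heavyPairs d H).card with ht
  have hbj : b ≤ (heavyNbrs d H x).card := by
    rw [hb, hL, filter_filter]; exact card_heavy_le_card_heavyNbrs x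
  have hLd : L.card ≤ 2 * d := by
    have h1 := (mem_heavyNbrs_iff (d := d) (H := H) hxz.symm).not.1 hxN
    have h2 := card_le_card (filter_subset_filter (x ∈ ·) (lightLink_subset (d := d) (H := H) z))
    rw [← hL] at h2
    omega
  have hwd : weightedDegree (lightLink d H z) (heavyPairs d H) x = b + (t : ℚ) / 3 := by
    rw [weightedDegree, ← hL, ← sum_filter_add_sum_filter_not L fun P => P ∈ heavyPairs d H]
    congr 1
    · rw [hb, card_eq_sum_ones, Nat.cast_sum]
      refine sum_congr rfl fun P hP => ?_
      simp [pairWeight, (mem_filter.1 hP).2]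
    · rw [ht, card_eq_sum_ones, Nat.cast_sum, sum_div]
      refine sum_congr rfl fun P hP => ?_
      simp [pairWeight, (mem_filter.1 hP).2]
  have hmax : max 0 (weightedDegree (lightLink d H z) (heavyPairs d H) x - (d - 2 / 3)) =
      b + (t : ℚ) / 3 - (d - 2 / 3) := by
    rw [hwd] at h ⊢
    exact max_eq_right (by by_contra hc; rw [max_eq_left (by linarith)] at h; exact lt_irrefl _ h)
  rw [hmax]
  have hbjq : (b : ℚ) ≤ (heavyNbrs d H x).card := by exact_mod_cast hbj
  have hLq : (b : ℚ) + t ≤ 2 * d := by exact_mod_cast (by omega : b + t ≤ 2 * d)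
  refine ⟨t, card_pos.2 ⟨P₀, mem_filter.2 ⟨mem_filter.2 ⟨hP₀, hxP₀⟩, hP₀B⟩⟩, ?_, by linarith,
    by linarith⟩
  refine card_le_card_of_injOn (fun P => (insert z P).erase x) ?_ ?_
  · intro P hP
    rw [mem_coe, mem_filter, hL, mem_filter] at hP
    obtain ⟨⟨hP, hxP⟩, hPB⟩ := hP
    obtain ⟨hPl, hPd⟩ := mem_filter.1 hP
    obtain ⟨hzP, hPH⟩ := mem_link.1 hPl
    obtain ⟨y, hyx, hPe⟩ := exists_eq_pair_of_mem (card_of_mem_link hH hPl) hxP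
    have hyP : y ∈ P := by rw [hPe]; simp
    have hxi : x ∈ insert z P := mem_insert_of_mem hxP
    refine mem_coe.2 (mem_filter.2 ⟨mem_filter.2 ⟨mem_link.2
      ⟨notMem_erase _ _, by rwa [insert_erase hxi]⟩, ?_⟩, mem_erase.2 ⟨hxz.symm,
        mem_insert_self _ _⟩⟩)
    change Disjoint ((insert z P).erase x) _
    rw [erase_insert_of_ne hxz.symm, hPe, erase_insert (by simpa using hyx.symm),
      disjoint_insert_left, disjoint_singleton_left]
    refine ⟨fun hh => hxN (mem_heavyNbrs_comm.1 hh), fun hh => hPB ?_⟩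
    rw [hPe]; exact mem_heavyNbrs.1 hh
  · intro P hP P' hP' heq
    rw [mem_coe, mem_filter, hL, mem_filter] at hP hP'
    have h1 := (mem_link.1 (lightLink_subset z hP.1.1)).1
    have h2 := (mem_link.1 (lightLink_subset z hP'.1.1)).1
    have h3 : insert z P = insert z P' := by
      rw [← insert_erase (mem_insert_of_mem hP.1.2 : x ∈ insert z P)]
      simp only at heq
      rw [heq, insert_erase (mem_insert_of_mem hP'.1.2)]
    rw [← erase_insert h1, h3, erase_insert h2]

end Bounded
end Shares

/-! ### The load of a vertex -/

section Load

variable {V : Type*} [Fintype V] [DecidableEq V] {d : ℕ} {H : Finset (Finset V)} {σ : V → ℕ}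

/-- In a graph of matching number one, at most three vertices have degree two or more. -/
lemma card_le_three_of_matching_le_one {E : Finset (Finset V)} (hE : ∀ e ∈ E, e.card = 2)
    (hν : ∀ Q, IsMatchingIn E Q → Q.card ≤ 1) {Z : Finset V}
    (hZ : ∀ z ∈ Z, 2 ≤ (E.filter (z ∈ ·)).card) : Z.card ≤ 3 := by
  rcases Z.eq_empty_or_nonempty with rfl | ⟨z, hz⟩
  · simp
  obtain ⟨P, hP, P', hP', hne⟩ := one_lt_card.1 (hZ z hz)
  obtain ⟨hPE, hzP⟩ := mem_filter.1 hP
  obtain ⟨hPE', hzP'⟩ := mem_filter.1 hP'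
  obtain ⟨a, haz, rfl⟩ := exists_eq_pair_of_mem (hE P hPE) hzP
  obtain ⟨b, hbz, rfl⟩ := exists_eq_pair_of_mem (hE P' hPE') hzP'
  have hmeet : ∀ e ∈ E, ∀ f ∈ E, ¬ Disjoint e f := by
    intro e he f hf hd
    have h1 := hν _ (((isMatchingIn_empty E).insert he (by simp)).insert hf
      (by simpa using hd.symm))
    have hfe : f ∉ insert e (∅ : Finset (Finset V)) := by
      simp only [insert_empty_eq, mem_singleton]
      rintro rfl
      have := hE f hf
      rw [disjoint_self_iff_empty] at hd
      simp [hd] at this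
    rw [card_insert_of_notMem hfe] at h1
    simp at h1
  refine (card_le_card (t := {z, a, b}) fun y hy => ?_).trans card_le_three
  by_contra hy'
  simp only [mem_insert, mem_singleton, not_or] at hy'
  obtain ⟨e, he, hye, hde⟩ := exists_edge_disjoint hE (y := y) (F := {z})
    (by simpa using hy'.1) (by have := hZ y hy; simp; omega)
  rw [disjoint_singleton_right] at hde
  obtain ⟨w, hwy, rfl⟩ := exists_eq_pair_of_mem (hE e he) hye
  have h1 := hmeet _ he _ hPE
  have h2 := hmeet _ he _ hPE'
  simp only [mem_insert, mem_singleton, not_or, disjoint_insert_left, disjoint_singleton_left] at *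
  have hab : a ≠ b := fun h => hne (by rw [h])
  have hwz : w ≠ z := fun h => hde.2 h.symm
  by_cases hwa : w = a
  · subst hwa
    exact h2 ⟨⟨hy'.1, hy'.2.2⟩, hwz, hab⟩
  · exact h1 ⟨⟨hy'.1, hy'.2.1⟩, hwz, hwa⟩

/-- What a vertex takes over from the other vertices is small compared to what it lacks itself
because of its heavy neighbours. -/
lemma sum_excess_le (hd : 2 ≤ d) (hH : ∀ e ∈ H, e.card = 3)
    (hσ : ∀ v Q, IsMatchingIn (link H v) Q → Q.card ≤ σ v) (hσd : ∀ v, σ v ≤ d) (x : V) :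
    ∑ z, excess d H z x ≤ if (heavyNbrs d H x).card = 0 then 0 else
      ((heavyNbrs d H x).card : ℚ) * (d + 1) / 2 - 1 + if d % 2 = 0 then (d : ℚ) / 2 else 0 := by
  set j := (heavyNbrs d H x).card with hj
  set Z := univ.filter fun z => 0 < excess d H z x with hZ
  have hjd : j ≤ d := (card_heavyNbrs_le hH hσ hσd x).trans (hσd x)
  have hd2 : (2 : ℚ) ≤ d := by exact_mod_cast hd
  have hsum : ∑ z, excess d H z x = ∑ z ∈ Z, excess d H z x := by
    rw [hZ, sum_filter]
    refine sum_congr rfl fun z _ => ?_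
    split_ifs with h
    · rfl
    · exact le_antisymm (not_lt.1 h) (excess_nonneg z x)
  have hE : ∀ e ∈ lightLink d H x, e.card = 2 := fun e he =>
    card_of_mem_link hH (lightLink_subset x he)
  have hν : ∀ Q, IsMatchingIn (lightLink d H x) Q → Q.card ≤ d - j := by
    intro Q hQ
    have h1 := card_matching_add_card_heavyNbrs_le hH hσ hσd x hQ
    have h2 := hσd x
    omega
  have hpar : (0 : ℚ) ≤ if d % 2 = 0 then (d : ℚ) / 2 else 0 := by split_ifs <;> linarith
  rw [hsum]
  rcases Z.eq_empty_or_nonempty with hZe | ⟨z₀, hz₀⟩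
  · rw [hZe, sum_empty]
    split_ifs with h0 h1
    · exact le_rfl
    · have : (1 : ℚ) ≤ j := by exact_mod_cast Nat.one_le_iff_ne_zero.2 h0
      nlinarith
    · have h3 : (1 : ℚ) ≤ j := by exact_mod_cast Nat.one_le_iff_ne_zero.2 h0
      have : (3 : ℚ) ≤ d := by exact_mod_cast (by omega : 3 ≤ d)
      nlinarith
  have hS : 1 ≤ d - j := by
    obtain ⟨t, ht1, ht2, -⟩ := excess_pos_imp hH (mem_filter.1 hz₀).2
    obtain ⟨P, hP⟩ := card_pos.1 (by omega : 0 < ((lightLink d H x).filter (z₀ ∈ ·)).card)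
    simpa using hν _ ((isMatchingIn_empty _).insert (mem_filter.1 hP).1 (by simp))
  have hjpos : j ≠ 0 := by
    intro h0
    obtain ⟨t, -, -, -, h4⟩ := excess_pos_imp hH (mem_filter.1 hz₀).2
    have := (mem_filter.1 hz₀).2
    rw [← hj, h0] at h4
    push_cast at h4
    linarith
  rw [if_neg hjpos]
  have hj1 : (1 : ℚ) ≤ j := by exact_mod_cast Nat.one_le_iff_ne_zero.2 hjpos
  have hle : ∀ z ∈ Z, excess d H z x ≤ (2 * (j : ℚ) - d + 2) / 3 := fun z hz => by
    obtain ⟨t, -, -, -, h4⟩ := excess_pos_imp hH (mem_filter.1 hz).2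
    exact h4
  have hSq : ((d - j : ℕ) : ℚ) = d - j := by rw [Nat.cast_sub hjd]
  by_cases hS2 : 2 ≤ d - j
  · -- the light link of `x` has matching number at most `d - j`, so it has at most `d - j` vertices
    -- of this degree
    have hdeg : ∀ z ∈ Z, 3 * (d - j) - 1 ≤ ((lightLink d H x).filter (z ∈ ·)).card := by
      intro z hz
      have hpos := (mem_filter.1 hz).2
      obtain ⟨t, ht1, ht2, h3, -⟩ := excess_pos_imp hH hpos
      refine le_trans ?_ ht2
      have h5 : (3 * (d - j : ℕ) : ℚ) < t + 2 := by
        rw [hSq]; rw [← hj] at h3; linarith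
      have h6 : 3 * (d - j) < t + 2 := by exact_mod_cast h5
      omega
    have hZc : Z.card ≤ d - j := by
      by_contra! hlt
      obtain ⟨J, hJ, hJc⟩ := exists_subset_card_eq (Nat.succ_le_of_lt hlt)
      obtain ⟨Q, hQ1, -, hQ3, -⟩ := exists_matching_extend hE ∅ J (disjoint_empty_right _)
        (fun y hy => hdeg y (hJ hy)) (isMatchingIn_empty _) (by simp) (by simp)
        (by simp only [card_empty]; omega)
      have := hν Q hQ1
      simp only [card_empty] at hQ3
      omega
    have hpos : 0 ≤ (2 * (j : ℚ) - d + 2) / 3 := (excess_nonneg _ _).trans (hle z₀ hz₀)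
    have h1 : ∑ z ∈ Z, excess d H z x ≤ ((d : ℚ) - j) * ((2 * (j : ℚ) - d + 2) / 3) := by
      refine (sum_le_card_nsmul Z _ _ hle).trans ?_
      rw [nsmul_eq_mul, ← hSq]
      exact mul_le_mul_of_nonneg_right (by exact_mod_cast hZc) hpos
    have h2 : (2 : ℚ) ≤ d - j := by rw [← hSq]; exact_mod_cast hS2
    have h3 : ((d : ℚ) - j) * ((2 * (j : ℚ) - d + 2) / 3) ≤ (d - j) * (j / 3) := by
      gcongr; linarith
    nlinarith
  · have hjd1 : (j : ℚ) = d - 1 := by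
      have : d - j = 1 := by omega
      rw [this] at hSq
      push_cast at hSq; linarith
    have hν1 : ∀ Q, IsMatchingIn (lightLink d H x) Q → Q.card ≤ 1 := fun Q hQ => by
      have := hν Q hQ; omega
    -- now the light link of `x` is a star or a triangle, possibly with isolated vertices
    have hdeg : ∀ z ∈ Z, 2 ≤ ((lightLink d H x).filter (z ∈ ·)).card := by
      intro z hz
      obtain ⟨t, ht1, ht2, h3, -⟩ := excess_pos_imp hH (mem_filter.1 hz).2
      refine le_trans ?_ ht2
      have hpos := (mem_filter.1 hz).2
      have h5 : (1 : ℚ) < t := by rw [← hj, hjd1] at h3; linarith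
      exact_mod_cast h5
    have hkey : ∑ z ∈ Z, excess d H z x ≤ max 1 ((d : ℚ) / 3) := by
      by_cases hbig : ∃ z ∈ Z, 3 ≤ ((lightLink d H x).filter (z ∈ ·)).card
      · obtain ⟨z, hz, hz3⟩ := hbig
        have hZ1 : Z = {z} := by
          refine eq_singleton_iff_unique_mem.2 ⟨hz, fun y hy => ?_⟩
          by_contra hyz
          obtain ⟨e, he, hye, hze⟩ := exists_edge_disjoint hE (y := y) (F := {z})
            (by simpa using hyz) (by have := hdeg y hy; simp; omega)
          obtain ⟨Q, hQ1, -, hQ3, -⟩ := exists_matching_extend hE ∅ {z} (D := 3)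
            (disjoint_empty_right _) (by simpa using hz3)
            ((isMatchingIn_empty _).insert he (by simp)) (by simpa using hze.symm) (by simp)
            (by simp)
          have := hν1 Q hQ1
          simp at hQ3
          omega
        rw [hZ1, sum_singleton]
        refine (hle z hz).trans (le_max_of_le_right ?_)
        rw [hjd1]; linarith
      · push Not at hbig
        have h13 : ∀ z ∈ Z, excess d H z x ≤ 1 / 3 := by
          intro z hz
          obtain ⟨t, ht1, ht2, h3, -⟩ := excess_pos_imp hH (mem_filter.1 hz).2
          have h5 : (t : ℚ) ≤ 2 := by
            have := hbig z hz
            exact_mod_cast (by omega : t ≤ 2)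
          rw [← hj, hjd1] at h3; linarith
        refine le_max_of_le_left ((sum_le_card_nsmul Z _ _ h13).trans ?_)
        have : (Z.card : ℚ) ≤ 3 := by
          exact_mod_cast card_le_three_of_matching_le_one hE hν1 hdeg
        rw [nsmul_eq_mul]; linarith
    refine hkey.trans (max_le ?_ ?_)
    · split_ifs with hp
      · nlinarith
      · have : (3 : ℚ) ≤ d := by exact_mod_cast (by omega : 3 ≤ d)
        nlinarith
    · split_ifs with hp
      · nlinarith
      · have : (3 : ℚ) ≤ d := by exact_mod_cast (by omega : 3 ≤ d)
        nlinarith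

/-- Every unit by which the matching number falls short of `d` costs at least `d` edges; for even
`d` there is an additional loss. -/
lemma matchingBound_add_le (hd : 2 ≤ d) {s : ℕ} (hs : s < d) :
    (matchingBound d s : ℚ) + d * (d - s) + (if d % 2 = 0 then (d : ℚ) / 2 else 0) ≤
      matchingBound d d := by
  have hds : ((d - s : ℕ) : ℚ) = d - s := Nat.cast_sub hs.le
  rw [← hds]
  have hmul : d * s + d * (d - s) = d * d := by rw [← mul_add, Nat.add_sub_cancel' hs.le]
  split_ifs with hp
  · have h1 : ((d / 2 : ℕ) : ℚ) = (d : ℚ) / 2 := by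
      rw [Nat.cast_div (Nat.dvd_of_mod_eq_zero hp) (by norm_num)]; norm_num
    rw [← h1]
    have h2 : (d + 1) / 2 = d / 2 := by omega
    have h3 : d / (d / 2) = 2 := Nat.div_eq_of_lt_le (by omega) (by omega)
    have h4 : s / (d / 2) ≤ 1 :=
      Nat.lt_succ_iff.1 ((Nat.div_lt_iff_lt_mul (by omega)).2 (by omega))
    have h5 : matchingBound d s + d * (d - s) + d / 2 ≤ matchingBound d d := by
      unfold matchingBound
      rw [h2, h3]
      have := Nat.mul_le_mul_left (d / 2) h4
      omega
    exact_mod_cast h5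
  · rw [add_zero]
    have h5 : matchingBound d s + d * (d - s) ≤ matchingBound d d := by
      unfold matchingBound
      have := Nat.mul_le_mul_left (d / 2) (Nat.div_le_div_right (c := (d + 1) / 2) hs.le)
      omega
    exact_mod_cast h5

/-- If `z` has a heavy neighbour or only short stars, then its load is smaller than the bound by
one; in the latter case there is also room for `d - σ z + 1` more edges, one for each popular
color. -/
lemma load_le_of_deficient (hd : 2 ≤ d) (hH : ∀ e ∈ H, e.card = 3)
    (hσ : ∀ v Q, IsMatchingIn (link H v) Q → Q.card ≤ σ v) (hσd : ∀ v, σ v ≤ d) (z : V)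
    (h : σ z < d ∨ heavyNbrs d H z ≠ ∅) :
    load d H z + (if σ z < d then (d - σ z : ℚ) + 1 else 0) ≤ matchingBound d d - 1 := by
  set j := (heavyNbrs d H z).card with hj
  have h1 := sum_edgeShare_le hH hσ hσd z
  have h2 := sum_excess_le hd hH hσ hσd z
  have hjσ := card_heavyNbrs_le hH hσ hσd z
  have hσz := hσd z
  have h3 := (isCapped_lightLink hH hσ hσd z).netWeight_le_matchingBound (by omega)
    (s := σ z - j) (fun Q hQ => by
      have := card_matching_add_card_heavyNbrs_le hH hσ hσd z hQ
      omega)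
  have h4 : netWeight (lightLink d H z) (heavyPairs d H) (excess d H z) univ =
      ∑ P ∈ lightLink d H z, pairWeight (heavyPairs d H) P - ∑ x, excess d H z x := by
    simp [netWeight]
  rw [← hj] at h1 h2
  have hlt : σ z - j < d := by
    rcases h with h | h
    · omega
    · have := card_pos.2 (nonempty_iff_ne_empty.2 h)
      omega
  have h5 := matchingBound_add_le hd hlt
  have hcast : ((σ z - j : ℕ) : ℚ) = σ z - j := Nat.cast_sub hjσ
  rw [hcast] at h5
  have hd2 : (2 : ℚ) ≤ d := by exact_mod_cast hd
  have hσq : (σ z : ℚ) ≤ d := by exact_mod_cast hσz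
  unfold load
  have hmain : ∑ z' , excess d H z' z ≤ d * (d - (σ z - j)) - j * ((d : ℚ) - 1) / 2 - 1 +
      (if d % 2 = 0 then (d : ℚ) / 2 else 0) - (if σ z < d then (d - σ z : ℚ) + 1 else 0) := by
    by_cases hj0 : j = 0
    · rw [if_pos hj0] at h2
      have hlt' : σ z < d := by omega
      have hs1 : (σ z : ℚ) + 1 ≤ d := by exact_mod_cast hlt'
      rw [if_pos hlt', hj0]
      refine h2.trans ?_
      push_cast
      split_ifs with hp
      · nlinarith
      · have : (3 : ℚ) ≤ d := by exact_mod_cast (by omega : 3 ≤ d)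
        nlinarith
    · rw [if_neg hj0] at h2
      refine h2.trans ?_
      generalize (if d % 2 = 0 then (d : ℚ) / 2 else 0) = p
      split_ifs with hq
      · have hs1 : (σ z : ℚ) + 1 ≤ d := by exact_mod_cast hq
        nlinarith
      · have : (σ z : ℚ) = d := by exact_mod_cast (by omega : σ z = d)
        rw [this]; linarith
  linarith

lemma load_le_of_heavyNbrs_eq_empty (hd : 2 ≤ d) (hH : ∀ e ∈ H, e.card = 3)
    (hσ : ∀ v Q, IsMatchingIn (link H v) Q → Q.card ≤ σ v) (hσd : ∀ v, σ v ≤ d) {z : V}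
    (h : heavyNbrs d H z = ∅) :
    load d H z ≤ netWeight (lightLink d H z) (heavyPairs d H) (excess d H z) univ := by
  have h1 := sum_edgeShare_le hH hσ hσd z
  have h2 := sum_excess_le hd hH hσ hσd z
  have h4 : netWeight (lightLink d H z) (heavyPairs d H) (excess d H z) univ =
      ∑ P ∈ lightLink d H z, pairWeight (heavyPairs d H) P - ∑ x, excess d H z x := by
    simp [netWeight]
  rw [h, card_empty] at h1 h2
  rw [if_pos rfl] at h2
  unfold load
  push_cast at h1
  linarith

end Load

/-! ### Stars, matchings in links, and the lower bound for the anti-Ramsey number -/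

section Copies

variable {V : Type*} [DecidableEq V]

/-- A matching of pairs avoiding `v` spans a star with core `v`. -/
lemma exists_star_embedding {k : ℕ} {v : V} {Q : Finset (Finset V)}
    (hQ : (Q : Set (Finset V)).PairwiseDisjoint id) (h2 : ∀ P ∈ Q, P.card = 2)
    (hv : ∀ P ∈ Q, v ∉ P) (hk : Q.card = k) :
    ∃ (φ : Option (Fin k × Bool) ↪ V) (f : Fin k → Finset V), Function.Injective f ∧
      (∀ i, f i ∈ Q) ∧ ∀ i, ({none, some (i, false), some (i, true)} :
        Finset (Option (Fin k × Bool))).map φ = insert v (f i) := by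
  set f : Fin k → Finset V := fun i => ((Q.equivFinOfCardEq hk).symm i : Finset V) with hf
  have hfQ : ∀ i, f i ∈ Q := fun i => ((Q.equivFinOfCardEq hk).symm i).2
  have hinj : Function.Injective f := fun i j h =>
    (Q.equivFinOfCardEq hk).symm.injective (Subtype.ext h)
  have hab : ∀ i, ∃ a b, a ≠ b ∧ f i = {a, b} := fun i => card_eq_two.1 (h2 _ (hfQ i))
  choose a b hne hfe using hab
  have hmema : ∀ i, a i ∈ f i := fun i => by rw [hfe]; simp
  have hmemb : ∀ i, b i ∈ f i := fun i => by rw [hfe]; simp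
  have hsame : ∀ i j x, x ∈ f i → x ∈ f j → i = j := by
    intro i j x hi hj
    by_contra hij
    exact disjoint_left.1 (hQ (hfQ i) (hfQ j) fun h => hij (hinj h)) hi hj
  have hva : ∀ i, v ≠ a i := fun i h => hv _ (hfQ i) (h ▸ hmema i)
  have hvb : ∀ i, v ≠ b i := fun i h => hv _ (hfQ i) (h ▸ hmemb i)
  let g : Option (Fin k × Bool) → V := fun o => o.elim v fun p => if p.2 then b p.1 else a p.1
  have hg : Function.Injective g := by
    rintro (_ | ⟨i, _ | _⟩) (_ | ⟨j, _ | _⟩) h <;> simp only [g, Option.elim] at h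
    · rfl
    · exact absurd h (hva j)
    · exact absurd h (hvb j)
    · exact absurd h.symm (hva i)
    · rw [hsame i j (a i) (hmema i) (by simp at h; rw [h]; exact hmema j)]
    · have hij := hsame i j (a i) (hmema i) (by simp at h; rw [h]; exact hmemb j)
      subst hij
      simp at h
      exact absurd h (hne i)
    · exact absurd h.symm (hvb i)
    · have hij := hsame i j (b i) (hmemb i) (by simp at h; rw [h]; exact hmema j)
      subst hij
      simp at h
      exact absurd h.symm (hne i)
    · rw [hsame i j (b i) (hmemb i) (by simp at h; rw [h]; exact hmemb j)]
  refine ⟨⟨g, hg⟩, f, hinj, hfQ, fun i => ?_⟩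
  rw [hfe i]
  simp [map_insert, g]

/-- The pairs of a copy of a star, without the core, form a matching. -/
lemma exists_matching_of_embedding {k : ℕ} (φ : Option (Fin k × Bool) ↪ V) :
    ∃ f : Fin k → Finset V, Function.Injective f ∧
      ((univ.image f : Finset (Finset V)) : Set (Finset V)).PairwiseDisjoint id ∧
      (∀ i, φ none ∉ f i) ∧ ∀ i, ({none, some (i, false), some (i, true)} :
        Finset (Option (Fin k × Bool))).map φ = insert (φ none) (f i) := by
  refine ⟨fun i => {φ (some (i, false)), φ (some (i, true))}, ?_, ?_, ?_, ?_⟩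
  · intro i j h
    have : φ (some (i, false)) ∈ ({φ (some (j, false)), φ (some (j, true))} : Finset V) := by
      simp only at h; rw [← h]; simp
    simp only [mem_insert, mem_singleton, φ.injective.eq_iff, Option.some.injEq,
      Prod.mk.injEq] at this
    tauto
  · intro P hP P' hP' hne
    obtain ⟨i, -, rfl⟩ := mem_image.1 (mem_coe.1 hP)
    obtain ⟨j, -, rfl⟩ := mem_image.1 (mem_coe.1 hP')
    have hij : i ≠ j := fun h => hne (by rw [h])
    simp [Function.onFun, φ.injective.eq_iff, hij.symm]
  · intro i
    simp [φ.injective.eq_iff]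
  · intro i
    simp [map_insert]

lemma mem_kStar {k : ℕ} {e : Finset (Option (Fin k × Bool))} :
    e ∈ kStar k ↔ ∃ i : Fin k, {none, some (i, false), some (i, true)} = e := by
  simp [kStar]

lemma containsCopy_kStar_iff {k : ℕ} {H : Finset (Finset V)} (hH : ∀ e ∈ H, e.card = 3) :
    ContainsCopy (kStar k) H ↔ ∃ v Q, IsMatchingIn (link H v) Q ∧ Q.card = k := by
  constructor
  · rintro ⟨φ, hφ⟩
    obtain ⟨f, hf, hd, hn, he⟩ := exists_matching_of_embedding φ
    refine ⟨φ none, univ.image f, ⟨?_, hd⟩, by rw [card_image_of_injective _ hf]; simp⟩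
    intro P hP
    obtain ⟨i, -, rfl⟩ := mem_image.1 hP
    exact mem_link.2 ⟨hn i, he i ▸ hφ _ (mem_kStar.2 ⟨i, rfl⟩)⟩
  · rintro ⟨v, Q, hQ, hk⟩
    obtain ⟨φ, f, -, hfQ, he⟩ := exists_star_embedding hQ.2
      (fun P hP => card_of_mem_link hH (hQ.1 hP)) (fun P hP => (mem_link.1 (hQ.1 hP)).1) hk
    refine ⟨φ, fun e hek => ?_⟩
    obtain ⟨i, rfl⟩ := mem_kStar.1 hek
    rw [he]
    exact (mem_link.1 (hQ.1 (hfQ i))).2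

end Copies

section Turan

variable {n : ℕ}

lemma mem_completeEdges {r : ℕ} {e : Finset (Fin n)} : e ∈ completeEdges r n ↔ e.card = r := by
  simp [completeEdges, mem_powersetCard]

lemma hasRainbowCopy_kStar {k : ℕ} {c : Finset (Fin n) → ℕ} {v : Fin n}
    {Q : Finset (Finset (Fin n))} (hQ : (Q : Set (Finset (Fin n))).PairwiseDisjoint id)
    (h2 : ∀ P ∈ Q, P.card = 2) (hv : ∀ P ∈ Q, v ∉ P) (hk : Q.card = k)
    (hc : Set.InjOn (fun P => c (insert v P)) Q) : HasRainbowCopy 3 n (kStar k) c := by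
  obtain ⟨φ, f, hf, hfQ, he⟩ := exists_star_embedding hQ h2 hv hk
  refine ⟨φ, fun e hek => ?_, fun e hek e' hek' h => ?_⟩
  · obtain ⟨i, rfl⟩ := mem_kStar.1 hek
    rw [he, mem_completeEdges, card_insert_of_notMem (hv _ (hfQ i)), h2 _ (hfQ i)]
  · obtain ⟨i, rfl⟩ := mem_kStar.1 hek
    obtain ⟨j, rfl⟩ := mem_kStar.1 hek'
    rw [he, he] at h
    rw [hf (hc (hfQ i) (hfQ j) h)]

lemma starTuranNumber_bddAbove (n k : ℕ) :
    BddAbove {m : ℕ | ∃ H : Finset (Finset (Fin n)), (H : Set (Finset (Fin n))).Sized 3 ∧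
      ¬ ContainsCopy (kStar k) H ∧ H.card = m} := by
  refine ⟨(univ : Finset (Finset (Fin n))).card, ?_⟩
  rintro m ⟨H, -, -, rfl⟩
  exact card_le_univ H

lemma card_le_starTuranNumber {k : ℕ} {H : Finset (Finset (Fin n))} (hH : ∀ e ∈ H, e.card = 3)
    (hk : ∀ v Q, IsMatchingIn (link H v) Q → Q.card ≠ k) : H.card ≤ starTuranNumber n k := by
  refine le_csSup (starTuranNumber_bddAbove n k) ⟨H, fun e he => hH e he, ?_, rfl⟩
  rw [containsCopy_kStar_iff hH]
  rintro ⟨v, Q, hQ, hQk⟩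
  exact hk v Q hQ hQk

lemma exists_card_eq_starTuranNumber (n : ℕ) {k : ℕ} (hk : 1 ≤ k) :
    ∃ H : Finset (Finset (Fin n)), (∀ e ∈ H, e.card = 3) ∧
      (∀ v Q, IsMatchingIn (link H v) Q → Q.card < k) ∧ H.card = starTuranNumber n k := by
  have hne : {m : ℕ | ∃ H : Finset (Finset (Fin n)), (H : Set (Finset (Fin n))).Sized 3 ∧
      ¬ ContainsCopy (kStar k) H ∧ H.card = m}.Nonempty := by
    refine ⟨0, ∅, by simp [Set.Sized], ?_, rfl⟩
    rintro ⟨φ, hφ⟩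
    exact notMem_empty _ (hφ _ (mem_kStar.2 ⟨⟨0, hk⟩, rfl⟩))
  obtain ⟨H, h3, hH, hc⟩ := Nat.sSup_mem hne (starTuranNumber_bddAbove n k)
  have h3' : ∀ e ∈ H, e.card = 3 := fun e he => h3 he
  refine ⟨H, h3', fun v Q hQ => ?_, hc⟩
  by_contra! hle
  obtain ⟨Q', hQ', hQc⟩ := exists_subset_card_eq hle
  exact hH ((containsCopy_kStar_iff h3').2 ⟨v, Q', hQ.mono hQ' (hQ'.trans hQ.1), hQc⟩)

/-- With at most `f(n, k) + 1` colors a rainbow star with `k + 1` edges can be avoided: color some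
edges of an extremal 3-graph with different colors, and everything else with one more color. -/
lemma exists_coloring_without_rainbow {k t : ℕ} (hk : 1 ≤ k) (hn : 2 * k + 1 ≤ n) (ht : 1 ≤ t)
    (ht' : t ≤ starTuranNumber n k + 1) :
    ∃ c : Finset (Fin n) → ℕ, IsExactColoring 3 n t c ∧ ¬ HasRainbowCopy 3 n (kStar (k + 1)) c := by
  classical
  obtain ⟨H₀, h3, hfree, hcard⟩ := exists_card_eq_starTuranNumber n hk
  obtain ⟨H, hHH₀, hHc⟩ := exists_subset_card_eq (by omega : t - 1 ≤ H₀.card)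
  set c : Finset (Fin n) → ℕ := fun e => if h : e ∈ H then (H.equivFin ⟨e, h⟩ : ℕ) + 1 else 0
    with hc
  have hcH : ∀ e (h : e ∈ H), c e = (H.equivFin ⟨e, h⟩ : ℕ) + 1 := fun e h => by simp [hc, h]
  have hc0 : ∀ e, e ∉ H → c e = 0 := fun e h => by simp [hc, h]
  have hinj : Set.InjOn c H := by
    intro e he e' he' h
    rw [hcH e he, hcH e' he'] at h
    have := H.equivFin.injective (Fin.ext (Nat.succ_injective h))
    exact congrArg Subtype.val this
  have hsub : H ⊆ completeEdges 3 n := fun e he => mem_completeEdges.2 (h3 e (hHH₀ he))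
  obtain ⟨e₀, he₀, he₀H⟩ : ∃ e ∈ completeEdges 3 n, e ∉ H := by
    by_contra! hall
    obtain ⟨φ⟩ : Nonempty (Option (Fin k × Bool) ↪ Fin n) :=
      Function.Embedding.nonempty_of_card_le (by simp; omega)
    obtain ⟨v, Q, hQ, hQk⟩ := (containsCopy_kStar_iff (k := k) h3).1 ⟨φ, fun e he => by
      obtain ⟨i, rfl⟩ := mem_kStar.1 he
      refine hHH₀ (hall _ (mem_completeEdges.2 ?_))
      exact (card_map _).trans (card_eq_three.2 ⟨_, _, _, by simp, by simp, by simp, rfl⟩)⟩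
    exact (hfree v Q hQ).ne hQk
  refine ⟨c, ?_, ?_⟩
  · have himg : (completeEdges 3 n).image c = insert 0 (H.image c) := by
      ext m
      simp only [mem_image, mem_insert]
      constructor
      · rintro ⟨e, -, rfl⟩
        by_cases h : e ∈ H
        · exact Or.inr ⟨e, h, rfl⟩
        · exact Or.inl (hc0 e h)
      · rintro (rfl | ⟨e, he, rfl⟩)
        · exact ⟨e₀, he₀, hc0 _ he₀H⟩
        · exact ⟨e, hsub he, rfl⟩
    rw [IsExactColoring, himg, card_insert_of_notMem, card_image_of_injOn hinj, hHc]
    · omega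
    · intro h
      obtain ⟨e, he, h0⟩ := mem_image.1 h
      rw [hcH e he] at h0
      omega
  · rintro ⟨φ, -, hrb⟩
    obtain ⟨f, hf, hd, hno, he⟩ := exists_matching_of_embedding φ
    -- at most one edge of a rainbow copy has the exceptional color
    set Q := (univ.image f).filter fun P => insert (φ none) P ∈ H with hQ
    have hone : ((univ.image f).filter fun P => ¬ insert (φ none) P ∈ H).card ≤ 1 := by
      rw [card_le_one]
      intro P hP P' hP'
      obtain ⟨hP1, hP2⟩ := mem_filter.1 hP
      obtain ⟨hP1', hP2'⟩ := mem_filter.1 hP'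
      obtain ⟨i, -, rfl⟩ := mem_image.1 hP1
      obtain ⟨j, -, rfl⟩ := mem_image.1 hP1'
      have h1 := hrb _ (mem_kStar.2 ⟨i, rfl⟩) _ (mem_kStar.2 ⟨j, rfl⟩)
        (by rw [he, he, hc0 _ hP2, hc0 _ hP2'])
      have h2 := congrArg (fun e => e.map φ) h1
      simp only [he] at h2
      rw [← erase_insert (hno i), h2, erase_insert (hno j)]
    have htot := card_filter_add_card_filter_not (s := univ.image f)
      fun P => insert (φ none) P ∈ H
    rw [card_image_of_injective _ hf, card_univ, Fintype.card_fin, ← hQ] at htot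
    have hQm : IsMatchingIn (link H₀ (φ none)) Q := by
      refine ⟨fun P hP => ?_, hd.subset (by exact_mod_cast filter_subset _ _)⟩
      obtain ⟨hP1, hP2⟩ := mem_filter.1 hP
      obtain ⟨i, -, rfl⟩ := mem_image.1 hP1
      exact mem_link.2 ⟨hno i, hHH₀ hP2⟩
    have := hfree _ Q hQm
    omega

end Turan

/-! ### A lower bound for the Turán number of stars -/

section LowerBound

variable {V : Type*} [DecidableEq V]

/-- The complete graph on `A` has a small edge cover. -/
lemma exists_pair_cover {A : Finset V} (hA : 2 ≤ A.card) :
    ∃ R ⊆ powersetCard 2 A, R.card ≤ (A.card + 1) / 2 ∧ ∀ x ∈ A, ∃ P ∈ R, x ∈ P := by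
  induction A using Finset.strongInduction with
  | H A ih =>
  obtain ⟨a, ha, b, hb, hab⟩ := one_lt_card.1 hA
  have hpair : ({a, b} : Finset V) ⊆ A := insert_subset ha (singleton_subset_iff.2 hb)
  have hsd : (A \ {a, b}).card = A.card - 2 := by
    rw [card_sdiff_of_subset hpair, card_pair hab]
  by_cases h4 : 4 ≤ A.card
  · obtain ⟨R, hR, hRc, hcov⟩ := ih (A \ {a, b})
      (sdiff_ssubset hpair ⟨a, mem_insert_self _ _⟩) (by omega)
    refine ⟨insert {a, b} R, insert_subset (mem_powersetCard.2 ⟨hpair, card_pair hab⟩)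
      (hR.trans (powersetCard_mono sdiff_subset)), ?_, fun x hx => ?_⟩
    · have := card_insert_le {a, b} R
      omega
    · by_cases hxab : x ∈ ({a, b} : Finset V)
      · exact ⟨_, mem_insert_self _ _, hxab⟩
      · obtain ⟨P, hP, hxP⟩ := hcov x (mem_sdiff.2 ⟨hx, hxab⟩)
        exact ⟨P, mem_insert_of_mem hP, hxP⟩
  · rcases (A \ {a, b}).eq_empty_or_nonempty with he | ⟨w, hw⟩
    · refine ⟨{{a, b}}, ?_, ?_, fun x hx => ⟨_, mem_singleton_self _, ?_⟩⟩
      · exact singleton_subset_iff.2 (mem_powersetCard.2 ⟨hpair, card_pair hab⟩)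
      · rw [card_singleton]; omega
      · exact sdiff_eq_empty_iff_subset.1 he hx
    · obtain ⟨hwA, hwab⟩ := mem_sdiff.1 hw
      have haw : a ≠ w := fun h => hwab (by simp [h])
      have h3 : A.card = 3 := by
        have := card_pos.2 ⟨w, hw⟩
        omega
      have hw1 : A \ {a, b} = {w} := by
        refine (eq_of_subset_of_card_le (singleton_subset_iff.2 hw) ?_).symm
        rw [card_singleton]; omega
      refine ⟨{{a, b}, {a, w}}, ?_, ?_, fun x hx => ?_⟩
      · refine insert_subset (mem_powersetCard.2 ⟨hpair, card_pair hab⟩)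
          (singleton_subset_iff.2 (mem_powersetCard.2 ⟨?_, card_pair haw⟩))
        exact insert_subset ha (singleton_subset_iff.2 hwA)
      · exact card_le_two.trans (by omega)
      · by_cases hxab : x ∈ ({a, b} : Finset V)
        · exact ⟨_, mem_insert_self _ _, hxab⟩
        · have hxw : x ∈ ({w} : Finset V) := hw1 ▸ mem_sdiff.2 ⟨hx, hxab⟩
          exact ⟨{a, w}, by simp, by simpa using Or.inr (mem_singleton.1 hxw)⟩

lemma card_matching_le_half {A : Finset V} {Q : Finset (Finset V)}
    (hQ : IsMatchingIn (powersetCard 2 A) Q) : Q.card ≤ A.card / 2 := by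
  have h1 := card_cover (fun e he => (mem_powersetCard.1 he).2) hQ
  have h2 : (Q.biUnion id).card ≤ A.card :=
    card_le_card (biUnion_subset.2 fun P hP => (mem_powersetCard.1 (hQ.1 hP)).1)
  omega

variable {n : ℕ}

/-- A graph of maximum degree `d` and matching number `d`, given on two disjoint parts, yields a
3-graph without stars with `d + 1` edges: all triples which consist of an edge of the graph and a
vertex outside both parts. -/
lemma mul_le_starTuranNumber {d : ℕ} {A₁ A₂ : Finset (Fin n)} (hA : Disjoint A₁ A₂)
    (hA₁ : A₁.card ≤ d + 1) (hd : A₁.card / 2 + A₂.card / 2 ≤ d) {E : Finset (Finset (Fin n))}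
    (hE : E ⊆ powersetCard 2 A₂)
    (hdeg : ∀ x ∈ A₂, (A₂.filter fun y => {x, y} ∈ E).card ≤ d) :
    (A₁.card.choose 2 + E.card) * (n - (A₁.card + A₂.card)) ≤ starTuranNumber n (d + 1) := by
  classical
  set B := powersetCard 2 A₁ ∪ E with hB
  set X := A₁ ∪ A₂ with hX
  have hXc : X.card = A₁.card + A₂.card := card_union_of_disjoint hA
  have hBdisj : Disjoint (powersetCard 2 A₁) E := by
    refine disjoint_left.2 fun P hP hP' => ?_
    obtain ⟨h1, h2⟩ := mem_powersetCard.1 hP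
    obtain ⟨x, hx⟩ : P.Nonempty := card_pos.1 (by omega)
    exact disjoint_left.1 hA (h1 hx) ((mem_powersetCard.1 (hE hP')).1 hx)
  have hBX : ∀ P ∈ B, P ⊆ X ∧ P.card = 2 := by
    intro P hP
    rcases mem_union.1 hP with h | h
    · have := mem_powersetCard.1 h
      exact ⟨this.1.trans subset_union_left, this.2⟩
    · have := mem_powersetCard.1 (hE h)
      exact ⟨this.1.trans subset_union_right, this.2⟩
  set H := (B ×ˢ (univ \ X)).image fun p => insert p.2 p.1 with hH
  have hmem : ∀ e, e ∈ H ↔ ∃ P ∈ B, ∃ z, z ∉ X ∧ insert z P = e := by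
    intro e
    simp only [hH, mem_image, mem_product, mem_sdiff, mem_univ, true_and, Prod.exists]
    constructor
    · rintro ⟨P, z, ⟨h1, h2⟩, h3⟩; exact ⟨P, h1, z, h2, h3⟩
    · rintro ⟨P, h1, z, h2, h3⟩; exact ⟨P, z, ⟨h1, h2⟩, h3⟩
  have hcard : H.card = B.card * (n - X.card) := by
    rw [hH, card_image_of_injOn, card_product, card_sdiff_of_subset (subset_univ _), card_univ,
      Fintype.card_fin]
    rintro ⟨P, z⟩ hp ⟨P', z'⟩ hp' heq
    simp only [coe_product, Set.mem_prod, mem_coe, mem_sdiff, mem_univ, true_and] at hp hp' heq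
    have hz : z = z' := by
      have : z ∈ insert z' P' := heq ▸ mem_insert_self _ _
      rcases mem_insert.1 this with h | h
      · exact h
      · exact absurd ((hBX P' hp'.1).1 h) hp.2
    subst hz
    have hP : P = P' := by
      rw [← erase_insert (fun h => hp.2 ((hBX P hp.1).1 h)), heq,
        erase_insert (fun h => hp.2 ((hBX P' hp'.1).1 h))]
    rw [hP]
  have hBc : B.card = A₁.card.choose 2 + E.card := by
    rw [hB, card_union_of_disjoint hBdisj, card_powersetCard]
  rw [← hBc, ← hXc, ← hcard]
  refine card_le_starTuranNumber (fun e he => ?_) fun v Q hQ => ?_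
  · obtain ⟨P, hP, z, hz, rfl⟩ := (hmem e).1 he
    obtain ⟨h1, h2⟩ := hBX P hP
    rw [card_insert_of_notMem (fun h => hz (h1 h)), h2]
  suffices h : Q.card ≤ d by omega
  by_cases hv : v ∈ X
  · -- every edge through `v` contains one of the at most `d` neighbours of `v` in the graph
    set N := X.filter fun y => {v, y} ∈ B with hN
    have hNd : N.card ≤ d := by
      rcases mem_union.1 hv with hv1 | hv2
      · have hsub : N ⊆ A₁.erase v := by
          intro y hy
          obtain ⟨-, hyB⟩ := mem_filter.1 hy
          have h2 := (hBX _ hyB).2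
          have hvy : y ≠ v := by rintro rfl; simp at h2
          rcases mem_union.1 hyB with h | h
          · exact mem_erase.2 ⟨hvy, (mem_powersetCard.1 h).1 (by simp)⟩
          · exact absurd ((mem_powersetCard.1 (hE h)).1 (by simp)) (disjoint_left.1 hA hv1)
        have := card_le_card hsub
        rw [card_erase_of_mem hv1] at this
        omega
      · refine (card_le_card fun y hy => ?_).trans (hdeg v hv2)
        obtain ⟨-, hyB⟩ := mem_filter.1 hy
        rcases mem_union.1 hyB with h | h
        · exact absurd hv2 (disjoint_left.1 hA ((mem_powersetCard.1 h).1 (by simp)))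
        · exact mem_filter.2 ⟨(mem_powersetCard.1 (hE h)).1 (by simp), h⟩
    have hmeet : ∀ P ∈ Q, ∃ y ∈ P, y ∈ N := by
      intro P hP
      obtain ⟨hvP, hPH⟩ := mem_link.1 (hQ.1 hP)
      obtain ⟨P', hP', z, hz, heq⟩ := (hmem _).1 hPH
      have hvz : v ≠ z := fun h => hz (h ▸ hv)
      have hvP' : v ∈ P' := by
        have : v ∈ insert z P' := heq ▸ mem_insert_self _ _
        exact mem_of_mem_insert_of_ne this hvz
      obtain ⟨y, hyv, rfl⟩ := exists_eq_pair_of_mem (hBX P' hP').2 hvP'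
      have hyP : y ∈ insert v P := heq ▸ by simp
      exact ⟨y, mem_of_mem_insert_of_ne hyP hyv,
        mem_filter.2 ⟨(hBX _ hP').1 (by simp), hP'⟩⟩
    have : Nonempty (Fin n) := ⟨v⟩
    choose! g hgP hgN using hmeet
    refine (card_le_card_of_injOn g hgN fun P hP P' hP' heq => ?_).trans hNd
    by_contra hne
    exact disjoint_left.1 (hQ.2 hP hP' hne) (hgP P hP) (heq ▸ hgP P' hP')
  · have hQB : Q ⊆ B := by
      intro P hP
      obtain ⟨hvP, hPH⟩ := mem_link.1 (hQ.1 hP)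
      obtain ⟨P', hP', z, hz, heq⟩ := (hmem _).1 hPH
      have hvz : v = z := by
        have : v ∈ insert z P' := heq ▸ mem_insert_self _ _
        rcases mem_insert.1 this with h | h
        · exact h
        · exact absurd ((hBX P' hP').1 h) hv
      subst hvz
      rw [← erase_insert hvP, ← heq, erase_insert fun h => hv ((hBX P' hP').1 h)]
      exact hP'
    have h1 := card_matching_le_half (A := A₁) (Q := Q ∩ powersetCard 2 A₁)
      (hQ.mono inter_subset_left inter_subset_right)
    have h2 := card_matching_le_half (A := A₂) (Q := Q ∩ E)
      (hQ.mono inter_subset_left (inter_subset_right.trans hE))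
    have h3 : Q.card ≤ (Q ∩ powersetCard 2 A₁).card + (Q ∩ E).card := by
      refine le_trans (card_le_card fun P hP => ?_) (card_union_le _ _)
      rw [← inter_union_distrib_left]
      exact mem_inter.2 ⟨hP, hQB hP⟩
    omega

/-- The Chvátal–Hanson number is attained by graphs on `2 * d + 2` vertices: two complete graphs of
order `d + 1` for even `d`; for odd `d`, a complete graph of order `d` and a complete graph of
order `d + 2` from which an edge cover is removed. -/
lemma matchingBound_mul_le_starTuranNumber {d : ℕ} (hd : 2 ≤ d) (hn : 2 * d + 2 ≤ n) :
    matchingBound d d * (n - (2 * d + 2)) ≤ starTuranNumber n (d + 1) := by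
  classical
  have hex : ∀ a b, a + b = 2 * d + 2 → ∃ A₁ A₂ : Finset (Fin n), Disjoint A₁ A₂ ∧ A₁.card = a ∧
      A₂.card = b := by
    intro a b hab
    obtain ⟨A₁, -, h1⟩ := exists_subset_card_eq (s := (univ : Finset (Fin n))) (n := a)
      (by rw [card_univ, Fintype.card_fin]; omega)
    obtain ⟨A₂, h2, h3⟩ := exists_subset_card_eq (s := univ \ A₁) (n := b)
      (by rw [card_sdiff_of_subset (subset_univ _), card_univ, Fintype.card_fin]; omega)
    exact ⟨A₁, A₂, disjoint_left.2 fun x hx hx' => (mem_sdiff.1 (h2 hx')).2 hx, h1, h3⟩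
  rcases Nat.even_or_odd' d with ⟨m, rfl | rfl⟩
  · obtain ⟨A₁, A₂, hA, h1, h2⟩ := hex (2 * m + 1) (2 * m + 1) (by ring)
    have h := mul_le_starTuranNumber hA (d := 2 * m) (by omega) (by omega) subset_rfl
      (fun x hx => by
        refine (card_le_card (t := A₂.erase x) fun y hy => ?_).trans
          (by rw [card_erase_of_mem hx]; omega)
        obtain ⟨hy1, hy2⟩ := mem_filter.1 hy
        refine mem_erase.2 ⟨?_, hy1⟩
        rintro rfl
        have := (mem_powersetCard.1 hy2).2
        simp at this)
    rw [card_powersetCard, h1, h2] at h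
    have hM : matchingBound (2 * m) (2 * m) ≤ (2 * m + 1).choose 2 + (2 * m + 1).choose 2 := by
      have e1 : 2 * m / 2 = m := by omega
      have e2 : (2 * m + 1) / 2 = m := by omega
      have e3 : 2 * m / m = 2 := Nat.mul_div_cancel _ (by omega)
      rw [matchingBound, e1, e2, e3, Nat.choose_two_right, Nat.add_sub_cancel,
        show (2 * m + 1) * (2 * m) = (2 * m + 1) * m * 2 by ring, Nat.mul_div_cancel _ two_pos]
      nlinarith
    refine (Nat.mul_le_mul hM ?_).trans h
    omega
  · have hm : 1 ≤ m := by omega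
    obtain ⟨A₁, A₂, hA, h1, h2⟩ := hex (2 * m + 1) (2 * m + 3) (by ring)
    obtain ⟨R, hR, hRc, hcov⟩ := exists_pair_cover (A := A₂) (by omega)
    have h := mul_le_starTuranNumber hA (d := 2 * m + 1) (by omega) (by omega)
      (E := powersetCard 2 A₂ \ R) sdiff_subset (fun x hx => by
        obtain ⟨P, hP, hxP⟩ := hcov x hx
        obtain ⟨hPA, hPc⟩ := mem_powersetCard.1 (hR hP)
        obtain ⟨w, hwx, rfl⟩ := exists_eq_pair_of_mem hPc hxP
        have hwA : w ∈ A₂.erase x := mem_erase.2 ⟨hwx, hPA (by simp)⟩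
        refine (card_le_card (t := (A₂.erase x).erase w) fun y hy => ?_).trans
          (by rw [card_erase_of_mem hwA, card_erase_of_mem hx]; omega)
        obtain ⟨hy1, hy2⟩ := mem_filter.1 hy
        obtain ⟨hy3, hy4⟩ := mem_sdiff.1 hy2
        refine mem_erase.2 ⟨?_, mem_erase.2 ⟨?_, hy1⟩⟩
        · rintro rfl; exact hy4 hP
        · rintro rfl
          have := (mem_powersetCard.1 hy3).2
          simp at this)
    rw [card_sdiff_of_subset hR, card_powersetCard, h1, h2] at h
    rw [h2] at hRc
    have hM : matchingBound (2 * m + 1) (2 * m + 1) ≤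
        (2 * m + 1).choose 2 + ((2 * m + 3).choose 2 - R.card) := by
      rw [matchingBound_self_of_odd (by omega) (by omega), Nat.choose_two_right,
        Nat.choose_two_right, Nat.add_sub_cancel,
        show (2 * m + 1) * (2 * m) = (2 * m + 1) * m * 2 by ring, Nat.mul_div_cancel _ two_pos,
        show (2 * m + 3 - 1) = (m + 1) * 2 by omega, ← mul_assoc, Nat.mul_div_cancel _ two_pos]
      have e1 : (2 * m + 1) / 2 = m := by omega
      have e2 : (2 * m + 3 + 1) / 2 = m + 2 := by omega
      rw [e1]
      rw [e2] at hRc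
      have e3 : (2 * m + 1) * (2 * m + 1) + m + (m + 2) ≤
          (2 * m + 1) * m + (2 * m + 3) * (m + 1) := by nlinarith
      omega
    refine (Nat.mul_le_mul hM ?_).trans h
    omega

end LowerBound

/-! ### Links of nearly maximal load -/

section Typical

variable {V : Type*} [Fintype V] [DecidableEq V] {d : ℕ} {H : Finset (Finset V)} {σ : V → ℕ}

lemma lightLink_eq_link {z : V} (h : heavyNbrs d H z = ∅) : lightLink d H z = link H z := by
  simp [lightLink, h]

/-- If the net weight of the light link of `z` is close to the maximum, then a vertex `a` which all
matchings of `d` pairs cover has a large weighted degree, and `d` is odd. -/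
lemma weightedDegree_gt_of_unavoidable (hd : 2 ≤ d) (hH : ∀ e ∈ H, e.card = 3)
    (hσ : ∀ v Q, IsMatchingIn (link H v) Q → Q.card ≤ σ v) (hσd : ∀ v, σ v ≤ d) {z a : V}
    (h : heavyNbrs d H z = ∅) (hz : (matchingBound d d : ℚ) - 1 < load d H z)
    (ha : ∀ Q, IsMatchingIn (link H z) Q → Q.card = d → a ∈ Q.biUnion id) :
    d % 2 = 1 ∧ (d : ℚ) - 1 < weightedDegree (link H z) (heavyPairs d H) a := by
  have hcap := isCapped_lightLink hH hσ hσd z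
  have hload := load_le_of_heavyNbrs_eq_empty hd hH hσ hσd h
  rw [lightLink_eq_link h] at hcap hload
  have hnet := hcap.netWeight_le_of_unavoidable (by omega)
    (fun Q hQ => (hσ z Q hQ).trans (hσd z)) ha
  have hM := matchingBound_add_le hd (s := d - 1) (by omega)
  have hc := hcap.cap a
  have he := hcap.ex_nonneg a
  have hd' : ((d - 1 : ℕ) : ℚ) = d - 1 := by rw [Nat.cast_sub (by omega)]; norm_num
  have hdq : (2 : ℚ) ≤ d := by exact_mod_cast hd
  rw [hd'] at hM
  split_ifs at hM with hp
  · exfalso; linarith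
  · exact ⟨by omega, by linarith⟩

lemma card_link_filter_le {z a : V} (h : heavyNbrs d H z = ∅) :
    ((link H z).filter (a ∈ ·)).card ≤ 2 * d := by
  by_cases haz : z = a
  · subst haz
    rw [filter_false_of_mem fun P hP => (mem_link.1 hP).1]
    simp
  · by_contra! hlt
    have : a ∈ heavyNbrs d H z := (mem_heavyNbrs_iff haz).2 hlt
    simp [h] at this

/-- A vertex without heavy neighbours can be avoided in a link of large net weight. -/
lemma exists_matching_missing_of_heavyNbrs_eq_empty (hd : 2 ≤ d) (hH : ∀ e ∈ H, e.card = 3)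
    (hσ : ∀ v Q, IsMatchingIn (link H v) Q → Q.card ≤ σ v) (hσd : ∀ v, σ v ≤ d) {z a : V}
    (h : heavyNbrs d H z = ∅) (hz : (matchingBound d d : ℚ) - 1 < load d H z)
    (ha : heavyNbrs d H a = ∅) :
    ∃ Q, IsMatchingIn (link H z) Q ∧ Q.card = d ∧ a ∉ Q.biUnion id := by
  by_contra! hcon
  obtain ⟨hodd, hwd⟩ := weightedDegree_gt_of_unavoidable hd hH hσ hσd h hz hcon
  have hle : weightedDegree (link H z) (heavyPairs d H) a ≤ (2 * d : ℕ) * (1 / 3 : ℚ) := by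
    have h1 : weightedDegree (link H z) (heavyPairs d H) a =
        ∑ e ∈ link H z with a ∈ e, (1 / 3 : ℚ) := by
      refine sum_congr rfl fun e he => ?_
      obtain ⟨heE, hae⟩ := mem_filter.1 he
      refine if_neg fun heB => ?_
      obtain ⟨y, -, rfl⟩ := exists_eq_pair_of_mem (card_of_mem_heavyPairs heB) hae
      have : y ∈ heavyNbrs d H a := mem_heavyNbrs.2 heB
      simp [ha] at this
    rw [h1, sum_const, nsmul_eq_mul]
    have := card_link_filter_le (a := a) h
    gcongr
  have hd3 : (3 : ℚ) ≤ d := by exact_mod_cast (by omega : 3 ≤ d)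
  push_cast at hle
  linarith

/-- If all pairs through `a` in the link of `z` are heavy, then the weighted degree of `a` is at
most the number of heavy neighbours of `a`. -/
lemma weightedDegree_le_card_heavyNbrs {z a : V}
    (h : ∀ P ∈ link H z, a ∈ P → P ∈ heavyPairs d H) :
    weightedDegree (link H z) (heavyPairs d H) a ≤ (heavyNbrs d H a).card := by
  have h1 : weightedDegree (link H z) (heavyPairs d H) a =
      ∑ e ∈ link H z with a ∈ e, (1 : ℚ) := by
    refine sum_congr rfl fun e he => ?_
    obtain ⟨heE, hae⟩ := mem_filter.1 he
    exact if_pos (h e heE hae)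
  rw [h1, sum_const, nsmul_eq_mul, mul_one]
  refine Nat.cast_le.2 (le_trans (card_le_card fun e he => ?_)
    (card_heavy_le_card_heavyNbrs (E := link H z) a))
  obtain ⟨heE, hae⟩ := mem_filter.1 he
  exact mem_filter.2 ⟨heE, hae, h e heE hae⟩

/-- Few vertices `z` without heavy neighbours have a pair through `a` in their link which is not
heavy: the light link of `a` has no large matching, and its degrees are bounded. -/
lemma exists_cover_of_light (hH : ∀ e ∈ H, e.card = 3)
    (hσ : ∀ v Q, IsMatchingIn (link H v) Q → Q.card ≤ σ v) (hσd : ∀ v, σ v ≤ d) (a : V) :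
    ∃ X : Finset V, X.card ≤ 2 * d + 2 * d * (2 * d) ∧ ∀ z, heavyNbrs d H z = ∅ →
      (∃ P ∈ link H z, a ∈ P ∧ P ∉ heavyPairs d H) → z ∈ X := by
  have h2 : ∀ e ∈ lightLink d H a, e.card = 2 := fun e he =>
    card_of_mem_link hH (lightLink_subset a he)
  obtain ⟨Q, hQ, hmax⟩ := exists_max_matching (lightLink d H a)
  have hQd : Q.card ≤ d :=
    (Nat.le_of_add_right_le (card_matching_add_card_heavyNbrs_le hH hσ hσd a hQ)).trans (hσd a)
  set W := Q.biUnion id with hW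
  have hWc : W.card ≤ 2 * d := by rw [hW, card_cover h2 hQ]; omega
  have hmem : ∀ z, heavyNbrs d H z = ∅ → ∀ b, {a, b} ∈ link H z → {a, b} ∉ heavyPairs d H →
      {z, b} ∈ lightLink d H a := by
    intro z hz b hb hnb
    obtain ⟨hzn, hin⟩ := mem_link.1 hb
    have hc := card_of_mem_link hH hb
    have hab : a ≠ b := by rintro rfl; simp at hc
    refine mem_filter.2 ⟨mem_link.2 ⟨?_, ?_⟩, ?_⟩
    · simp only [mem_insert, mem_singleton, not_or] at hzn ⊢
      exact ⟨Ne.symm hzn.1, hab⟩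
    · rwa [insert_comm]
    · rw [disjoint_insert_left, disjoint_singleton_left]
      refine ⟨fun h => ?_, fun h => hnb (mem_heavyNbrs.1 h)⟩
      rw [mem_heavyNbrs_comm, hz] at h
      exact notMem_empty _ h
  refine ⟨W ∪ W.biUnion fun y => (((lightLink d H a).filter (y ∈ ·)).biUnion (·.erase y)), ?_, ?_⟩
  · refine (card_union_le _ _).trans (Nat.add_le_add hWc ?_)
    refine card_biUnion_le.trans ((sum_le_card_nsmul _ _ (2 * d) fun y hy => ?_).trans ?_)
    · obtain ⟨e, heQ, hye⟩ := mem_biUnion.1 hy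
      obtain ⟨heL, hdis⟩ := mem_filter.1 (hQ.1 heQ)
      have hay : a ≠ y := by
        rintro rfl
        exact (mem_link.1 heL).1 hye
      refine card_biUnion_le.trans ((sum_le_card_nsmul _ _ 1 fun P hP => ?_).trans ?_)
      · obtain ⟨hPL, hyP⟩ := mem_filter.1 hP
        rw [card_erase_of_mem hyP, h2 P hPL]
      · rw [smul_eq_mul, mul_one]
        by_contra! hlt
        refine disjoint_left.1 hdis hye ((mem_heavyNbrs_iff hay).2 (lt_of_lt_of_le hlt ?_))
        exact card_le_card (filter_subset_filter _ (lightLink_subset a))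
    · rw [smul_eq_mul]; gcongr
  · rintro z hz ⟨P, hP, haP, hPB⟩
    obtain ⟨b, -, rfl⟩ := exists_eq_pair_of_mem (card_of_mem_link hH hP) haP
    have hin := hmem z hz b hP hPB
    have hzb : z ≠ b := by rintro rfl; have := h2 _ hin; simp at this
    by_contra hout
    simp only [mem_union, not_or] at hout
    -- otherwise the pair `{z, b}` could be added to the maximum matching
    have hdisj : Disjoint ({z, b} : Finset V) W := by
      rw [disjoint_insert_left, disjoint_singleton_left]
      refine ⟨hout.1, fun hb => hout.2 (mem_biUnion.2 ⟨b, hb, mem_biUnion.2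
        ⟨{z, b}, mem_filter.2 ⟨hin, by simp⟩, by simp [hzb]⟩⟩)⟩
    have hnew := hmax _ (hQ.insert hin hdisj)
    rw [card_insert_of_notMem] at hnew
    · omega
    · intro hmemQ
      exact hout.1 (mem_biUnion.2 ⟨_, hmemQ, by simp⟩)

/-- If `y` has `d` heavy neighbours, then every other vertex is missed by some matching of `d`
pairs in the link of `y`. -/
lemma exists_matching_missing_of_full (hH : ∀ e ∈ H, e.card = 3) {y z : V}
    (hy : d ≤ (heavyNbrs d H y).card) (hz : z ∉ heavyNbrs d H y) :
    ∃ Q, IsMatchingIn (link H y) Q ∧ Q.card = d ∧ z ∉ Q.biUnion id := by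
  obtain ⟨J, hJ, hJc⟩ := exists_subset_card_eq hy
  obtain ⟨Q, hQ, -, hQc, hX⟩ := exists_matching_extend (fun P hP => card_of_mem_link hH hP) {z} J
    (D := 2 * d + 1) (disjoint_singleton_right.2 fun h => hz (hJ h)) (fun x hx => by
      have hx' := hJ hx
      exact (mem_heavyNbrs_iff (fun h => notMem_heavyNbrs_self y (by rwa [← h] at hx'))).1 hx')
    (isMatchingIn_empty _) (by simp) (by simp) (by simp; omega)
  exact ⟨Q, hQ, by simpa [hJc] using hQc, disjoint_singleton_left.1 hX⟩

/-- In a link of large net weight in which `a` cannot be avoided although its weighted degree comes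
from heavy pairs only, there is an avoidable vertex `y` with `d` heavy neighbours, none of which
is `a`. -/
lemma exists_full_of_unavoidable (hd : 2 ≤ d) (hH : ∀ e ∈ H, e.card = 3)
    (hσ : ∀ v Q, IsMatchingIn (link H v) Q → Q.card ≤ σ v) (hσd : ∀ v, σ v ≤ d) {z a : V}
    (h : heavyNbrs d H z = ∅) (hz : (matchingBound d d : ℚ) - 1 < load d H z)
    (ha : ∀ Q, IsMatchingIn (link H z) Q → Q.card = d → a ∈ Q.biUnion id)
    (hheavy : ∀ P ∈ link H z, a ∈ P → P ∈ heavyPairs d H) :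
    d ≤ (heavyNbrs d H a).card ∧ ∃ y, y ≠ z ∧ y ≠ a ∧ d ≤ (heavyNbrs d H y).card ∧
      a ∉ heavyNbrs d H y ∧ ∃ Q, IsMatchingIn (link H z) Q ∧ Q.card = d ∧ y ∉ Q.biUnion id := by
  obtain ⟨hodd, hwd⟩ := weightedDegree_gt_of_unavoidable hd hH hσ hσd h hz ha
  have hwd' := weightedDegree_le_card_heavyNbrs hheavy
  constructor
  · have : (d : ℚ) < (heavyNbrs d H a).card + 1 := by linarith
    have : d < (heavyNbrs d H a).card + 1 := by exact_mod_cast this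
    omega
  have hcap := isCapped_lightLink hH hσ hσd z
  have hload := load_le_of_heavyNbrs_eq_empty hd hH hσ hσd h
  rw [lightLink_eq_link h] at hcap hload
  obtain ⟨C, hC, y, hyC, hyd⟩ := hcap.exists_avoidable_class (by omega) hodd
    (fun Q hQ => (hσ z Q hQ).trans (hσd z)) (hz.trans_le hload)
  have haC : a ∉ C := fun haC => by
    obtain ⟨Q, hQ, hQc, haQ⟩ := hC a haC
    exact haQ (ha Q hQ hQc)
  have hsub : ((link H z).filter fun e => y ∈ e ∧ e ∈ heavyPairs d H ∧ e ⊆ C).card ≤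
      (heavyNbrs d H y ∩ C).card := by
    refine (card_le_card (t := (heavyNbrs d H y ∩ C).image fun x => {y, x}) ?_).trans card_image_le
    intro e he
    obtain ⟨-, hye, heB, heC⟩ := mem_filter.1 he
    obtain ⟨x, -, rfl⟩ := exists_eq_pair_of_mem (card_of_mem_heavyPairs heB) hye
    exact mem_image_of_mem _ (mem_inter.2 ⟨mem_heavyNbrs.2 heB, heC (by simp)⟩)
  have hle := (card_heavyNbrs_le hH hσ hσd y).trans (hσd y)
  have hsubC : heavyNbrs d H y ⊆ C := by
    have := eq_of_subset_of_card_le (inter_subset_left (s₁ := heavyNbrs d H y) (s₂ := C)) (by omega)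
    exact inter_eq_left.1 this
  refine ⟨y, ?_, fun hya => haC (hya ▸ hyC), ?_, fun hay => haC (hsubC hay), hC y hyC⟩
  · rintro rfl
    have h0 := hyd.trans hsub
    rw [h, empty_inter, card_empty] at h0
    omega
  · exact hyd.trans (hsub.trans (card_le_card inter_subset_left))

end Typical

/-! ### Popular colors -/

section Colors

variable {V : Type*} [DecidableEq V]

/-- `Q` is a matching of pairs which spans a rainbow star with core `v`. -/
structure IsRainbowMatching (c : Finset V → ℕ) (v : V) (Q : Finset (Finset V)) : Prop where
  disjoint : (Q : Set (Finset V)).PairwiseDisjoint id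
  card_eq : ∀ P ∈ Q, P.card = 2
  notMem : ∀ P ∈ Q, v ∉ P
  injOn : Set.InjOn (fun P => c (insert v P)) Q

/-- The colors of the star with core `v` spanned by `Q`. -/
def starColors (c : Finset V → ℕ) (v : V) (Q : Finset (Finset V)) : Finset ℕ :=
  Q.image fun P => c (insert v P)

lemma mem_starColors {c : Finset V → ℕ} {v : V} {Q : Finset (Finset V)} {γ : ℕ} :
    γ ∈ starColors c v Q ↔ ∃ P ∈ Q, c (insert v P) = γ := mem_image

lemma isRainbowMatching_empty (c : Finset V → ℕ) (v : V) : IsRainbowMatching c v ∅ :=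
  ⟨by simp, by simp, by simp, by simp⟩

lemma IsRainbowMatching.card_biUnion {c : Finset V → ℕ} {v : V} {Q : Finset (Finset V)}
    (hQ : IsRainbowMatching c v Q) : (Q.biUnion id).card = 2 * Q.card :=
  card_cover (E := Q) hQ.card_eq ⟨subset_rfl, hQ.disjoint⟩

lemma IsRainbowMatching.insert {c : Finset V → ℕ} {v : V} {Q : Finset (Finset V)}
    (hQ : IsRainbowMatching c v Q) {P : Finset V} (hP : P.card = 2) (hv : v ∉ P)
    (hd : Disjoint P (Q.biUnion id)) (hc : c (insert v P) ∉ starColors c v Q) :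
    IsRainbowMatching c v (insert P Q) ∧ (insert P Q).card = Q.card + 1 := by
  have hPQ : P ∉ Q := fun h => hc (mem_starColors.2 ⟨P, h, rfl⟩)
  refine ⟨⟨?_, ?_, ?_, ?_⟩, card_insert_of_notMem hPQ⟩
  · rw [coe_insert]
    refine hQ.disjoint.insert fun P' hP' _ => ?_
    exact (disjoint_biUnion_right _ _ _).1 hd P' hP'
  · exact fun P' hP' => (mem_insert.1 hP').elim (fun h => h ▸ hP) (hQ.card_eq P')
  · exact fun P' hP' => (mem_insert.1 hP').elim (fun h => h ▸ hv) (hQ.notMem P')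
  · rw [coe_insert, Set.injOn_insert (by simpa using hPQ)]
    refine ⟨hQ.injOn, ?_⟩
    rintro ⟨P', hP', h⟩
    exact hc (mem_starColors.2 ⟨P', hP', h⟩)

/-- All rainbow stars have at most `k` edges. -/
def RainbowBounded (k : ℕ) (c : Finset V → ℕ) : Prop :=
  ∀ v Q, IsRainbowMatching c v Q → Q.card ≤ k

variable [Fintype V]

/-- The popular colors at `v`: those which appear on an edge at `v` whose other two vertices avoid
any given `2 * k` vertices. -/
def popularColors (k : ℕ) (c : Finset V → ℕ) (v : V) : Finset ℕ :=
  (univ.image c).filter fun γ => ∀ T : Finset V, T.card ≤ 2 * k →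
    ∃ P : Finset V, P.card = 2 ∧ v ∉ P ∧ c (insert v P) = γ ∧ Disjoint P T

variable {k : ℕ} {c : Finset V → ℕ}

lemma mem_popularColors {v : V} {γ : ℕ} : γ ∈ popularColors k c v ↔ ∀ T : Finset V,
    T.card ≤ 2 * k → ∃ P : Finset V, P.card = 2 ∧ v ∉ P ∧ c (insert v P) = γ ∧ Disjoint P T := by
  rw [popularColors, mem_filter, and_iff_right_iff_imp]
  intro h
  obtain ⟨P, -, -, rfl, -⟩ := h ∅ (by simp)
  exact mem_image_of_mem _ (mem_univ _)

/-- Popular colors which do not appear in a rainbow star can be added to it one by one. -/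
lemma RainbowBounded.card_add_card_le (hb : RainbowBounded k c) {v : V} {Q : Finset (Finset V)}
    (hQ : IsRainbowMatching c v Q) {A : Finset ℕ} (hA : A ⊆ popularColors k c v)
    (hdis : Disjoint A (starColors c v Q)) : Q.card + A.card ≤ k := by
  have key : ∃ Q', IsRainbowMatching c v Q' ∧ Q'.card = Q.card + A.card ∧
      starColors c v Q' = A ∪ starColors c v Q := by
    induction A using Finset.induction_on with
    | empty => exact ⟨Q, hQ, by simp, by simp⟩
    | insert γ A hγ ih =>
      obtain ⟨Q', hQ', hQc, hcol⟩ := ih ((subset_insert _ _).trans hA)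
        (hdis.mono_left (subset_insert _ _))
      obtain ⟨P, hP2, hvP, hPγ, hPT⟩ := mem_popularColors.1 (hA (mem_insert_self _ _))
        (Q'.biUnion id) (by rw [hQ'.card_biUnion]; have := hb v Q' hQ'; omega)
      have hγ' : γ ∉ starColors c v Q' := by
        rw [hcol, mem_union, not_or]
        exact ⟨hγ, disjoint_left.1 hdis (mem_insert_self _ _)⟩
      obtain ⟨h1, h2⟩ := hQ'.insert hP2 hvP hPT (by rwa [hPγ])
      refine ⟨insert P Q', h1, by rw [h2, hQc, card_insert_of_notMem hγ, add_assoc], ?_⟩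
      rw [starColors, image_insert, hPγ, insert_union, ← hcol, starColors]
  obtain ⟨Q', hQ', hQc, -⟩ := key
  exact hQc ▸ hb v Q' hQ'

/-- A few vertices meet all edges at `v` whose color is not popular at `v`. -/
lemma RainbowBounded.exists_transversal (hb : RainbowBounded k c) (v : V) :
    ∃ T : Finset V, T.card ≤ 2 * (k + 1) * (k - (popularColors k c v).card) ∧
      ∀ P : Finset V, P.card = 2 → v ∉ P → Disjoint P T →
        c (insert v P) ∈ popularColors k c v := by
  classical
  set S := univ.filter fun Q : Finset (Finset V) =>
    IsRainbowMatching c v Q ∧ Disjoint (popularColors k c v) (starColors c v Q) with hS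
  obtain ⟨Q, hQS, hmax⟩ := exists_max_image S card
    ⟨∅, mem_filter.2 ⟨mem_univ _, isRainbowMatching_empty c v, by simp [starColors]⟩⟩
  obtain ⟨-, hQ, hdis⟩ := mem_filter.1 hQS
  have hcard := hb.card_add_card_le hQ subset_rfl hdis
  have hT : ∀ γ, ∃ T : Finset V, γ ∉ popularColors k c v → T.card ≤ 2 * k ∧
      ∀ P : Finset V, P.card = 2 → v ∉ P → c (insert v P) = γ → ¬ Disjoint P T := by
    intro γ
    by_cases h : γ ∈ popularColors k c v
    · exact ⟨∅, fun h' => absurd h h'⟩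
    · have h' := h
      rw [mem_popularColors] at h'
      push Not at h'
      obtain ⟨T, hT, hT'⟩ := h'
      exact ⟨T, fun _ => ⟨hT, hT'⟩⟩
  choose T hT using hT
  refine ⟨Q.biUnion id ∪ (starColors c v Q).biUnion T, ?_, fun P hP2 hvP hPd => ?_⟩
  · have h1 : ((starColors c v Q).biUnion T).card ≤ Q.card * (2 * k) := by
      refine card_biUnion_le.trans ((sum_le_card_nsmul _ _ (2 * k) fun γ hγ =>
        (hT γ (disjoint_right.1 hdis hγ)).1).trans ?_)
      rw [smul_eq_mul]
      exact Nat.mul_le_mul_right _ card_image_le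
    have h2 := hQ.card_biUnion
    calc _ ≤ _ := card_union_le _ _
      _ ≤ 2 * Q.card + Q.card * (2 * k) := by omega
      _ = 2 * (k + 1) * Q.card := by ring
      _ ≤ _ := Nat.mul_le_mul_left _ (by omega)
  · rw [disjoint_union_right] at hPd
    by_contra hpop
    by_cases hcol : c (insert v P) ∈ starColors c v Q
    · exact (hT _ hpop).2 P hP2 hvP rfl
        ((disjoint_biUnion_right _ _ _).1 hPd.2 _ hcol)
    · obtain ⟨h1, h2⟩ := hQ.insert hP2 hvP hPd.1 hcol
      have := hmax _ (mem_filter.2 ⟨mem_univ _, h1, by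
        rw [starColors, image_insert, disjoint_insert_right]
        exact ⟨hpop, hdis⟩⟩)
      omega

lemma exists_pair_disjoint {T : Finset V} (hT : T.card + 2 ≤ Fintype.card V) :
    ∃ P : Finset V, P.card = 2 ∧ Disjoint P T := by
  obtain ⟨P, hP, hP2⟩ := exists_subset_card_eq (s := univ \ T) (n := 2)
    (by rw [card_univ_sdiff]; omega)
  exact ⟨P, hP2, disjoint_left.2 fun x hx => (mem_sdiff.1 (hP hx)).2⟩

lemma RainbowBounded.one_le_card_popularColors (hb : RainbowBounded k c)
    (hn : 2 * (k + 1) * k + 3 ≤ Fintype.card V) (v : V) : 1 ≤ (popularColors k c v).card := by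
  by_contra! h0
  obtain ⟨T, hT, hpop⟩ := hb.exists_transversal v
  rw [Nat.lt_one_iff.1 h0, Nat.sub_zero] at hT
  obtain ⟨P, hP2, hPT⟩ := exists_pair_disjoint (T := insert v T) (by
    have := card_insert_le v T
    omega)
  rw [disjoint_insert_right] at hPT
  exact card_ne_zero_of_mem (hpop P hP2 hPT.1 hPT.2) (Nat.lt_one_iff.1 h0)

lemma RainbowBounded.card_popularColors_le (hb : RainbowBounded k c) (v : V) :
    (popularColors k c v).card ≤ k := by
  simpa using hb.card_add_card_le (isRainbowMatching_empty c v) subset_rfl (by simp [starColors])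

/-- The colors which are the only popular color at some vertex. -/
def soleColors (k : ℕ) (c : Finset V → ℕ) : Finset ℕ :=
  (univ.biUnion (popularColors k c)).filter fun α => ∃ v, popularColors k c v = {α}

lemma mem_soleColors {α : ℕ} : α ∈ soleColors k c ↔ ∃ v, popularColors k c v = {α} := by
  rw [soleColors, mem_filter, and_iff_right_iff_imp]
  rintro ⟨v, hv⟩
  exact mem_biUnion.2 ⟨v, mem_univ _, by simp [hv]⟩

/-- If a digraph of out-degree at most `t` joins any two vertices, then it has at most `2 * t + 1`
vertices. -/
lemma card_le_of_outdegree_le {α : Type*} [DecidableEq α] (R : Finset α) (N : α → Finset α) {t : ℕ}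
    (hN : ∀ a ∈ R, (N a).card ≤ t) (hR : ∀ a ∈ R, ∀ b ∈ R, a ≠ b → b ∈ N a ∨ a ∈ N b) :
    R.card ≤ 2 * t + 1 := by
  have h1 : R.offDiag ⊆ R.biUnion (fun a => (N a).image (a, ·)) ∪
      R.biUnion (fun a => (N a).image (·, a)) := by
    rintro ⟨a, b⟩ hab
    obtain ⟨ha, hb, hne⟩ := mem_offDiag.1 hab
    rcases hR a ha b hb hne with h | h
    · exact mem_union_left _ (mem_biUnion.2 ⟨a, ha, mem_image_of_mem _ h⟩)
    · exact mem_union_right _ (mem_biUnion.2 ⟨b, hb, mem_image_of_mem _ h⟩)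
  have h2 : R.offDiag.card ≤ R.card * t + R.card * t := by
    refine (card_le_card h1).trans ((card_union_le _ _).trans (Nat.add_le_add ?_ ?_)) <;>
    · refine card_biUnion_le.trans ((sum_le_card_nsmul _ _ t fun a ha => ?_).trans (by simp))
      exact card_image_le.trans (hN a ha)
  rw [offDiag_card] at h2
  by_contra! hlt
  have h3 : R.card * (2 * t + 2) ≤ R.card * R.card := Nat.mul_le_mul_left _ hlt
  have h4 : R.card * (2 * t + 2) = R.card * t + R.card * t + 2 * R.card := by ring
  omega

lemma exists_notMem_of_card_lt {T : Finset V} (hT : T.card < Fintype.card V) : ∃ x, x ∉ T := by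
  by_contra! h
  rw [eq_univ_of_forall h, card_univ] at hT
  exact lt_irrefl _ hT

/-- There are few sole colors: if `u` and `v` have different sole popular colors, then `v` lies in
the transversal at `u` or the other way round, as an edge through `u`, `v` and a vertex off both
transversals has only one color. -/
lemma RainbowBounded.card_soleColors_le (hb : RainbowBounded k c)
    (hn : 4 * (k + 1) * (k - 1) + 3 ≤ Fintype.card V) :
    (soleColors k c).card ≤ 4 * (k + 1) * (k - 1) + 1 := by
  rcases isEmpty_or_nonempty V with hV | hV
  · simp [soleColors]
  have h : ∀ α ∈ soleColors k c, ∃ v, popularColors k c v = {α} := fun α hα => mem_soleColors.1 hα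
  choose! a ha using h
  choose T hT hpop using hb.exists_transversal
  have hTc : ∀ α ∈ soleColors k c, (T (a α)).card ≤ 2 * (k + 1) * (k - 1) := by
    intro α hα
    have := hT (a α)
    rwa [ha α hα, card_singleton] at this
  have hmain := card_le_of_outdegree_le (soleColors k c)
    (fun α => (soleColors k c).filter fun β => a β ∈ T (a α)) (t := 2 * (k + 1) * (k - 1)) ?_ ?_
  · refine hmain.trans (le_of_eq ?_)
    ring
  · intro α hα
    refine le_trans ?_ (hTc α hα)
    refine card_le_card_of_injOn a (fun β hβ => (mem_filter.1 hβ).2) fun β hβ γ hγ heq => ?_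
    have h1 := ha β (mem_filter.1 hβ).1
    rw [heq, ha γ (mem_filter.1 hγ).1] at h1
    exact (singleton_injective h1).symm
  · intro α hα β hβ hne
    by_contra! hcon
    simp only [mem_filter, not_and] at hcon
    have hβT := hcon.1 hβ
    have hαT := hcon.2 hα
    have haab : a α ≠ a β := fun heq => hne (singleton_injective (by
      rw [← ha α hα, ← ha β hβ, heq]))
    obtain ⟨x, hx⟩ := exists_notMem_of_card_lt (T := insert (a α) (insert (a β)
        (T (a α) ∪ T (a β)))) (by
      have h1 := card_insert_le (a α) (insert (a β) (T (a α) ∪ T (a β)))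
      have h2 := card_insert_le (a β) (T (a α) ∪ T (a β))
      have h3 := card_union_le (T (a α)) (T (a β))
      have h4 := hTc α hα
      have h5 := hTc β hβ
      have h6 : 4 * (k + 1) * (k - 1) = 2 * (k + 1) * (k - 1) + 2 * (k + 1) * (k - 1) := by ring
      omega)
    simp only [mem_insert, mem_union, not_or] at hx
    obtain ⟨hxα, hxβ, hxTα, hxTβ⟩ := hx
    have h1 := hpop (a α) {a β, x} (card_pair (Ne.symm hxβ))
      (by simp [haab, Ne.symm hxα]) (by simp [hβT, hxTα])
    have h2 := hpop (a β) {a α, x} (card_pair (Ne.symm hxα))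
      (by simp [haab.symm, Ne.symm hxβ]) (by simp [hαT, hxTβ])
    rw [ha α hα, mem_singleton] at h1
    rw [ha β hβ, mem_singleton, insert_comm] at h2
    exact hne (h1.symm.trans h2)

end Colors

/-! ### Unpopular edges and typical vertices -/

section Unpopular

variable {V : Type*} [Fintype V] [DecidableEq V]

/-- The edges of `G` whose color is neither popular at one of their vertices nor the sole popular
color at some vertex. -/
def unpopularEdges (k : ℕ) (c : Finset V → ℕ) (G : Finset (Finset V)) : Finset (Finset V) :=
  G.filter fun e => c e ∉ soleColors k c ∧ ∀ v ∈ e, c e ∉ popularColors k c v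

/-- The number of edges which a rainbow star with core `v` can have when none of its colors is
popular at `v`. -/
def starSlack (k : ℕ) (c : Finset V → ℕ) (v : V) : ℕ := k - (popularColors k c v).card

variable {k d : ℕ} {c : Finset V → ℕ} {G : Finset (Finset V)}

lemma isRainbowMatching_of_link (hG : ∀ e ∈ G, e.card = 3) (hc : Set.InjOn c G) {v : V}
    {Q : Finset (Finset V)} (hQ : IsMatchingIn (link G v) Q) : IsRainbowMatching c v Q := by
  refine ⟨hQ.2, fun P hP => card_of_mem_link hG (hQ.1 hP), fun P hP => (mem_link.1 (hQ.1 hP)).1,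
    fun P hP P' hP' h => ?_⟩
  obtain ⟨h1, h2⟩ := mem_link.1 (hQ.1 hP)
  obtain ⟨h1', h2'⟩ := mem_link.1 (hQ.1 hP')
  rw [← erase_insert h1, hc h2 h2' h, erase_insert h1']

lemma uniform_unpopularEdges (hG : ∀ e ∈ G, e.card = 3) : ∀ e ∈ unpopularEdges k c G, e.card = 3 :=
  fun e he => hG e (mem_filter.1 he).1

lemma injOn_unpopularEdges (hc : Set.InjOn c G) : Set.InjOn c (unpopularEdges k c G) :=
  hc.mono (coe_subset.2 (filter_subset _ _))

lemma disjoint_starColors_unpopularEdges {v : V} {Q : Finset (Finset V)}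
    (hQ : Q ⊆ link (unpopularEdges k c G) v) :
    Disjoint (popularColors k c v) (starColors c v Q) := by
  refine disjoint_right.2 fun γ hγ => ?_
  obtain ⟨P, hP, rfl⟩ := mem_starColors.1 hγ
  exact (mem_filter.1 (mem_link.1 (hQ hP)).2).2.2 v (mem_insert_self _ _)

lemma RainbowBounded.card_matching_le_starSlack (hb : RainbowBounded k c)
    (hG : ∀ e ∈ G, e.card = 3) (hc : Set.InjOn c G) (v : V) (Q : Finset (Finset V))
    (hQ : IsMatchingIn (link (unpopularEdges k c G) v) Q) : Q.card ≤ starSlack k c v := by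
  have := hb.card_add_card_le (isRainbowMatching_of_link (uniform_unpopularEdges hG)
    (injOn_unpopularEdges hc) hQ) subset_rfl (disjoint_starColors_unpopularEdges hQ.1)
  unfold starSlack
  omega

/-- The other edges of `G` have a sole popular color, or a color popular at a vertex with several
popular colors; and the colors of the edges of `G` are different. -/
lemma card_le_card_unpopularEdges_add (hc : Set.InjOn c G)
    (hp : ∀ v, 1 ≤ (popularColors k c v).card) :
    G.card ≤ (unpopularEdges k c G).card + ((soleColors k c).card +
      ∑ v, if 2 ≤ (popularColors k c v).card then (popularColors k c v).card else 0) := by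
  rw [unpopularEdges, ← card_filter_add_card_filter_not
    (fun e => c e ∉ soleColors k c ∧ ∀ v ∈ e, c e ∉ popularColors k c v)]
  refine Nat.add_le_add_left ?_ _
  have hsub : ∀ e ∈ G.filter (fun e => ¬ (c e ∉ soleColors k c ∧
      ∀ v ∈ e, c e ∉ popularColors k c v)), c e ∈ soleColors k c ∪ univ.biUnion fun v =>
        if 2 ≤ (popularColors k c v).card then popularColors k c v else ∅ := by
    intro e he
    have he' := (mem_filter.1 he).2
    by_cases hR : c e ∈ soleColors k c
    · exact mem_union_left _ hR
    · simp only [hR, not_false_eq_true, true_and] at he'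
      push Not at he'
      obtain ⟨v, -, hv⟩ := he'
      refine mem_union_right _ (mem_biUnion.2 ⟨v, mem_univ _, ?_⟩)
      rw [if_pos]
      · exact hv
      · by_contra! hlt
        have h1 : (popularColors k c v).card = 1 := by have := hp v; omega
        obtain ⟨α, hα⟩ := card_eq_one.1 h1
        rw [hα, mem_singleton] at hv
        exact hR (mem_soleColors.2 ⟨v, hv ▸ hα⟩)
  refine (card_le_card_of_injOn c hsub (hc.mono (coe_subset.2 (filter_subset _ _)))).trans
    ((card_union_le _ _).trans (Nat.add_le_add_left
      (card_biUnion_le.trans (sum_le_sum fun v _ => ?_)) _))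
  split_ifs <;> simp

/-- The vertices at which only one color is popular, which have no heavy neighbours in the
hypergraph of the unpopular edges, and whose load is close to the maximum. -/
def typicalVertices (d : ℕ) (c : Finset V → ℕ) (G : Finset (Finset V)) : Finset V :=
  univ.filter fun z => (popularColors (d + 1) c z).card = 1 ∧
    heavyNbrs d (unpopularEdges (d + 1) c G) z = ∅ ∧
    (matchingBound d d : ℚ) - 1 < load d (unpopularEdges (d + 1) c G) z

lemma matchingBound_self_le (d : ℕ) : matchingBound d d ≤ d * (d + 1) := by
  unfold matchingBound
  have h : d / 2 * (d / ((d + 1) / 2)) ≤ d := by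
    rcases Nat.even_or_odd' d with ⟨m, rfl | rfl⟩
    · have h1 : (2 * m + 1) / 2 = m := by omega
      have h2 : 2 * m / 2 = m := by omega
      rw [h1, h2]
      exact Nat.mul_div_le _ _
    · have h1 : (2 * m + 1 + 1) / 2 = m + 1 := by omega
      have h2 : (2 * m + 1) / 2 = m := by omega
      rw [h1, h2]
      exact (Nat.mul_le_mul_right _ (Nat.le_succ m)).trans (Nat.mul_div_le _ _)
  nlinarith

/-- The loads add up to the number of unpopular edges, and the load of a vertex which is not
typical, together with its popular colors if there are several, is at most `matchingBound d d - 1`.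
Hence `G` can only be large if most vertices are typical. -/
lemma RainbowBounded.card_le_card_typicalVertices_add (hd : 2 ≤ d) (hb : RainbowBounded (d + 1) c)
    (hG : ∀ e ∈ G, e.card = 3) (hc : Set.InjOn c G)
    (hn : 2 * (d + 2) * (d + 1) + 3 ≤ Fintype.card V) :
    G.card + Fintype.card V ≤ matchingBound d d * Fintype.card V + (soleColors (d + 1) c).card +
      (typicalVertices d c G).card := by
  set H := unpopularEdges (d + 1) c G with hHdef
  set σ := starSlack (d + 1) c with hσdef
  set p := fun v => (popularColors (d + 1) c v).card with hpdef
  have hp : ∀ v, 1 ≤ p v := hb.one_le_card_popularColors hn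
  have hp' : ∀ v, p v ≤ d + 1 := hb.card_popularColors_le
  have hσp : ∀ v, σ v = d + 1 - p v := fun v => rfl
  have hH : ∀ e ∈ H, e.card = 3 := uniform_unpopularEdges hG
  have hσ : ∀ v Q, IsMatchingIn (link H v) Q → Q.card ≤ σ v := hb.card_matching_le_starSlack hG hc
  have hσd : ∀ v, σ v ≤ d := fun v => by have := hp v; have := hσp v; omega
  have h1 : G.card ≤ H.card + ((soleColors (d + 1) c).card + ∑ v, if 2 ≤ p v then p v else 0) :=
    card_le_card_unpopularEdges_add hc hp
  have h2 : ∀ z, load d H z + ((if 2 ≤ p z then p z else 0 : ℕ) : ℚ) ≤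
      matchingBound d d - 1 + if z ∈ typicalVertices d c G then 1 else 0 := by
    intro z
    have hloss : ((if 2 ≤ p z then p z else 0 : ℕ) : ℚ) =
        if σ z < d then (d - σ z : ℚ) + 1 else 0 := by
      have ha := hp z
      have hb' := hp' z
      have hs := hσp z
      by_cases h : 2 ≤ p z
      · rw [if_pos h, if_pos (by omega)]
        have : d + 1 = σ z + p z := by omega
        have : (d : ℚ) + 1 = σ z + p z := by exact_mod_cast this
        linarith
      · rw [if_neg h, if_neg (by omega), Nat.cast_zero]
    by_cases hdef : σ z < d ∨ heavyNbrs d H z ≠ ∅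
    · have h3 := load_le_of_deficient hd hH hσ hσd z hdef
      rw [hloss]
      refine h3.trans (le_add_of_nonneg_right ?_)
      split_ifs <;> norm_num
    · push Not at hdef
      have hs := hσp z
      have hz := hp z
      rw [if_neg (by omega), Nat.cast_zero, add_zero]
      split_ifs with htyp
      · have hcap := isCapped_lightLink hH hσ hσd z
        have h3 := load_le_of_heavyNbrs_eq_empty hd hH hσ hσd hdef.2
        have h4 := hcap.netWeight_le_matchingBound (by omega) (s := d) fun Q hQ =>
          (hσ z Q (hQ.mono subset_rfl (hQ.1.trans (lightLink_subset z)))).trans (hσd z)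
        linarith
      · by_contra! hlt
        refine htyp (mem_filter.2 ⟨mem_univ _, ?_, hdef.2, by linarith⟩)
        change p z = 1
        omega
  have h3 := sum_le_sum fun z (_ : z ∈ univ) => h2 z
  simp only [sum_add_distrib, sum_load hH, sum_const, card_univ, nsmul_eq_mul, sum_ite_mem,
    univ_inter, mul_one, ← Nat.cast_sum] at h3
  have h4 : (G.card : ℚ) ≤ H.card + ((soleColors (d + 1) c).card +
      ((∑ v, if 2 ≤ p v then p v else 0 : ℕ) : ℚ)) := by exact_mod_cast h1
  have h5 : ((G.card + Fintype.card V : ℕ) : ℚ) ≤ (matchingBound d d * Fintype.card V +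
      (soleColors (d + 1) c).card + (typicalVertices d c G).card : ℕ) := by
    push_cast at h3 h4 ⊢
    linarith
  exact_mod_cast h5

end Unpopular

/-! ### A color in all large rainbow stars -/

section CommonColor

variable {V : Type*} [Fintype V] [DecidableEq V] {d : ℕ} {c : Finset V → ℕ}
  {G : Finset (Finset V)}

/-- If `α` is the only popular color at `u`, and `Q` consists of `d` unpopular pairs at `u`, then an
edge at `u` which avoids `Q` has color `α` or a color of `Q`. -/
lemma RainbowBounded.color_eq_or_mem (hb : RainbowBounded (d + 1) c) (hG : ∀ e ∈ G, e.card = 3)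
    (hc : Set.InjOn c G) {u v x : V} {α : ℕ} (hu : popularColors (d + 1) c u = {α})
    {Q : Finset (Finset V)} (hQ : IsMatchingIn (link (unpopularEdges (d + 1) c G) u) Q)
    (hQd : Q.card = d) (huv : u ≠ v) (hux : u ≠ x) (hvx : v ≠ x) (hv : v ∉ Q.biUnion id)
    (hx : x ∉ Q.biUnion id) : c {u, v, x} = α ∨ c {u, v, x} ∈ starColors c u Q := by
  by_contra! hcon
  have hr := isRainbowMatching_of_link (uniform_unpopularEdges hG) (injOn_unpopularEdges hc) hQ
  obtain ⟨h1, h2⟩ := hr.insert (P := {v, x}) (card_pair hvx) (by simp [huv, hux])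
    (by rw [disjoint_insert_left, disjoint_singleton_left]; exact ⟨hv, hx⟩) hcon.2
  have h3 := hb.card_add_card_le h1 (A := {α}) (by rw [hu]) (by
    have := disjoint_starColors_unpopularEdges hQ.1
    rw [hu, disjoint_singleton_left] at this
    rw [disjoint_singleton_left, starColors, image_insert, mem_insert, not_or]
    exact ⟨fun h => hcon.1 h.symm, this⟩)
  rw [card_singleton] at h3
  omega

/-- Two vertices with a single popular color each have the same popular color, provided that each of
them is missed by a matching of `d` unpopular pairs at the other one. -/
lemma RainbowBounded.sole_color_eq (hb : RainbowBounded (d + 1) c) (hG : ∀ e ∈ G, e.card = 3)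
    (hc : Set.InjOn c G) (hn : 4 * d + 3 ≤ Fintype.card V) {u v : V} {α β : ℕ} (huv : u ≠ v)
    (hu : popularColors (d + 1) c u = {α}) (hv : popularColors (d + 1) c v = {β})
    (hQu : ∃ Q, IsMatchingIn (link (unpopularEdges (d + 1) c G) u) Q ∧ Q.card = d ∧
      v ∉ Q.biUnion id)
    (hQv : ∃ Q, IsMatchingIn (link (unpopularEdges (d + 1) c G) v) Q ∧ Q.card = d ∧
      u ∉ Q.biUnion id) : α = β := by
  obtain ⟨Q, hQ, hQd, hvQ⟩ := hQu
  obtain ⟨Q', hQ', hQd', huQ'⟩ := hQv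
  have hc1 := (isRainbowMatching_of_link (uniform_unpopularEdges hG)
    (injOn_unpopularEdges hc) hQ).card_biUnion
  have hc2 := (isRainbowMatching_of_link (uniform_unpopularEdges hG)
    (injOn_unpopularEdges hc) hQ').card_biUnion
  obtain ⟨x, hx⟩ := exists_notMem_of_card_lt (T := insert u (insert v
      (Q.biUnion id ∪ Q'.biUnion id))) (by
    have h1 := card_insert_le u (insert v (Q.biUnion id ∪ Q'.biUnion id))
    have h2 := card_insert_le v (Q.biUnion id ∪ Q'.biUnion id)
    have h3 := card_union_le (Q.biUnion id) (Q'.biUnion id)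
    omega)
  rw [mem_insert, mem_insert, mem_union] at hx
  push Not at hx
  obtain ⟨hxu, hxv, hxQ, hxQ'⟩ := hx
  have hα := hb.color_eq_or_mem hG hc hu hQ hQd huv (Ne.symm hxu) (Ne.symm hxv) hvQ hxQ
  have hβ := hb.color_eq_or_mem hG hc hv hQ' hQd' huv.symm (Ne.symm hxv) (Ne.symm hxu) huQ' hxQ'
  rw [insert_comm] at hβ
  have hαR : α ∈ soleColors (d + 1) c := mem_soleColors.2 ⟨u, hu⟩
  have hβR : β ∈ soleColors (d + 1) c := mem_soleColors.2 ⟨v, hv⟩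
  have hedge : ∀ {w : V} {R : Finset (Finset V)},
      R ⊆ link (unpopularEdges (d + 1) c G) w → ∀ {γ}, γ ∈ starColors c w R →
      ∃ P ∈ R, insert w P ∈ G ∧ c (insert w P) = γ ∧ γ ∉ soleColors (d + 1) c := by
    intro w R hR γ hγ
    obtain ⟨P, hP, rfl⟩ := mem_starColors.1 hγ
    have := mem_filter.1 (mem_link.1 (hR hP)).2
    exact ⟨P, hP, this.1, rfl, this.2.1⟩
  rcases hα with hα | hα
  · rcases hβ with hβ | hβ
    · exact hα.symm.trans hβ
    · obtain ⟨-, -, -, -, h⟩ := hedge hQ'.1 hβ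
      exact absurd (hα ▸ hαR) h
  · obtain ⟨P, hP, hPG, hPc, h⟩ := hedge hQ.1 hα
    rcases hβ with hβ | hβ
    · exact absurd (hβ ▸ hβR) h
    · obtain ⟨P', hP', hPG', hPc', -⟩ := hedge hQ'.1 hβ
      -- the edges at `u` and at `v` of this color coincide, although the former avoids `v`
      have heq := hc hPG hPG' (hPc.trans hPc'.symm)
      have hvP : v ∈ insert u P := heq ▸ mem_insert_self v P'
      exact absurd (mem_biUnion.2 ⟨P, hP, mem_of_mem_insert_of_ne hvP huv.symm⟩) hvQ

/-- A small set `X` of exceptional vertices for the comparison of a rainbow star `S` with core `a`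
and a typical vertex `z`: off `X`, no unpopular edge through `z` has a color of `S`, and all pairs
through `a` in the link of `z` are heavy. -/
lemma exists_cover_of_star (hd : 2 ≤ d) (hb : RainbowBounded (d + 1) c) (hG : ∀ e ∈ G, e.card = 3)
    (hc : Set.InjOn c G) (hn : 2 * (d + 2) * (d + 1) + 3 ≤ Fintype.card V) {a : V}
    {S : Finset (Finset V)} (hS : IsRainbowMatching c a S) (hSc : S.card = d + 1) :
    ∃ X : Finset V, X.card ≤ 4 * d * d + 7 * d + 6 ∧ a ∈ X ∧ S.biUnion id ⊆ X ∧
      (∀ e ∈ unpopularEdges (d + 1) c G, c e ∈ starColors c a S → e ⊆ X) ∧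
      ∀ z, heavyNbrs d (unpopularEdges (d + 1) c G) z = ∅ → z ∉ X →
        ∀ P ∈ link (unpopularEdges (d + 1) c G) z, a ∈ P →
          P ∈ heavyPairs d (unpopularEdges (d + 1) c G) := by
  set H := unpopularEdges (d + 1) c G with hHdef
  have hp : ∀ v, 1 ≤ (popularColors (d + 1) c v).card := hb.one_le_card_popularColors hn
  have hH : ∀ e ∈ H, e.card = 3 := uniform_unpopularEdges hG
  have hσ : ∀ v Q, IsMatchingIn (link H v) Q → Q.card ≤ starSlack (d + 1) c v :=
    hb.card_matching_le_starSlack hG hc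
  have hσd : ∀ v, starSlack (d + 1) c v ≤ d := fun v => by
    have := hp v
    unfold starSlack
    omega
  obtain ⟨X, hX, hcov⟩ := exists_cover_of_light hH hσ hσd a
  set F := H.filter fun e => c e ∈ starColors c a S with hF
  have hFc : F.card ≤ d + 1 := by
    refine (card_le_card_of_injOn (t := starColors c a S) c (fun e he => (mem_filter.1 he).2)
      ((injOn_unpopularEdges hc).mono (coe_subset.2 (filter_subset _ _)))).trans ?_
    exact card_image_le.trans hSc.le
  have hFc' : (F.biUnion id).card ≤ (d + 1) * 3 := by
    refine card_biUnion_le.trans ((sum_le_card_nsmul _ _ 3 fun e he =>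
      (hH e (mem_filter.1 he).1).le).trans ?_)
    rw [smul_eq_mul]
    gcongr
  refine ⟨insert a (S.biUnion id ∪ (F.biUnion id ∪ X)), ?_, mem_insert_self _ _, ?_, ?_, ?_⟩
  · have h1 := card_insert_le a (S.biUnion id ∪ (F.biUnion id ∪ X))
    have h2 := card_union_le (S.biUnion id) (F.biUnion id ∪ X)
    have h3 := card_union_le (F.biUnion id) X
    have h4 := hS.card_biUnion
    have h5 : 2 * d * (2 * d) = 4 * d * d := by ring
    omega
  · exact subset_union_left.trans (subset_insert _ _)
  · intro e he hce
    have heF : e ∈ F := mem_filter.2 ⟨he, hce⟩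
    refine (subset_biUnion_of_mem id heF).trans ?_
    exact subset_union_left.trans (subset_union_right.trans (subset_insert _ _))
  · intro z hz hzX P hP haP
    by_contra hPB
    exact hzX (mem_insert_of_mem (mem_union_right _ (mem_union_right _
      (hcov z hz ⟨P, hP, haP, hPB⟩))))

/-- If there are many typical vertices, then all rainbow stars of the largest size use one and the
same color `α`, namely the sole popular color at the typical vertices. -/
lemma RainbowBounded.exists_unavoidable_color (hd : 2 ≤ d) (hb : RainbowBounded (d + 1) c)
    (hG : ∀ e ∈ G, e.card = 3) (hc : Set.InjOn c G)
    (hn : 2 * (d + 2) * (d + 1) + 3 ≤ Fintype.card V)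
    (htyp : 4 * d * d + 7 * d + 6 < (typicalVertices d c G).card) :
    ∃ α, ∀ a S, IsRainbowMatching c a S → S.card = d + 1 → α ∈ starColors c a S := by
  set H := unpopularEdges (d + 1) c G with hHdef
  have hp : ∀ v, 1 ≤ (popularColors (d + 1) c v).card := hb.one_le_card_popularColors hn
  have hH : ∀ e ∈ H, e.card = 3 := uniform_unpopularEdges hG
  have hσ : ∀ v Q, IsMatchingIn (link H v) Q → Q.card ≤ starSlack (d + 1) c v :=
    hb.card_matching_le_starSlack hG hc
  have hσd : ∀ v, starSlack (d + 1) c v ≤ d := fun v => by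
    have := hp v
    unfold starSlack
    omega
  have hn' : 4 * d + 5 ≤ Fintype.card V := by nlinarith
  have htyp' : ∀ z ∈ typicalVertices d c G, (∃ α, popularColors (d + 1) c z = {α}) ∧
      heavyNbrs d H z = ∅ ∧ (matchingBound d d : ℚ) - 1 < load d H z := fun z hz => by
    obtain ⟨-, h1, h2⟩ := mem_filter.1 hz
    exact ⟨card_eq_one.1 h1, h2⟩
  obtain ⟨z₀, hz₀⟩ := card_pos.1 (Nat.zero_lt_of_lt htyp)
  obtain ⟨⟨α, hα⟩, hh₀, hl₀⟩ := htyp' z₀ hz₀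
  have hcommon : ∀ z ∈ typicalVertices d c G, popularColors (d + 1) c z = {α} := by
    intro z hz
    obtain ⟨⟨β, hβ⟩, hh, hl⟩ := htyp' z hz
    by_cases hzz : z = z₀
    · rw [hzz, hα]
    · rw [hβ, hb.sole_color_eq hG hc (by omega) hzz hβ hα
        (exists_matching_missing_of_heavyNbrs_eq_empty hd hH hσ hσd hh hl hh₀)
        (exists_matching_missing_of_heavyNbrs_eq_empty hd hH hσ hσd hh₀ hl₀ hh)]
  refine ⟨α, fun a S hS hSc => ?_⟩
  by_contra hαS
  obtain ⟨X, hXc, haX, hSX, hcolX, hlightX⟩ := exists_cover_of_star hd hb hG hc hn hS hSc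
  obtain ⟨z, hz, hzX⟩ := exists_mem_notMem_of_card_lt_card (hXc.trans_lt htyp)
  have hza : z ≠ a := fun h => hzX (h ▸ haX)
  obtain ⟨-, hh, hl⟩ := htyp' z hz
  have hzα := hcommon z hz
  have hSb := hS.card_biUnion
  by_cases hav : ∃ Q, IsMatchingIn (link H z) Q ∧ Q.card = d ∧ a ∉ Q.biUnion id
  · obtain ⟨Q, hQ, hQd, haQ⟩ := hav
    have hQb := (isRainbowMatching_of_link hH (injOn_unpopularEdges hc) hQ).card_biUnion
    obtain ⟨x, hx⟩ := exists_notMem_of_card_lt (T := insert a (insert z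
        (Q.biUnion id ∪ S.biUnion id))) (by
      have h1 := card_insert_le a (insert z (Q.biUnion id ∪ S.biUnion id))
      have h2 := card_insert_le z (Q.biUnion id ∪ S.biUnion id)
      have h3 := card_union_le (Q.biUnion id) (S.biUnion id)
      omega)
    rw [mem_insert, mem_insert, mem_union] at hx
    push Not at hx
    obtain ⟨hxa, hxz, hxQ, hxS⟩ := hx
    -- otherwise the edge `{z, a, x}` extends `S`
    have hin : c {z, a, x} ∈ starColors c a S := by
      by_contra hout
      rw [insert_comm] at hout
      obtain ⟨h1, h2⟩ := hS.insert (P := {z, x}) (card_pair (Ne.symm hxz))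
        (by simp [hza.symm, Ne.symm hxa])
        (by
          rw [disjoint_insert_left, disjoint_singleton_left]
          exact ⟨fun h => hzX (hSX h), hxS⟩) hout
      have := hb a _ h1
      omega
    rcases hb.color_eq_or_mem hG hc hzα hQ hQd hza (Ne.symm hxz) (Ne.symm hxa) haQ hxQ with h | h
    · exact hαS (h ▸ hin)
    · obtain ⟨P, hP, hPc⟩ := mem_starColors.1 h
      exact hzX (hcolX _ (mem_link.1 (hQ.1 hP)).2 (hPc ▸ hin) (mem_insert_self _ _))
  · push Not at hav
    obtain ⟨haf, y, hyz, hya, hyf, hay, hyQ⟩ := exists_full_of_unavoidable hd hH hσ hσd hh hl hav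
      (hlightX z hh hzX)
    have hsole : ∀ w, d ≤ (heavyNbrs d H w).card → ∃ β, popularColors (d + 1) c w = {β} := by
      intro w hw
      refine card_eq_one.1 (le_antisymm ?_ (hp w))
      have h1 := hw.trans (card_heavyNbrs_le hH hσ hσd w)
      unfold starSlack at h1
      omega
    -- the sole color `α` passes from `z` to `y` and on to `a`, where it extends `S`
    obtain ⟨β, hβ⟩ := hsole y hyf
    obtain ⟨γ, hγ⟩ := hsole a haf
    have hzy : z ∉ heavyNbrs d H y := by
      rw [mem_heavyNbrs_comm, hh]
      exact notMem_empty _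
    have h1 := hb.sole_color_eq hG hc (by omega) hyz hβ hzα
      (exists_matching_missing_of_full hH hyf hzy) hyQ
    have h2 := hb.sole_color_eq hG hc (by omega) hya hβ hγ
      (exists_matching_missing_of_full hH hyf hay)
      (exists_matching_missing_of_full hH haf (by rwa [mem_heavyNbrs_comm]))
    have h3 := hb.card_add_card_le hS (A := {α}) (by rw [hγ, ← h2, h1])
      (disjoint_singleton_left.2 hαS)
    rw [card_singleton] at h3
    omega

end CommonColor

/-! ### The upper bound for the anti-Ramsey number -/

section Main

/-- A coloring with `f(n, k) + 2` colors contains a rainbow star with `k + 1` edges. -/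
lemma hasRainbowCopy_of_isExactColoring {k n : ℕ} (hk : 3 ≤ k)
    (hn : 5 * k ^ 3 + 15 * k ^ 2 + 52 * k < 2 * n + 6) {c : Finset (Fin n) → ℕ}
    (hc : IsExactColoring 3 n (starTuranNumber n k + 2) c) :
    HasRainbowCopy 3 n (kStar (k + 1)) c := by
  by_contra hno
  obtain ⟨d, rfl⟩ : ∃ d, k = d + 1 := ⟨k - 1, by omega⟩
  have hd : 2 ≤ d := by omega
  have hb : RainbowBounded (d + 1) c := by
    intro v Q hQ
    by_contra! hlt
    obtain ⟨Q', hQ', hQc⟩ := exists_subset_card_eq (Nat.succ_le_of_lt hlt)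
    exact hno (hasRainbowCopy_kStar (hQ.disjoint.subset (coe_subset.2 hQ'))
      (fun P hP => hQ.card_eq P (hQ' hP)) (fun P hP => hQ.notMem P (hQ' hP)) hQc
      (hQ.injOn.mono (coe_subset.2 hQ')))
  obtain ⟨G, hGs, hGc, hGi⟩ := exists_subset_injOn_image_eq_of_surjOn
    (completeEdges 3 n : Set (Finset (Fin n))) ((completeEdges 3 n).image c)
    (by rw [coe_image]; exact Set.surjOn_image _ _)
  have hG : ∀ e ∈ G, e.card = 3 := fun e he => mem_completeEdges.1 (hGs he)
  have hGcard : G.card = starTuranNumber n (d + 1) + 2 := by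
    rw [← hc, ← hGi, card_image_of_injOn hGc]
  have hn1 : 2 * (d + 2) * (d + 1) + 3 ≤ n := by nlinarith [sq_nonneg d]
  have hn2 : 4 * (d + 2) * d + 3 ≤ n := by nlinarith [sq_nonneg d]
  have hturan := matchingBound_mul_le_starTuranNumber hd (n := n) (by nlinarith)
  have htyp := hb.card_le_card_typicalVertices_add hd hG hGc (by simpa using hn1)
  have hsole := hb.card_soleColors_le (by simpa using hn2)
  have hM := matchingBound_self_le d
  obtain ⟨α, hα⟩ := hb.exists_unavoidable_color hd hG hGc (by simpa using hn1) (by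
    rw [Fintype.card_fin] at htyp
    obtain ⟨m, rfl⟩ : ∃ m, n = m + (2 * d + 2) := ⟨n - (2 * d + 2), by
      have : 2 * d + 2 ≤ n := by nlinarith
      omega⟩
    rw [Nat.add_sub_cancel] at hturan
    rw [Nat.add_sub_cancel] at hsole
    have h1 : matchingBound d d * (2 * d + 2) ≤ d * (d + 1) * (2 * d + 2) :=
      Nat.mul_le_mul_right _ hM
    rw [mul_add] at htyp
    nlinarith)
  -- the edges of the other colors form a hypergraph without stars
  have hle := card_le_starTuranNumber (n := n) (k := d + 1) (H := G.filter fun e => c e ≠ α)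
    (fun e he => hG e (mem_filter.1 he).1) fun v Q hQ hQc => by
      have hr := isRainbowMatching_of_link (fun e he => hG e (mem_filter.1 he).1)
        (hGc.mono (coe_subset.2 (filter_subset _ _))) hQ
      obtain ⟨P, hP, hPα⟩ := mem_starColors.1 (hα v Q hr hQc)
      exact (mem_filter.1 (mem_link.1 (hQ.1 hP)).2).2 hPα
  have hone : (G.filter fun e => ¬ c e ≠ α).card ≤ 1 := by
    refine card_le_one.2 fun e he e' he' => ?_
    obtain ⟨h1, h2⟩ := mem_filter.1 he
    obtain ⟨h1', h2'⟩ := mem_filter.1 he'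
    exact hGc h1 h1' ((not_not.1 h2).trans (not_not.1 h2').symm)
  have hsplit := card_filter_add_card_filter_not (s := G) fun e => c e ≠ α
  omega

end Main

end AntiRamsey

theorem theorem1p5 (k n : ℕ) (hk : 3 ≤ k)
    (hn : (n : ℝ) > 5 / 2 * (k : ℝ) ^ 3 + 15 / 2 * (k : ℝ) ^ 2 + 26 * (k : ℝ) - 3) :
    AntiRamsey.antiRamseyNumber 3 n (AntiRamsey.kStar (k + 1)) =
      AntiRamsey.starTuranNumber n k + 2 := by
  have hn' : 5 * k ^ 3 + 15 * k ^ 2 + 52 * k < 2 * n + 6 := by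
    have : (5 * k ^ 3 + 15 * k ^ 2 + 52 * k : ℝ) < 2 * n + 6 := by linarith
    exact_mod_cast this
  have hmem : AntiRamsey.starTuranNumber n k + 2 ∈ {t : ℕ | 1 ≤ t ∧ ∀ c : Finset (Fin n) → ℕ,
      AntiRamsey.IsExactColoring 3 n t c →
        AntiRamsey.HasRainbowCopy 3 n (AntiRamsey.kStar (k + 1)) c} :=
    ⟨by omega, fun c hc => AntiRamsey.hasRainbowCopy_of_isExactColoring hk hn' hc⟩
  refine le_antisymm (Nat.sInf_le hmem) (le_csInf ⟨_, hmem⟩ ?_)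
  rintro t ⟨ht, hrain⟩
  by_contra! hlt
  obtain ⟨c, hc, hno⟩ := AntiRamsey.exists_coloring_without_rainbow (n := n) (k := k) (t := t)
    (by omega) (by nlinarith [sq_nonneg k]) ht (by omega)
  exact hno (hrain c hc)
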